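/- Let $p$ be an odd prime and let $M=\mathbb{Q}^*\cap\mathbb{Z}_{(p)}\hookrightarrow\mathbb{Z}_{(p)}$ be the canonical log structure. A ($p$-typical) Witt complex over a $\mathbb{Z}_{(p)}$-algebra $A$ consists of graded-commutative graded rings $E_n^*$ ($n\ge 0$, $*\ge 0$, $E_0^*=0$) with graded ring maps $R,F:E_{n+1}^*\to E_n^*$, graded additive maps $V:E_n^*\to E_{n+1}^*$ and $d:E_n^*\to E_n^{*+1}$, where $F,V,d$ commute with $R$, and ring maps $\lambda:W_n(A)\to E_n^0$ compatible with $R,F,V$, such that $d$ is a graded derivation with $dd=0$, $V(x)y=V(xF(y))$, $FV=p$, $FdV=d$, and $Fd\lambda([a]_{n+1})=\lambda([a]_n)^{p-1}d\lambda([a]_n)$ for $a\in A$. A Witt complex over a log ring $(A,\alpha:M\to A)$ is a Witt complex over $A$ together with a monoid $M_E$, maps of monoids $\alpha_n:M_E\to E_n^0$ (multiplicative) and $d\log:M_E\to E_n^1$ (to the additive group), compatible with $R$, with $\alpha_n(m)\,d\log m=d\alpha_n(m)$ and $d(d\log m)=0$, and a map of monoids $\lambda:M\to M_E$ with $\alpha_n(\lambda(a))=\lambda([\alpha(a)]_n)$;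 for $a\in M$ write $d\log[a]_n\in E_n^1$ for $d\log\lambda(a)$, and require $F(d\log[a]_{n+1})=d\log[a]_n$. Maps are maps of graded rings compatible with all the structure. The de Rham–Witt complexes $W_\bullet\Omega^*_A$ and $W_\bullet\Omega^*_{(A,M)}$ are the initial objects of the corresponding categories. Write $V^i(1)=V^i([1]_{n-i})$ at level $n$ (zero if $i\ge n$), and $dV^i(1)=d(V^i(1))$. **Theorem.** The complexes $W_\bullet\Omega^*_{\mathbb{Z}_{(p)}}$ and $W_\bullet\Omega^*_{(\mathbb{Z}_{(p)},M)}$ exist, and have the following structure, for all $n\ge 0$. (i) The canonical map $W_n\Omega^0_{\mathbb{Z}_{(p)}}\to W_n\Omega^0_{(\mathbb{Z}_{(p)},M)}$ is an isomorphism, and $\lambda$ identifies both with $W_n(\mathbb{Z}_{(p)})=\bigoplus_{i=0}^{n-1}\mathbb{Z}_{(p)}\cdot V^i(1)$. In degree one, $$W_n\Omega^1_{\mathbb{Z}_{(p)}}=\bigoplus_{i=1}^{n-1}\mathbb{Z}/p^i\mathbb{Z}\cdot dV^i(1),\qquad W_n\Omega^1_{(\mathbb{Z}_{(p)},M)}=W_n\Omega^1_{\mathbb{Z}_{(p)}}\oplus\mathbb{Z}/p^n\mathbb{Z}\cdot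 d\log[p]_n,$$ where $W_n\Omega^1_{\mathbb{Z}_{(p)}}$ is embedded by the canonical map. Both complexes vanish in degrees $\ge 2$. (ii) In $W_n\Omega^*_{(\mathbb{Z}_{(p)},M)}$: $V^i(1)V^j(1)=p^iV^j(1)$ for $i\le j$; $V^i(1)\,dV^j(1)=p^i\,dV^j(1)$ for $i<j$, and $V^i(1)\,dV^j(1)=0$ for $i\ge j$; and for $i\ge 1$ $$V^i(1)\,d\log[p]_n=\begin{cases}3^i\,d\log[3]_n+3^{i-1}\,dV^i(1)+3^i\,dV^{i+1}(1),&p=3,\\ p^i\,d\log[p]_n+p^{i-1}\,dV^i(1),&p\ge 5.\end{cases}$$ (iii) $FV^{i}(1)=pV^{i-1}(1)$ and $FdV^{i}(1)=dV^{i-1}(1)$ for $i\ge1$; $V(V^i(1))=V^{i+1}(1)$ and $V(dV^i(1))=p\,dV^{i+1}(1)$ for $i\ge0$; $F(d\log[p]_{n+1})=d\log[p]_n$; and $$V(d\log[p]_n)=\begin{cases}3\,d\log[3]_{n+1}+dV([1]_n)+3\,dV^2([1]_{n-1}),&p=3,\\ p\,d\log[p]_{n+1}+dV([1]_n),&p\ge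 5.\end{cases}$$ -/

import Mathlib

open CategoryTheory CategoryTheory.Limits

universe v u w

/-- A (`p`-typical, `p` an odd prime) Witt complex over a commutative ring `A` (in practice a
`ℤ_(p)`-algebra). The level is indexed by `n : ℕ`, the object of level `0` being zero.
At each level `n` there is a graded ring `obj n`, whose part of degree `q` is the subgroup
`gr n q`. The maps `R`, `F`, `V`, `d` are given on the whole graded rings and are homogeneous.
The ring of Witt vectors of length `n` is `TruncatedWittVector p n A`; its restriction, Frobenius
and Verschiebung maps are induced by those of `WittVector p A` through the surjections
`WittVector.truncate n`. -/
structure WittComplex (p : ℕ) [Fact p.Prime] (A : Type u) [CommRing A] : Type (max u (v + 1)) where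
  /-- the graded ring of level `n` -/
  obj : ℕ → Type v
  [ring : ∀ n, Ring (obj n)]
  /-- the homogeneous part of degree `q` -/
  gr : ∀ n : ℕ, ℕ → AddSubgroup (obj n)
  one_mem : ∀ n, 1 ∈ gr n 0
  mul_mem : ∀ n i j x y, x ∈ gr n i → y ∈ gr n j → x * y ∈ gr n (i + j)
  isInternal : ∀ n, DirectSum.IsInternal (gr n)
  graded_comm : ∀ n i j x y, x ∈ gr n i → y ∈ gr n j → x * y = (-1) ^ (i * j) * (y * x)
  level_zero : Subsingleton (obj 0)
  /-- restriction -/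
  R : ∀ n, obj (n + 1) →+* obj n
  R_mem : ∀ n q x, x ∈ gr (n + 1) q → R n x ∈ gr n q
  /-- the strict map of pro-rings from the Witt vectors of `A` -/
  lam : ∀ n, TruncatedWittVector p n A →+* obj n
  lam_mem : ∀ n x, lam n x ∈ gr n 0
  R_lam : ∀ n (x : WittVector p A),
    R n (lam (n + 1) (WittVector.truncate (n + 1) x)) = lam n (WittVector.truncate n x)
  /-- Frobenius -/
  F : ∀ n, obj (n + 1) →+* obj n
  F_mem : ∀ n q x, x ∈ gr (n + 1) q → F n x ∈ gr n q
  R_F : ∀ n x, R n (F (n + 1) x) = F n (R (n + 1) x)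
  F_lam : ∀ n (x : WittVector p A),
    F n (lam (n + 1) (WittVector.truncate (n + 1) x)) =
      lam n (WittVector.truncate n (WittVector.frobenius x))
  /-- Verschiebung -/
  V : ∀ n, obj n →+ obj (n + 1)
  V_mem : ∀ n q x, x ∈ gr n q → V n x ∈ gr (n + 1) q
  R_V : ∀ n x, R (n + 1) (V (n + 1) x) = V n (R n x)
  V_lam : ∀ n (x : WittVector p A),
    V n (lam n (WittVector.truncate n x)) =
      lam (n + 1) (WittVector.truncate (n + 1) (WittVector.verschiebung x))
  V_mul : ∀ n x y, V n x * y = V n (x * F n y)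
  F_V : ∀ n x, F n (V n x) = p • x
  /-- the differential -/
  d : ∀ n, obj n →+ obj n
  d_mem : ∀ n q x, x ∈ gr n q → d n x ∈ gr n (q + 1)
  R_d : ∀ n x, R n (d (n + 1) x) = d n (R n x)
  d_mul : ∀ n q x y, x ∈ gr n q → d n (x * y) = d n x * y + (-1) ^ q * (x * d n y)
  d_d : ∀ n x, d n (d n x) = 0
  F_d_V : ∀ n x, F n (d (n + 1) (V n x)) = d n x
  F_d_teichmuller : ∀ n (a : A),
    F n (d (n + 1) (lam (n + 1) (WittVector.truncate (n + 1) (WittVector.teichmuller p a)))) =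
      lam n (WittVector.truncate n (WittVector.teichmuller p a)) ^ (p - 1) *
        d n (lam n (WittVector.truncate n (WittVector.teichmuller p a)))

attribute [instance] WittComplex.ring

namespace WittComplex

variable {p : ℕ} [Fact p.Prime] {A : Type u} [CommRing A]

/-- A map of Witt complexes: a map of pro-graded rings compatible with `λ`, `d`, `F`, `V`. -/
@[ext]
structure Hom (D E : WittComplex.{v} p A) : Type v where
  map : ∀ n, D.obj n →+* E.obj n
  map_mem : ∀ n q x, x ∈ D.gr n q → map n x ∈ E.gr n q
  map_R : ∀ n x, map n (D.R n x) = E.R n (map (n + 1) x)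
  map_lam : ∀ n x, map n (D.lam n x) = E.lam n x
  map_d : ∀ n x, map n (D.d n x) = E.d n (map n x)
  map_F : ∀ n x, map n (D.F n x) = E.F n (map (n + 1) x)
  map_V : ∀ n x, map (n + 1) (D.V n x) = E.V n (map n x)

/-- The identity map. -/
def Hom.id (E : WittComplex.{v} p A) : Hom E E where
  map n := RingHom.id _
  map_mem _ _ _ h := h
  map_R _ _ := rfl
  map_lam _ _ := rfl
  map_d _ _ := rfl
  map_F _ _ := rfl
  map_V _ _ := rfl

/-- Composition of maps. -/
def Hom.comp {C D E : WittComplex.{v} p A} (f : Hom C D) (g : Hom D E) : Hom C E where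
  map n := (g.map n).comp (f.map n)
  map_mem n q x h := g.map_mem n q _ (f.map_mem n q x h)
  map_R n x := by simp [f.map_R, g.map_R]
  map_lam n x := by simp [f.map_lam, g.map_lam]
  map_d n x := by simp [f.map_d, g.map_d]
  map_F n x := by simp [f.map_F, g.map_F]
  map_V n x := by simp [f.map_V, g.map_V]

/-- The category of Witt complexes over `A`; its initial object is the de Rham-Witt complex
of `A`. -/
instance : Category (WittComplex.{v} p A) where
  Hom D E := Hom D E
  id E := Hom.id E
  comp f g := Hom.comp f g

/-- The element `V^i(1) = V^i([1]_{n-i})` of level `n` and degree `0`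
(for `i ≥ n` it comes from the zero ring of level `0`, so it is zero). -/
def vOne (E : WittComplex.{v} p A) : ∀ n : ℕ, ℕ → E.obj n
  | _, 0 => 1
  | 0, _ + 1 => 0
  | n + 1, i + 1 => E.V n (vOne E n i)

/-- The element `dV^i(1)` of level `n` and degree `1`. -/
def dvOne (E : WittComplex.{v} p A) (n i : ℕ) : E.obj n := E.d n (E.vOne n i)

end WittComplex

/-- A Witt complex over the log ring `(A, M)` given by the map of monoids `α : M →* A`: a Witt
complex over `A`, with a monoid `mon` and (compatible) pre-log structures `mon →* obj n` in degree
zero, making each level a log differential graded ring, together with an extension of `λ` to a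
strict map of pro-log rings from `(W_n(A), M)`, where `M` maps to `W_n(A)` by `a ↦ [α a]_n`. -/
structure LogWittComplex (p : ℕ) [Fact p.Prime] {A : Type u} [CommRing A] {M : Type w}
    [CommMonoid M] (α : M →* A) : Type (max u w (v + 1)) extends WittComplex.{v} p A where
  /-- the monoid of the pre-log structures -/
  mon : Type v
  [commMonoid : CommMonoid mon]
  /-- the pre-log structures -/
  pre : ∀ n, mon →* obj n
  pre_mem : ∀ n a, pre n a ∈ gr n 0
  R_pre : ∀ n a, R n (pre (n + 1) a) = pre n a
  /-- `λ` on the monoids -/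
  lamMon : M →* mon
  pre_lamMon : ∀ n a,
    pre n (lamMon a) = lam n (WittVector.truncate n (WittVector.teichmuller p (α a)))
  /-- the logarithmic derivation -/
  dlog : ∀ n, mon → obj n
  dlog_mem : ∀ n a, dlog n a ∈ gr n 1
  dlog_one : ∀ n, dlog n 1 = 0
  dlog_mul : ∀ n a b, dlog n (a * b) = dlog n a + dlog n b
  pre_mul_dlog : ∀ n a, pre n a * dlog n a = d n (pre n a)
  R_dlog : ∀ n a, R n (dlog (n + 1) a) = dlog n a
  d_dlog : ∀ n a, d n (dlog n a) = 0
  F_dlog : ∀ n (a : M), F n (dlog (n + 1) (lamMon a)) = dlog n (lamMon a)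

attribute [instance] LogWittComplex.commMonoid

namespace LogWittComplex

variable {p : ℕ} [Fact p.Prime] {A : Type u} [CommRing A] {M : Type w} [CommMonoid M] {α : M →* A}

/-- A map of Witt complexes over a log ring. -/
@[ext]
structure Hom (D E : LogWittComplex.{v} p α) : Type v extends
    WittComplex.Hom D.toWittComplex E.toWittComplex where
  mapMon : D.mon →* E.mon
  mapMon_lamMon : ∀ a, mapMon (D.lamMon a) = E.lamMon a
  map_pre : ∀ n a, map n (D.pre n a) = E.pre n (mapMon a)
  map_dlog : ∀ n a, map n (D.dlog n a) = E.dlog n (mapMon a)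

/-- The identity map. -/
def Hom.id (E : LogWittComplex.{v} p α) : Hom E E where
  toHom := WittComplex.Hom.id E.toWittComplex
  mapMon := MonoidHom.id _
  mapMon_lamMon _ := rfl
  map_pre _ _ := rfl
  map_dlog _ _ := rfl

/-- Composition of maps. -/
def Hom.comp {C D E : LogWittComplex.{v} p α} (f : Hom C D) (g : Hom D E) : Hom C E where
  toHom := WittComplex.Hom.comp f.toHom g.toHom
  mapMon := g.mapMon.comp f.mapMon
  mapMon_lamMon a := by simp [f.mapMon_lamMon, g.mapMon_lamMon]
  map_pre n a := by simp [WittComplex.Hom.comp, f.map_pre, g.map_pre]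
  map_dlog n a := by simp [WittComplex.Hom.comp, f.map_dlog, g.map_dlog]

/-- The category of Witt complexes over `(A, M)`; its initial object is the de Rham-Witt complex
of `(A, M)`. -/
instance : Category (LogWittComplex.{v} p α) where
  Hom D E := Hom D E
  id E := Hom.id E
  comp f g := Hom.comp f g

end LogWittComplex

/-- The prime ideal `(p)` of `ℤ`. -/
instance isPrime_span_prime (p : ℕ) [Fact p.Prime] : (Ideal.span {(p : ℤ)}).IsPrime :=
  (Ideal.span_singleton_prime (by exact_mod_cast (Fact.out : p.Prime).ne_zero)).2
    (Nat.prime_iff_prime_int.1 Fact.out)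

/-- The ring `ℤ_(p)`. -/
abbrev ZLoc (p : ℕ) [Fact p.Prime] : Type := Localization.AtPrime (Ideal.span {(p : ℤ)})

/-- The monoid `ℚ^* ∩ ℤ_(p)` of the nonzero elements of `ℤ_(p)`. -/
abbrev ZLocMonoid (p : ℕ) [Fact p.Prime] : Submonoid (ZLoc p) := nonZeroDivisors (ZLoc p)

/-- The canonical log structure `ℚ^* ∩ ℤ_(p) ↪ ℤ_(p)`. -/
abbrev canonicalLog (p : ℕ) [Fact p.Prime] : ZLocMonoid p →* ZLoc p := (ZLocMonoid p).subtype

theorem natCast_mem_ZLocMonoid (p : ℕ) [Fact p.Prime] : (p : ZLoc p) ∈ ZLocMonoid p := by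
  have h : (p : ℤ) ∈ nonZeroDivisors ℤ :=
    mem_nonZeroDivisors_of_ne_zero (by exact_mod_cast (Fact.out : p.Prime).ne_zero)
  have := IsLocalization.nonZeroDivisors_le_comap (Ideal.span {(p : ℤ)}).primeCompl (ZLoc p) h
  simpa using this

/-- The element `dlog [p]_n` of a Witt complex over `(ℤ_(p), ℚ^* ∩ ℤ_(p))`. -/
def LogWittComplex.dlogP {p : ℕ} [Fact p.Prime] (E : LogWittComplex.{v} p (canonicalLog p))
    (n : ℕ) : E.obj n :=
  E.dlog n (E.lamMon ⟨(p : ZLoc p), natCast_mem_ZLocMonoid p⟩)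

/-!
`ℤ_(p)` is its own Frobenius lift, so Dwork's lemma identifies `W_n(ℤ_(p))` with the ring of the
sequences `s` of length `n` with `s j ≡ s (j - 1)` modulo `p ^ j`. Such a sequence is telescopically
of the form `∑ c j • V^j(1)` with constants `c j`; as `d` kills the constants, its differential in
any Witt complex is `∑ c j • dV^j(1)`.

In every Witt complex over the log ring, products, `R`, `F`, `V` and `d` act on the forms
`∑ a j • dV^j(1) + b • dlog [p]` by universal formulas in the coefficients, and `p ^ j` kills
`dV^j(1)` and `p ^ n` kills `dlog [p]`. The module of forms subject to no further relations embeds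
into the product of the rings `A / p ^ (j + 1)`, for `j < n`, and `A / p ^ n` by sending `dlog [p]`
to `1` and `dV^j(1)` to `-p` in the component of index `j`. There the operations can be defined
componentwise, and they make the square-zero extension of the ghost ring by the forms a Witt
complex. The universal formulas hold in it and in every other Witt complex, so it is initial, and a
given initial object inherits its structure through the isomorphism between them.
-/

noncomputable section

/-- A ring without `p`-torsion in which `a ^ p ≡ a` modulo `p`, so that the identity is a lift of
the Frobenius. Over such a ring the ghost map is injective, and its image is described by
congruences between consecutive ghost components. -/
class IsFermatRing (p : ℕ) (A : Type u) [CommRing A] : Prop where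
  isLeftRegular : IsLeftRegular (p : A)
  dvd_pow_sub_self : ∀ a : A, (p : A) ∣ a ^ p - a

namespace IsFermatRing

variable {p : ℕ} {A : Type u} [CommRing A] [IsFermatRing p A]

theorem eq_of_pow_mul_eq {k : ℕ} {a b : A} (h : (p : A) ^ k * a = (p : A) ^ k * b) : a = b :=
  (isLeftRegular (p := p) (A := A)).pow k h

theorem eq_of_natCast_mul_eq {a b : A} (h : (p : A) * a = (p : A) * b) : a = b :=
  isLeftRegular h

theorem pow_dvd_of_pow_add_dvd_mul {k l : ℕ} {a : A} (h : (p : A) ^ (k + l) ∣ (p : A) ^ k * a) :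
    (p : A) ^ l ∣ a := by
  obtain ⟨b, hb⟩ := h
  exact ⟨b, eq_of_pow_mul_eq (k := k) (by rw [hb, pow_add, mul_assoc])⟩

theorem pow_dvd_of_dvd_mul {l : ℕ} {a : A} (h : (p : A) ^ (l + 1) ∣ (p : A) * a) :
    (p : A) ^ l ∣ a :=
  pow_dvd_of_pow_add_dvd_mul (k := 1) (by rwa [pow_one, add_comm])

theorem pow_dvd_pow_sub_pow (a : A) (k : ℕ) :
    (p : A) ^ (k + 1) ∣ a ^ p ^ (k + 1) - a ^ p ^ k := by
  have := dvd_sub_pow_of_dvd_sub (dvd_pow_sub_self (p := p) a) k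
  rwa [← pow_mul, ← pow_succ'] at this

end IsFermatRing

/-- The ghost component `∑ i ≤ j, p ^ i * x i ^ p ^ (j - i)` of a sequence of Witt coordinates. -/
def ghostSum (p : ℕ) {A : Type u} [CommRing A] (x : ℕ → A) (j : ℕ) : A :=
  ∑ i ∈ Finset.range (j + 1), (p : A) ^ i * x i ^ p ^ (j - i)

section GhostSum

variable {p : ℕ} {A : Type u} [CommRing A]

theorem ghostComponent_eq_ghostSum [Fact p.Prime] (x : WittVector p A) (j : ℕ) :
    WittVector.ghostComponent j x = ghostSum p x.coeff j := by
  rw [WittVector.ghostComponent_apply, wittPolynomial_eq_sum_C_mul_X_pow, map_sum]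
  simp [ghostSum]

theorem ghostSum_succ (x : ℕ → A) (j : ℕ) : ghostSum p x (j + 1) =
    ghostSum p (fun i => x i ^ p) j + (p : A) ^ (j + 1) * x (j + 1) := by
  rw [ghostSum, ghostSum, Finset.sum_range_succ, Nat.sub_self, pow_zero, pow_one]
  congr 1
  refine Finset.sum_congr rfl fun i hi => ?_
  rw [Nat.succ_sub (Finset.mem_range_succ_iff.1 hi), pow_succ', pow_mul]

theorem ghostSum_congr {x y : ℕ → A} {j : ℕ} (h : ∀ i ≤ j, x i = y i) :
    ghostSum p x j = ghostSum p y j :=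
  Finset.sum_congr rfl fun i hi => by rw [h i (Finset.mem_range_succ_iff.1 hi)]

variable [IsFermatRing p A]

theorem pow_dvd_ghostSum_pow_sub (x : ℕ → A) (j : ℕ) :
    (p : A) ^ (j + 1) ∣ ghostSum p (fun i => x i ^ p) j - ghostSum p x j := by
  rw [ghostSum, ghostSum, ← Finset.sum_sub_distrib]
  refine Finset.dvd_sum fun i hi => ?_
  obtain ⟨k, rfl⟩ := Nat.exists_eq_add_of_le (Finset.mem_range_succ_iff.1 hi)
  rw [← mul_sub, add_assoc, pow_add, Nat.add_sub_cancel_left, ← pow_mul, ← pow_succ']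
  exact mul_dvd_mul_left _ (IsFermatRing.pow_dvd_pow_sub_pow (x i) k)

theorem pow_dvd_ghostSum_succ_sub (x : ℕ → A) (j : ℕ) :
    (p : A) ^ (j + 1) ∣ ghostSum p x (j + 1) - ghostSum p x j := by
  rw [ghostSum_succ, add_sub_right_comm]
  exact dvd_add (pow_dvd_ghostSum_pow_sub x j) (dvd_mul_right _ _)

theorem eq_zero_of_ghostSum_eq_zero [Fact p.Prime] {x : ℕ → A} {n : ℕ}
    (h : ∀ j < n, ghostSum p x j = 0) : ∀ j < n, x j = 0 := by
  intro j
  induction j using Nat.strong_induction_on with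
  | _ j ih =>
    intro hj
    have hsum := h j hj
    rw [ghostSum, Finset.sum_range_succ, Finset.sum_eq_zero, zero_add, Nat.sub_self, pow_zero,
      pow_one] at hsum
    · exact IsFermatRing.eq_of_pow_mul_eq (hsum.trans (mul_zero _).symm)
    · intro i hi
      rw [ih i (Finset.mem_range.1 hi) ((Finset.mem_range.1 hi).trans hj), zero_pow, mul_zero]
      exact pow_ne_zero _ (Fact.out : p.Prime).ne_zero

theorem exists_ghostSum_eq (s : ℕ → A) (n : ℕ)
    (h : ∀ i, i + 1 < n → (p : A) ^ (i + 1) ∣ s (i + 1) - s i) :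
    ∃ x : ℕ → A, ∀ j < n, ghostSum p x j = s j := by
  induction n with
  | zero => exact ⟨0, fun j hj => absurd hj j.not_lt_zero⟩
  | succ n ih =>
    obtain ⟨x, hx⟩ := ih fun i hi => h i (hi.trans n.lt_succ_self)
    suffices ∃ b, ghostSum p (Function.update x n b) n = s n by
      obtain ⟨b, hb⟩ := this
      refine ⟨Function.update x n b, fun j hj => ?_⟩
      rcases Nat.lt_succ_iff_lt_or_eq.1 hj with hj | rfl
      · rw [← hx j hj]
        exact ghostSum_congr fun i hi => Function.update_of_ne (by omega) _ _
      · exact hb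
    cases n with
    | zero => exact ⟨s 0, by simp [ghostSum]⟩
    | succ n =>
      obtain ⟨c, hc⟩ := h n (by omega)
      obtain ⟨e, he⟩ := pow_dvd_ghostSum_pow_sub (p := p) x n
      have hupdate : ghostSum p (fun i => Function.update x (n + 1) (c - e) i ^ p) n =
          ghostSum p (fun i => x i ^ p) n :=
        ghostSum_congr fun i hi => by rw [Function.update_of_ne (by omega)]
      refine ⟨c - e, ?_⟩
      rw [ghostSum_succ, hupdate, Function.update_self]
      linear_combination he - hc + hx n (by omega)

end GhostSum

/-- The predecessor of an index, with the convention that the first index is its own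
predecessor. -/
def prevIdx {n : ℕ} (j : Fin n) : Fin n := ⟨j - 1, (Nat.sub_le _ _).trans_lt j.2⟩

theorem prevIdx_of_eq_zero {n : ℕ} {j : Fin n} (hj : (j : ℕ) = 0) : prevIdx j = j :=
  Fin.ext (by simp [prevIdx, hj])

theorem succ_prevIdx {n : ℕ} {j : Fin n} (hj : (j : ℕ) ≠ 0) :
    (prevIdx j).succ = prevIdx j.succ :=
  Fin.ext (Nat.sub_add_cancel (Nat.one_le_iff_ne_zero.2 hj))

/-- The ring of sequences `s` of length `n` with `s j ≡ s (j - 1)` modulo `p ^ j`: by Dwork's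
lemma, the image of the ghost map on Witt vectors of length `n` over an `IsFermatRing`. -/
def GhostRing (p : ℕ) (A : Type u) [CommRing A] (n : ℕ) : Subring (Fin n → A) where
  carrier := {s | ∀ j : Fin n, (p : A) ^ (j : ℕ) ∣ s j - s (prevIdx j)}
  mul_mem' {s t} hs ht j := by
    have h : (s * t) j - (s * t) (prevIdx j) =
        s j * (t j - t (prevIdx j)) + t (prevIdx j) * (s j - s (prevIdx j)) := by
      simp only [Pi.mul_apply]
      ring
    rw [h]
    exact dvd_add ((ht j).mul_left _) ((hs j).mul_left _)
  one_mem' j := by simp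
  add_mem' {s t} hs ht j := by
    simpa only [Pi.add_apply, add_sub_add_comm] using dvd_add (hs j) (ht j)
  zero_mem' j := by simp
  neg_mem' {s} hs j := by
    simpa only [Pi.neg_apply, ← neg_sub'] using (hs j).neg_right

namespace GhostRing

variable {p : ℕ} {A : Type u} [CommRing A] {n : ℕ}

theorem ext {s t : GhostRing p A n} (h : ∀ j, s.1 j = t.1 j) : s = t := Subtype.ext (funext h)

theorem mul_val (s t : GhostRing p A n) (j : Fin n) : (s * t).1 j = s.1 j * t.1 j := rfl

theorem add_val (s t : GhostRing p A n) (j : Fin n) : (s + t).1 j = s.1 j + t.1 j := rfl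

/-- Restriction in ghost coordinates. -/
def res (p : ℕ) (A : Type u) [CommRing A] (n : ℕ) : GhostRing p A (n + 1) →+* GhostRing p A n :=
  ((RingHom.pi fun j : Fin n => Pi.evalRingHom (fun _ : Fin (n + 1) => A) j.castSucc).comp
    (GhostRing p A (n + 1)).subtype).codRestrict _ fun s j => s.2 j.castSucc

/-- Frobenius in ghost coordinates. -/
def frob (p : ℕ) (A : Type u) [CommRing A] (n : ℕ) : GhostRing p A (n + 1) →+* GhostRing p A n :=
  ((RingHom.pi fun j : Fin n => Pi.evalRingHom (fun _ : Fin (n + 1) => A) j.succ).comp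
    (GhostRing p A (n + 1)).subtype).codRestrict _ fun s j => by
      by_cases hj : (j : ℕ) = 0
      · simp [hj]
      · change _ ∣ s.1 j.succ - s.1 (prevIdx j).succ
        rw [succ_prevIdx hj]
        exact (pow_dvd_pow _ (Nat.le_succ _)).trans (s.2 j.succ)

/-- Verschiebung in ghost coordinates. -/
def ver (p : ℕ) (A : Type u) [CommRing A] (n : ℕ) : GhostRing p A n →+ GhostRing p A (n + 1) where
  toFun s := ⟨Fin.cons 0 fun j => p * s.1 j, fun j => by
    cases j using Fin.cases with
    | zero => simp
    | succ j =>
      by_cases hj : (j : ℕ) = 0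
      · have hprev : prevIdx j.succ = 0 := Fin.ext hj
        simp [hj, hprev]
      · rw [← succ_prevIdx hj, Fin.cons_succ, Fin.cons_succ, ← mul_sub, Fin.val_succ, pow_succ']
        exact mul_dvd_mul_left _ (s.2 j)⟩
  map_zero' := ext fun j => by cases j using Fin.cases <;> simp
  map_add' s t := ext fun j => by cases j using Fin.cases <;> simp [mul_add]

theorem frob_val (s : GhostRing p A (n + 1)) (j : Fin n) : (frob p A n s).1 j = s.1 j.succ := rfl

theorem ver_zero (s : GhostRing p A n) : (ver p A n s).1 0 = 0 := rfl

theorem ver_succ (s : GhostRing p A n) (j : Fin n) : (ver p A n s).1 j.succ = p * s.1 j := rfl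

theorem res_ver (s : GhostRing p A (n + 1)) :
    res p A (n + 1) (ver p A (n + 1) s) = ver p A n (res p A n s) :=
  ext fun j => by cases j using Fin.cases <;> rfl

theorem ver_mul (s : GhostRing p A n) (t : GhostRing p A (n + 1)) :
    ver p A n s * t = ver p A n (s * frob p A n t) := ext fun j => by
  cases j using Fin.cases with
  | zero => exact zero_mul _
  | succ j => exact mul_assoc _ _ _

theorem frob_ver (s : GhostRing p A n) : frob p A n (ver p A n s) = p • s :=
  ext fun j => (nsmul_eq_mul p (s.1 j)).symm

/-- The constant sequences, which make `GhostRing p A n` an algebra over `A`. -/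
def const (p : ℕ) (A : Type u) [CommRing A] (n : ℕ) : A →+* GhostRing p A n :=
  (RingHom.pi fun _ : Fin n => RingHom.id A).codRestrict _ fun a j => by
    change _ ∣ a - a
    simp

theorem const_val (a : A) (j : Fin n) : (const p A n a).1 j = a := rfl

theorem const_mul_ver (a : A) (s : GhostRing p A n) :
    const p A (n + 1) a * ver p A n s = ver p A n (const p A n a * s) := by
  rw [mul_comm, ver_mul, mul_comm]
  rfl

section Ghost

variable [Fact p.Prime] [IsFermatRing p A]

/-- The ghost map on Witt vectors, truncated. -/
def ghost (p : ℕ) [Fact p.Prime] (A : Type u) [CommRing A] [IsFermatRing p A] (n : ℕ) :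
    WittVector p A →+* GhostRing p A n :=
  (RingHom.pi fun j : Fin n => WittVector.ghostComponent (p := p) (R := A) j).codRestrict _ <| by
    rintro x ⟨_ | i, _⟩
    · simp
    · change _ ∣ WittVector.ghostComponent (i + 1) x - WittVector.ghostComponent i x
      rw [ghostComponent_eq_ghostSum, ghostComponent_eq_ghostSum]
      exact pow_dvd_ghostSum_succ_sub _ _

theorem ghost_val (x : WittVector p A) (j : Fin n) :
    (ghost p A n x).1 j = WittVector.ghostComponent j x := rfl

theorem ghost_eq_zero_iff (x : WittVector p A) :
    ghost p A n x = 0 ↔ WittVector.truncate n x = 0 := by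
  rw [← RingHom.mem_ker (f := WittVector.truncate n), WittVector.mem_ker_truncate]
  constructor
  · intro h
    refine eq_zero_of_ghostSum_eq_zero (p := p) fun j hj => ?_
    rw [← ghostComponent_eq_ghostSum]
    exact congrFun (congrArg Subtype.val h) ⟨j, hj⟩
  · intro h
    refine ext fun j => ?_
    rw [ghost_val, ghostComponent_eq_ghostSum, ghostSum]
    refine Finset.sum_eq_zero fun i hi => ?_
    rw [h i ((Finset.mem_range_succ_iff.1 hi).trans_lt j.2), zero_pow, mul_zero]
    exact pow_ne_zero _ (Fact.out : p.Prime).ne_zero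

theorem ghost_surjective (n : ℕ) : Function.Surjective (ghost p A n) := by
  intro s
  obtain ⟨x, hx⟩ := exists_ghostSum_eq (p := p)
    (fun j => if h : j < n then s.1 ⟨j, h⟩ else 0) n fun i hi => by
      rw [dif_pos hi, dif_pos (i.lt_succ_self.trans hi)]
      exact s.2 ⟨i + 1, hi⟩
  refine ⟨WittVector.mk p x, ext fun j => ?_⟩
  rw [ghost_val, ghostComponent_eq_ghostSum]
  exact (hx j j.2).trans (dif_pos j.2)

/-- The ghost map identifies `W_n(A)` with `GhostRing p A n`. -/
def equiv (p : ℕ) [Fact p.Prime] (A : Type u) [CommRing A] [IsFermatRing p A] (n : ℕ) :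
    TruncatedWittVector p n A ≃+* GhostRing p A n :=
  (RingHom.quotientKerEquivOfSurjective (WittVector.truncate_surjective p n A)).symm.trans <|
    (Ideal.quotEquivOfEq (Ideal.ext fun x => (ghost_eq_zero_iff x).symm)).trans <|
      RingHom.quotientKerEquivOfSurjective (ghost_surjective (p := p) n)

theorem equiv_truncate (x : WittVector p A) :
    equiv p A n (WittVector.truncate n x) = ghost p A n x := by
  have h : (RingHom.quotientKerEquivOfSurjective (WittVector.truncate_surjective p n A)).symm
      (WittVector.truncate n x) = Ideal.Quotient.mk _ x :=
    (RingEquiv.symm_apply_eq _).2 rfl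
  rw [equiv, RingEquiv.trans_apply, h]
  rfl

theorem equiv_symm_ghost (x : WittVector p A) :
    (equiv p A n).symm (ghost p A n x) = WittVector.truncate n x := by
  rw [RingEquiv.symm_apply_eq, equiv_truncate]

/-- The Teichmüller representatives in ghost coordinates. -/
def teich (p : ℕ) (A : Type u) [CommRing A] [IsFermatRing p A] (n : ℕ) :
    A →* GhostRing p A n where
  toFun a := ⟨fun j => a ^ p ^ (j : ℕ), by
    rintro ⟨_ | i, _⟩
    · simp
    · exact IsFermatRing.pow_dvd_pow_sub_pow a i⟩
  map_one' := ext fun _ => one_pow _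
  map_mul' _ _ := ext fun _ => mul_pow _ _ _

omit [Fact p.Prime] in
theorem teich_val (a : A) (j : Fin n) : (teich p A n a).1 j = a ^ p ^ (j : ℕ) := rfl

theorem ghost_teichmuller (a : A) : ghost p A n (WittVector.teichmuller p a) = teich p A n a :=
  ext fun _ => WittVector.ghostComponent_teichmuller _ _ _

theorem ghost_frobenius (x : WittVector p A) :
    ghost p A n (WittVector.frobenius x) = frob p A n (ghost p A (n + 1) x) :=
  ext fun _ => WittVector.ghostComponent_frobenius _ _

theorem ghost_verschiebung (x : WittVector p A) :
    ghost p A (n + 1) (WittVector.verschiebung x) = ver p A n (ghost p A n x) :=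
  ext fun j => by
    cases j using Fin.cases with
    | zero => exact WittVector.ghostComponent_zero_verschiebung x
    | succ j => exact WittVector.ghostComponent_verschiebung x j

end Ghost

/-- The quotient `(s j - s (j - 1)) / p ^ j`, which is unique, and `0` for `j = 0`, as soon as `p`
is regular in `A`. -/
def diffQuot (s : GhostRing p A n) (j : Fin n) : A := (s.2 j).choose

theorem pow_mul_diffQuot (s : GhostRing p A n) (j : Fin n) :
    (p : A) ^ (j : ℕ) * diffQuot s j = s.1 j - s.1 (prevIdx j) :=
  (s.2 j).choose_spec.symm

/-- The elements `V^i(1)` in ghost coordinates. -/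
def vOne (p : ℕ) (A : Type u) [CommRing A] : ∀ n : ℕ, ℕ → GhostRing p A n
  | _, 0 => 1
  | 0, _ + 1 => 0
  | n + 1, i + 1 => ver p A n (vOne p A n i)

theorem vOne_val (i : ℕ) (j : Fin n) :
    (vOne p A n i).1 j = if i ≤ j then (p : A) ^ i else 0 := by
  induction n generalizing i with
  | zero => exact j.elim0
  | succ n ih =>
    cases i with
    | zero => simp [vOne]
    | succ i =>
      cases j using Fin.cases with
      | zero => exact (ver_zero _).trans (if_neg (by simp)).symm
      | succ j => rw [vOne, ver_succ, ih, mul_ite, mul_zero, ← pow_succ']; simp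

theorem sum_const_mul_vOne_succ (c : Fin (n + 1) → A) :
    ∑ i, const p A (n + 1) (c i) * vOne p A (n + 1) i =
      const p A (n + 1) (c 0) + ver p A n (∑ i : Fin n, const p A n (c i.succ) * vOne p A n i) := by
  rw [Fin.sum_univ_succ, map_sum]
  congr 1
  · exact mul_one _
  · exact Finset.sum_congr rfl fun i _ => const_mul_ver _ _

theorem eq_const_add_sum_diffQuot (s : GhostRing p A (n + 1)) :
    s = const p A (n + 1) (s.1 0) +
      ∑ j : Fin n, const p A (n + 1) (diffQuot s j.succ) * vOne p A (n + 1) (j + 1) := by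
  refine ext fun j => ?_
  have hval : ∀ k, (∑ i : Fin n, const p A (n + 1) (diffQuot s i.succ) *
      vOne p A (n + 1) (i + 1)).1 k =
        ∑ i : Fin n, diffQuot s i.succ * if (i : ℕ) + 1 ≤ k then (p : A) ^ ((i : ℕ) + 1) else 0 :=
    fun k => by
      simp only [AddSubmonoidClass.coe_finsetSum, Finset.sum_apply, mul_val, const_val, vOne_val]
  rw [add_val, hval, const_val]
  induction j using Fin.induction with
  | zero => simp
  | succ j ih =>
    have hstep := pow_mul_diffQuot s j.succ
    rw [Fin.val_succ, show prevIdx j.succ = j.castSucc from rfl] at hstep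
    rw [← sub_add_cancel (s.1 j.succ) (s.1 j.castSucc), ← hstep, ih, add_left_comm,
      add_right_inj, ← eq_sub_iff_add_eq, ← Finset.sum_sub_distrib, Finset.sum_eq_single j]
    · simp [mul_comm]
    · intro i _ hij
      have : (i : ℕ) ≠ j := fun h => hij (Fin.ext h)
      have hiff : (i : ℕ) + 1 ≤ j.succ ↔ (i : ℕ) + 1 ≤ j.castSucc := by
        rw [Fin.val_succ, Fin.val_castSucc]; omega
      rw [← mul_sub, if_congr hiff rfl rfl, sub_self, mul_zero]
    · exact fun h => absurd (Finset.mem_univ j) h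

theorem dvd_val_sub_val_zero (s : GhostRing p A (n + 1)) (j : Fin (n + 1)) :
    (p : A) ∣ s.1 j - s.1 0 := by
  induction j using Fin.induction with
  | zero => exact (sub_self (s.1 0)).symm ▸ dvd_zero _
  | succ j ih =>
    rw [← sub_add_sub_cancel _ (s.1 j.castSucc)]
    exact dvd_add ((dvd_pow_self (p : A) j.val.succ_ne_zero).trans (s.2 j.succ)) ih

variable [IsFermatRing p A]

theorem diffQuot_eq {s : GhostRing p A n} {j : Fin n} {c : A}
    (hc : (p : A) ^ (j : ℕ) * c = s.1 j - s.1 (prevIdx j)) : diffQuot s j = c :=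
  IsFermatRing.eq_of_pow_mul_eq ((pow_mul_diffQuot s j).trans hc.symm)

theorem diffQuot_of_eq_zero (s : GhostRing p A n) {j : Fin n} (hj : (j : ℕ) = 0) :
    diffQuot s j = 0 :=
  diffQuot_eq (by rw [prevIdx_of_eq_zero hj, sub_self, mul_zero])

theorem diffQuot_add (s t : GhostRing p A n) (j : Fin n) :
    diffQuot (s + t) j = diffQuot s j + diffQuot t j :=
  diffQuot_eq <| by
    rw [mul_add, pow_mul_diffQuot, pow_mul_diffQuot, add_val, add_val, add_sub_add_comm]

theorem diffQuot_mul (s t : GhostRing p A n) (j : Fin n) :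
    diffQuot (s * t) j = s.1 j * diffQuot t j + t.1 (prevIdx j) * diffQuot s j :=
  diffQuot_eq <| by
    rw [mul_add, mul_left_comm, pow_mul_diffQuot, mul_left_comm, pow_mul_diffQuot, mul_val, mul_val]
    ring

theorem diffQuot_res (s : GhostRing p A (n + 1)) (j : Fin n) :
    diffQuot (res p A n s) j = diffQuot s j.castSucc :=
  diffQuot_eq (pow_mul_diffQuot s j.castSucc)

theorem diffQuot_ver_succ (s : GhostRing p A n) {j : Fin n} (hj : (j : ℕ) ≠ 0) :
    diffQuot (ver p A n s) j.succ = diffQuot s j :=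
  diffQuot_eq <| by
    rw [← succ_prevIdx hj, ver_succ, ver_succ, Fin.val_succ, pow_succ', mul_assoc,
      pow_mul_diffQuot, mul_sub]

theorem exists_eq_const_add_ver (s : GhostRing p A (n + 1)) :
    ∃ t : GhostRing p A n, s = const p A (n + 1) (s.1 0) + ver p A n t := by
  choose t ht using dvd_val_sub_val_zero s
  refine ⟨⟨fun j => t j.succ, fun j => ?_⟩, ext fun j => ?_⟩
  · by_cases hj : (j : ℕ) = 0
    · simp [hj]
    · refine IsFermatRing.pow_dvd_of_dvd_mul ?_
      rw [mul_sub, ← ht, ← ht, sub_sub_sub_cancel_right, succ_prevIdx hj]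
      exact s.2 j.succ
  · cases j using Fin.cases with
    | zero => exact (add_zero _).symm
    | succ j => rw [add_val, const_val, ver_succ, ← ht, add_sub_cancel]

theorem ver_injective : Function.Injective (ver p A n) := fun _ _ h => ext fun j =>
  IsFermatRing.eq_of_natCast_mul_eq (congrFun (congrArg Subtype.val h) j.succ)

theorem existsUnique_sum_const_mul_vOne (s : GhostRing p A n) :
    ∃! c : Fin n → A, s = ∑ i, const p A n (c i) * vOne p A n i := by
  induction n with
  | zero => exact ⟨fun _ => 0, ext fun j => j.elim0, fun c _ => funext fun j => j.elim0⟩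
  | succ n ih =>
    obtain ⟨t, ht⟩ := exists_eq_const_add_ver s
    obtain ⟨c, hc, hunique⟩ := ih t
    refine ⟨Fin.cons (s.1 0) c, ?_, fun c' hc' => ?_⟩
    · simp only [sum_const_mul_vOne_succ, Fin.cons_zero, Fin.cons_succ]
      rw [← hc, ← ht]
    · change s = _ at hc'
      rw [sum_const_mul_vOne_succ] at hc'
      have h0 : s.1 0 = c' 0 := by
        conv_lhs => rw [hc', add_val, const_val, ver_zero, add_zero]
      rw [← h0] at hc'
      rw [← hunique _ (ver_injective (add_left_cancel (ht.symm.trans hc'))), h0]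
      exact (Fin.cons_self_tail c').symm

end GhostRing

/-- The data making the square-zero extensions of the rings `W_n(A)` (in ghost coordinates) by
modules `N n` into a Witt complex over `A` that vanishes in degrees at least two. -/
structure WittModule (p : ℕ) [Fact p.Prime] (A : Type u) [CommRing A] [IsFermatRing p A] where
  /-- the part of degree one -/
  N : ℕ → Type u
  [addCommGroup : ∀ n, AddCommGroup (N n)]
  [module : ∀ n, Module (GhostRing p A n) (N n)]
  subsingleton : Subsingleton (N 0)
  /-- restriction -/
  R : ∀ n, N (n + 1) →+ N n
  R_smul : ∀ n (s : GhostRing p A (n + 1)) m, R n (s • m) = GhostRing.res p A n s • R n m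
  /-- Frobenius -/
  F : ∀ n, N (n + 1) →+ N n
  F_smul : ∀ n (s : GhostRing p A (n + 1)) m, F n (s • m) = GhostRing.frob p A n s • F n m
  R_F : ∀ n m, R n (F (n + 1) m) = F n (R (n + 1) m)
  /-- Verschiebung -/
  V : ∀ n, N n →+ N (n + 1)
  R_V : ∀ n m, R (n + 1) (V (n + 1) m) = V n (R n m)
  ver_smul : ∀ n (s : GhostRing p A n) m, GhostRing.ver p A n s • m = V n (s • F n m)
  smul_V : ∀ n (s : GhostRing p A (n + 1)) m, s • V n m = V n (GhostRing.frob p A n s • m)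
  F_V : ∀ n m, F n (V n m) = p • m
  /-- the differential -/
  d : ∀ n, GhostRing p A n →+ N n
  d_mul : ∀ n s t, d n (s * t) = s • d n t + t • d n s
  R_d : ∀ n s, R n (d (n + 1) s) = d n (GhostRing.res p A n s)
  F_d_ver : ∀ n s, F n (d (n + 1) (GhostRing.ver p A n s)) = d n s
  F_d_teich : ∀ n a, F n (d (n + 1) (GhostRing.teich p A (n + 1) a)) =
    GhostRing.teich p A n a ^ (p - 1) • d n (GhostRing.teich p A n a)

namespace WittModule

attribute [instance] WittModule.addCommGroup WittModule.module

open GhostRing TrivSqZeroExt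

variable {p : ℕ} [Fact p.Prime] {A : Type u} [CommRing A] [IsFermatRing p A]

instance (D : WittModule p A) (n : ℕ) : Module (GhostRing p A n)ᵐᵒᵖ (D.N n) :=
  Module.compHom _ ((RingHom.id (GhostRing p A n)).fromOpposite mul_comm)

instance (D : WittModule p A) (n : ℕ) : IsCentralScalar (GhostRing p A n) (D.N n) :=
  ⟨fun _ _ => rfl⟩

/-- The square-zero extension of level `n`. The lift to a higher universe lets a Witt module be
compared with Witt complexes in any universe. -/
def SqZero (D : WittModule p A) (n : ℕ) : Type (max u v) :=
  ULift.{v} (TrivSqZeroExt (GhostRing p A n) (D.N n))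

instance (D : WittModule p A) (n : ℕ) : CommRing (SqZero.{v, u} D n) :=
  inferInstanceAs (CommRing (ULift (TrivSqZeroExt (GhostRing p A n) (D.N n))))

namespace SqZero

variable (D : WittModule p A) {D' : WittModule p A} {n m : ℕ}

theorem ext {D : WittModule p A} {x y : SqZero.{v, u} D n} (h₁ : x.down.fst = y.down.fst)
    (h₂ : x.down.snd = y.down.snd) : x = y :=
  ULift.ext _ _ (TrivSqZeroExt.ext h₁ h₂)

/-- The inclusion of the part of degree zero. -/
def ofFst (n : ℕ) : GhostRing p A n →+* SqZero.{v, u} D n :=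
  (ULift.ringEquiv.symm : TrivSqZeroExt (GhostRing p A n) (D.N n) ≃+* _).toRingHom.comp
    (inlHom (GhostRing p A n) (D.N n))

/-- The inclusion of the part of degree one. -/
def ofSnd (n : ℕ) : D.N n →+ SqZero.{v, u} D n :=
  (AddEquiv.ulift.symm : TrivSqZeroExt (GhostRing p A n) (D.N n) ≃+ _).toAddMonoidHom.comp
    (inrHom (GhostRing p A n) (D.N n)).toAddMonoidHom

/-- The projection to degree zero. -/
def fst (n : ℕ) : SqZero.{v, u} D n →+* GhostRing p A n :=
  ((fstHom ℤ (GhostRing p A n) (D.N n)).toRingHom).comp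
    (ULift.ringEquiv : _ ≃+* TrivSqZeroExt (GhostRing p A n) (D.N n)).toRingHom

/-- The projection to degree one. -/
def snd (n : ℕ) : SqZero.{v, u} D n →+ D.N n :=
  (sndHom (GhostRing p A n) (D.N n)).toAddMonoidHom.comp
    (AddEquiv.ulift : _ ≃+ TrivSqZeroExt (GhostRing p A n) (D.N n)).toAddMonoidHom

theorem ofFst_fst_add_ofSnd_snd (x : SqZero.{v, u} D n) :
    ofFst D n (fst D n x) + ofSnd D n (snd D n x) = x :=
  ext (add_zero _) (zero_add _)

variable {D}

theorem ofFst_mul_ofSnd (s : GhostRing p A n) (y : D.N n) :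
    ofFst.{v, u} D n s * ofSnd D n y = ofSnd D n (s • y) :=
  ULift.ext _ _ (inl_mul_inr s y)

/-- The additive map given by `f` in degree zero and `g` in degree one. -/
def mapAdd (f : GhostRing p A n →+ GhostRing p A m) (g : D.N n →+ D'.N m) :
    SqZero.{v, u} D n →+ SqZero.{v, u} D' m where
  toFun x := ⟨(f x.down.fst, g x.down.snd)⟩
  map_zero' := ext (map_zero f) (map_zero g)
  map_add' _ _ := ext (map_add f _ _) (map_add g _ _)

/-- The map of rings given by `f` in degree zero and `g` in degree one. -/
def mapRing (f : GhostRing p A n →+* GhostRing p A m) (g : D.N n →+ D'.N m)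
    (h : ∀ s x, g (s • x) = f s • g x) : SqZero.{v, u} D n →+* SqZero.{v, u} D' m where
  __ := mapAdd f.toAddMonoidHom g
  map_one' := ext (map_one f) (map_zero g)
  map_mul' x y := ext (map_mul f _ _) (by
    change g (x.down.fst • y.down.snd + y.down.fst • x.down.snd) =
      f x.down.fst • g y.down.snd + f y.down.fst • g x.down.snd
    rw [map_add, h, h])

variable (D) in
/-- The grading by degree, concentrated in degrees zero and one. -/
def gr (n : ℕ) : ℕ → AddSubgroup (SqZero.{v, u} D n)
  | 0 => (ofFst D n).range.toAddSubgroup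
  | 1 => (ofSnd D n).range
  | _ + 2 => ⊥

theorem mapAdd_mem_gr (f : GhostRing p A n →+ GhostRing p A m) (g : D.N n →+ D'.N m) (q : ℕ)
    (x : SqZero.{v, u} D n) (hx : x ∈ gr D n q) : mapAdd f g x ∈ gr D' m q := by
  match q, hx with
  | 0, ⟨s, hs⟩ => exact ⟨f s, hs ▸ ext rfl (map_zero g).symm⟩
  | 1, ⟨y, hy⟩ => exact ⟨g y, hy ▸ ext (map_zero f).symm rfl⟩
  | _ + 2, hx => exact AddSubgroup.mem_bot.2 ((congrArg _ (AddSubgroup.mem_bot.1 hx)).trans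
      (map_zero _))

theorem mul_mem_gr (i j : ℕ) (x y : SqZero.{v, u} D n) (hx : x ∈ gr D n i) (hy : y ∈ gr D n j) :
    x * y ∈ gr D n (i + j) := by
  match i, j, hx, hy with
  | 0, 0, ⟨s, hs⟩, ⟨t, ht⟩ => exact ⟨s * t, by rw [← hs, ← ht, map_mul]⟩
  | 0, 1, ⟨s, hs⟩, ⟨b, hb⟩ =>
    exact ⟨s • b, hs ▸ hb ▸ (ofFst_mul_ofSnd s b).symm⟩
  | 1, 0, ⟨a, ha⟩, ⟨t, ht⟩ =>
    exact ⟨t • a, ha ▸ ht ▸ ULift.ext _ _ (inr_mul_inl t a).symm⟩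
  | 1, 1, ⟨a, ha⟩, ⟨b, hb⟩ =>
    exact AddSubgroup.mem_bot.2 (ha ▸ hb ▸ ULift.ext _ _ (inr_mul_inr _ a b))
  | i, j + 2, _, hy =>
    rw [AddSubgroup.mem_bot.1 hy, mul_zero]
    exact zero_mem _
  | i + 2, j, hx, _ =>
    rw [AddSubgroup.mem_bot.1 hx, zero_mul]
    exact zero_mem _

theorem gr_of_two_le {q : ℕ} (hq : 2 ≤ q) : gr.{v, u} D n q = ⊥ := by
  obtain ⟨q, rfl⟩ := Nat.exists_eq_add_of_le' hq
  rfl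

theorem mul_comm_of_mem_gr (i j : ℕ) (x y : SqZero.{v, u} D n) (hx : x ∈ gr D n i)
    (hy : y ∈ gr D n j) : x * y = (-1) ^ (i * j) * (y * x) := by
  by_cases hij : i = 0 ∨ j = 0
  · rw [mul_eq_zero.2 hij, pow_zero, one_mul, mul_comm]
  · have hxy := mul_mem_gr i j x y hx hy
    rw [gr_of_two_le (by omega), AddSubgroup.mem_bot] at hxy
    rw [mul_comm y, hxy, mul_zero]

theorem fst_eq_zero {q : ℕ} (hq : q ≠ 0) {x : SqZero.{v, u} D n} (hx : x ∈ gr D n q) :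
    fst D n x = 0 := by
  match q, hq, hx with
  | 1, _, ⟨y, hy⟩ => exact hy ▸ rfl
  | _ + 2, _, hx => rw [AddSubgroup.mem_bot.1 hx, map_zero]

theorem snd_eq_zero {q : ℕ} (hq : q ≠ 1) {x : SqZero.{v, u} D n} (hx : x ∈ gr D n q) :
    snd D n x = 0 := by
  match q, hq, hx with
  | 0, _, ⟨y, hy⟩ => exact hy ▸ rfl
  | _ + 2, _, hx => rw [AddSubgroup.mem_bot.1 hx, map_zero]

variable (D n) in
/-- The decomposition of the square-zero extension into its homogeneous parts. -/
def decompose : SqZero.{v, u} D n →+ DirectSum ℕ fun q => gr.{v, u} D n q :=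
  ((DirectSum.of (fun q => gr.{v, u} D n q) 0).comp
      (((ofFst D n).comp (fst D n)).toAddMonoidHom.codRestrict (gr D n 0) fun _ => ⟨_, rfl⟩)) +
    (DirectSum.of (fun q => gr.{v, u} D n q) 1).comp
      (((ofSnd D n).comp (snd D n)).codRestrict (gr D n 1) fun _ => ⟨_, rfl⟩)

theorem decompose_coe {q : ℕ} (x : gr.{v, u} D n q) :
    decompose D n x = DirectSum.of (fun q => gr.{v, u} D n q) q x := by
  match q, x with
  | 0, ⟨_, s, rfl⟩ =>
    exact (congrArg _ (map_zero (DirectSum.of (fun q => gr.{v, u} D n q) 1))).trans (add_zero _)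
  | 1, ⟨_, y, rfl⟩ =>
    exact (congrArg (· + _) (map_zero (DirectSum.of (fun q => gr.{v, u} D n q) 0))).trans
      (zero_add _)
  | q + 2, ⟨x, hx⟩ =>
    obtain rfl : x = 0 := AddSubgroup.mem_bot.1 hx
    exact (map_zero (decompose D n)).trans (map_zero (DirectSum.of _ (q + 2))).symm

theorem isInternal_gr : DirectSum.IsInternal (gr.{v, u} D n) :=
  let := DirectSum.Decomposition.ofAddHom (gr.{v, u} D n) (decompose D n)
    (AddMonoidHom.ext fun x => by
      rw [AddMonoidHom.comp_apply, decompose, AddMonoidHom.add_apply, map_add]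
      exact (congrArg₂ _ (DirectSum.coeAddMonoidHom_of _ _ _)
        (DirectSum.coeAddMonoidHom_of _ _ _)).trans (ofFst_fst_add_ofSnd_snd D x))
    (DirectSum.addHom_ext fun q x => by
      rw [AddMonoidHom.comp_apply, DirectSum.coeAddMonoidHom_of]
      exact decompose_coe x)
  DirectSum.Decomposition.isInternal _

variable (D n) in
/-- The differential, from degree zero to degree one. -/
def diff : SqZero.{v, u} D n →+ SqZero.{v, u} D n :=
  (ofSnd D n).comp ((D.d n).comp (fst D n).toAddMonoidHom)

theorem diff_mem_gr (q : ℕ) (x : SqZero.{v, u} D n) (hx : x ∈ gr D n q) :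
    diff D n x ∈ gr D n (q + 1) := by
  cases q with
  | zero => exact ⟨_, rfl⟩
  | succ q =>
    have h : diff D n x = ofSnd D n (D.d n (fst D n x)) := rfl
    rw [h, fst_eq_zero q.succ_ne_zero hx, map_zero, map_zero]
    exact zero_mem _

theorem diff_mul (q : ℕ) (x y : SqZero.{v, u} D n) (hx : x ∈ gr D n q) :
    diff D n (x * y) = diff D n x * y + (-1) ^ q * (x * diff D n y) := by
  have leibniz : diff D n (x * y) = diff D n x * y + x * diff D n y := by
    refine ext ?_ ?_
    · change (0 : GhostRing p A n) = 0 * y.down.fst + x.down.fst * 0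
      rw [zero_mul, mul_zero, add_zero]
    · change D.d n (fst D n x * fst D n y) = (0 : GhostRing p A n) • y.down.snd +
        fst D n y • D.d n (fst D n x) + (fst D n x • D.d n (fst D n y) +
        (0 : GhostRing p A n) • x.down.snd)
      rw [D.d_mul, zero_smul, zero_smul, zero_add, add_zero, add_comm]
  cases q with
  | zero => rw [leibniz, pow_zero, one_mul]
  | succ q =>
    have h : x * diff D n y = ofSnd D n (fst D n x • D.d n (fst D n y)) := by
      refine ext (mul_zero _) ?_
      change fst D n x • D.d n (fst D n y) + (0 : GhostRing p A n) • x.down.snd = _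
      rw [zero_smul, add_zero]
      rfl
    rw [leibniz, h, fst_eq_zero q.succ_ne_zero hx, zero_smul, map_zero, mul_zero]

end SqZero

open SqZero

/-- The Witt complex given by a `WittModule`. -/
def toWittComplex (D : WittModule p A) : WittComplex.{max u v} p A where
  obj n := SqZero.{v, u} D n
  gr n := gr D n
  one_mem n := ⟨1, map_one _⟩
  mul_mem n := mul_mem_gr
  isInternal n := isInternal_gr
  graded_comm n := mul_comm_of_mem_gr
  level_zero := ⟨fun x y => SqZero.ext (GhostRing.ext fun j => j.elim0) (D.subsingleton.elim _ _)⟩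
  R n := mapRing (res p A n) (D.R n) (D.R_smul n)
  R_mem n := mapAdd_mem_gr (res p A n).toAddMonoidHom (D.R n)
  lam n := (ofFst D n).comp (equiv p A n).toRingHom
  lam_mem n x := ⟨_, rfl⟩
  R_lam n x := SqZero.ext
    ((congrArg (res p A n) (equiv_truncate x)).trans (equiv_truncate x).symm) (map_zero _)
  F n := mapRing (frob p A n) (D.F n) (D.F_smul n)
  F_mem n := mapAdd_mem_gr (frob p A n).toAddMonoidHom (D.F n)
  R_F n x := SqZero.ext rfl (D.R_F n _)
  F_lam n x := SqZero.ext
    ((congrArg (frob p A n) (equiv_truncate x)).trans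
      ((ghost_frobenius x).symm.trans (equiv_truncate _).symm)) (map_zero _)
  V n := mapAdd (ver p A n) (D.V n)
  V_mem n := mapAdd_mem_gr (ver p A n) (D.V n)
  R_V n x := SqZero.ext (res_ver _) (D.R_V n _)
  V_lam n x := SqZero.ext
    ((congrArg (ver p A n) (equiv_truncate x)).trans
      ((ghost_verschiebung x).symm.trans (equiv_truncate _).symm)) (map_zero _)
  V_mul n x y := SqZero.ext (ver_mul _ _) (by
    change ver p A n x.down.fst • y.down.snd + y.down.fst • D.V n x.down.snd =
      D.V n (x.down.fst • D.F n y.down.snd + frob p A n y.down.fst • x.down.snd)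
    rw [map_add, D.ver_smul, D.smul_V])
  F_V n x := SqZero.ext (frob_ver _) (D.F_V n _)
  d n := diff D n
  d_mem n := diff_mem_gr
  R_d n x := SqZero.ext (map_zero _) (D.R_d n _)
  d_mul n := diff_mul
  d_d n x := SqZero.ext rfl (map_zero (D.d n))
  F_d_V n x := SqZero.ext (map_zero _) (D.F_d_ver n _)
  F_d_teichmuller n a := by
    have h : ∀ k, equiv p A k (WittVector.truncate k (WittVector.teichmuller p a)) =
      teich p A k a := fun k => (equiv_truncate _).trans (ghost_teichmuller a)
    change ofSnd D n (D.F n (D.d (n + 1) (equiv p A (n + 1)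
      (WittVector.truncate (n + 1) (WittVector.teichmuller p a))))) =
      ofFst D n (equiv p A n (WittVector.truncate n (WittVector.teichmuller p a))) ^ (p - 1) *
      ofSnd D n (D.d n (equiv p A n (WittVector.truncate n (WittVector.teichmuller p a))))
    rw [h, h, ← map_pow, ofFst_mul_ofSnd, D.F_d_teich]

end WittModule

theorem mul_sq_dvd_add_pow_sub {p : ℕ} [hp : Fact p.Prime] (hp2 : p ≠ 2) {A : Type u} [CommRing A]
    {x : A} (hx : (p : A) ∣ x) (y : A) :
    (p : A) * x ^ 2 ∣ (x + y) ^ p - y ^ p - p * x * y ^ (p - 1) := by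
  have hp3 : 3 ≤ p := lt_of_le_of_ne hp.out.two_le hp2.symm
  have hx_pow : (p : A) * x ^ 2 ∣ x ^ p := by
    rw [← Nat.sub_add_cancel hp.out.two_le, pow_add, Nat.sub_add_cancel hp.out.two_le]
    exact mul_dvd_mul_right (hx.trans (dvd_pow_self x (by omega))) _
  have hrest : x ∣ ∑ k ∈ (Finset.Ioo 0 p).erase 1,
      x ^ (k - 1) * y ^ (p - k - 1) * ((p.choose k / p : ℕ) : A) := by
    refine Finset.dvd_sum fun k hk => ?_
    obtain ⟨hk1, hk⟩ := Finset.mem_erase.1 hk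
    have hk0 := (Finset.mem_Ioo.1 hk).1
    exact ((dvd_pow_self x (by omega)).mul_right _).mul_right _
  have hy : y ^ (p - 1) = y ^ (p - 1 - 1) * y := by rw [← pow_succ]; congr 1; omega
  rw [add_pow_prime_eq hp.out,
    ← Finset.add_sum_erase _ _ (Finset.mem_Ioo.2 ⟨one_pos, hp.out.one_lt⟩), Nat.choose_one_right,
    Nat.div_self hp.out.pos, Nat.cast_one, hy]
  have hmul := mul_dvd_mul_left ((p : A) * x) (hrest.mul_left y)
  rw [mul_assoc, ← sq] at hmul
  convert dvd_add hx_pow hmul using 1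
  ring

namespace GhostRing

variable {p : ℕ} {A : Type u} [CommRing A] {n : ℕ}

theorem pow_dvd_diffQuot_teich_sub [Fact p.Prime] [IsFermatRing p A] (hp : p ≠ 2) (a : A)
    (j : Fin n) :
    (p : A) ^ (j : ℕ) ∣ diffQuot (teich p A (n + 1) a) j.succ -
      (teich p A n a).1 j ^ (p - 1) * diffQuot (teich p A n a) j := by
  by_cases hj : (j : ℕ) = 0
  · simp [hj]
  set e := diffQuot (teich p A n a) j with he
  set y := (teich p A n a).1 j with hy
  have hstep := pow_mul_diffQuot (teich p A n a) j
  have hstep_succ := pow_mul_diffQuot (teich p A (n + 1) a) j.succ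
  have hval_succ : (teich p A (n + 1) a).1 j.succ = y ^ p := by
    rw [hy, teich_val, teich_val, Fin.val_succ, pow_succ, pow_mul]
  have hval : (teich p A (n + 1) a).1 (prevIdx j.succ) = y := rfl
  have hval_prev : (teich p A n a).1 (prevIdx j) ^ p = y := by
    rw [hy, teich_val, teich_val, ← pow_mul, ← pow_succ]
    exact congrArg (a ^ p ^ ·) (Nat.succ_pred_eq_of_ne_zero hj)
  obtain ⟨c, hc⟩ := mul_sq_dvd_add_pow_sub hp
    (((dvd_pow_self (p : A) hj).mul_right e).neg_right) y
  rw [hstep, ← hy, neg_sub, sub_add_cancel, hval_prev] at hc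
  rw [hval_succ, Fin.val_succ, hval] at hstep_succ
  refine ⟨-(e ^ 2 * c), IsFermatRing.eq_of_pow_mul_eq (p := p) (k := j + 1) ?_⟩
  rw [← he, ← hy] at hstep
  rw [mul_sub, hstep_succ]
  linear_combination -hc + (p * ((p : A) ^ (j : ℕ) * e + y - (teich p A n a).1 (prevIdx j)) * c
    - p * y ^ (p - 1)) * hstep

/-- The scalar by which `s` acts on the `j`-th component of a logarithmic form. It is congruent to
`s j` modulo `p ^ j`; the correction by `p ^ (p - 2)` produces the extra terms of the formulas for
`V^i(1) dlog [p]`. -/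
def twist (s : GhostRing p A n) (j : Fin n) : A :=
  s.1 (prevIdx j) - p ^ (p - 2) * (s.1 (prevIdx j) - s.1 (prevIdx (prevIdx j)))

theorem prev_sub_twist (s : GhostRing p A n) (j : Fin n) : s.1 (prevIdx j) - twist s j =
    p ^ (p - 2) * (s.1 (prevIdx j) - s.1 (prevIdx (prevIdx j))) :=
  sub_sub_cancel _ _

theorem twist_of_le_one (s : GhostRing p A n) {j : Fin n} (hj : (j : ℕ) ≤ 1) :
    twist s j = s.1 (prevIdx j) := by
  have hprev : ((prevIdx j : Fin n) : ℕ) = 0 := Nat.sub_eq_zero_of_le hj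
  rw [twist, prevIdx_of_eq_zero hprev, sub_self, mul_zero, sub_zero]

theorem twist_one (j : Fin n) : twist (1 : GhostRing p A n) j = 1 := by
  change (1 : A) - p ^ (p - 2) * (1 - 1) = 1
  rw [sub_self, mul_zero, sub_zero]

theorem twist_add (s t : GhostRing p A n) (j : Fin n) :
    twist (s + t) j = twist s j + twist t j := by
  simp only [twist, add_val]
  ring

/-- The factor by which Verschiebung multiplies the `j`-th component of a logarithmic form: the
twist of `V(1)`. -/
def verTwist (p : ℕ) (A : Type u) [CommRing A] (j : ℕ) : A :=
  if j = 0 then 0 else if j = 1 then p - p ^ (p - 2) * p else p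

theorem twist_ver_zero (s : GhostRing p A n) : twist (ver p A n s) 0 = 0 := by
  rw [twist_of_le_one _ (Nat.zero_le 1)]
  exact ver_zero s

theorem twist_ver_succ (s : GhostRing p A n) (j : Fin n) :
    twist (ver p A n s) j.succ = verTwist p A j * twist s j := by
  by_cases hj : (j : ℕ) = 0
  · rw [verTwist, if_pos hj, zero_mul, twist_of_le_one _ (by simp [hj])]
    exact (congrArg _ (Fin.ext hj : prevIdx j.succ = 0)).trans (ver_zero s)
  by_cases hprev : ((prevIdx j : Fin n) : ℕ) = 0
  · have hj1 : (j : ℕ) = 1 := by simp only [prevIdx] at hprev; omega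
    have hzero : prevIdx (prevIdx j).succ = 0 := Fin.ext hprev
    rw [verTwist, if_neg hj, if_pos hj1, twist_of_le_one s hj1.le, twist, ← succ_prevIdx hj, hzero,
      ver_succ, ver_zero]
    ring
  · have hj1 : (j : ℕ) ≠ 1 := by simp only [prevIdx] at hprev; omega
    rw [verTwist, if_neg hj, if_neg hj1, twist, twist, ← succ_prevIdx hj, ← succ_prevIdx hprev,
      ver_succ, ver_succ]
    ring

theorem dvd_verTwist (j : ℕ) : (p : A) ∣ verTwist p A j := by
  rw [verTwist]
  split_ifs
  exacts [dvd_zero _, dvd_sub dvd_rfl (dvd_mul_left _ _), dvd_rfl]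

variable [Fact p.Prime]

theorem dvd_pow_sub_two (hp : p ≠ 2) : (p : A) ∣ (p : A) ^ (p - 2) :=
  dvd_pow_self _ (Nat.sub_pos_of_lt (lt_of_le_of_ne (Fact.out : p.Prime).two_le hp.symm)).ne'

theorem pow_dvd_prev_sub_twist (hp : p ≠ 2) (s : GhostRing p A n) (j : Fin n) :
    (p : A) ^ (j : ℕ) ∣ s.1 (prevIdx j) - twist s j := by
  rw [prev_sub_twist]
  refine dvd_trans ?_ (mul_dvd_mul (dvd_pow_sub_two hp) (s.2 (prevIdx j)))
  rw [← pow_succ']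
  exact pow_dvd_pow _ (Nat.le_add_of_sub_le le_rfl)

theorem pow_dvd_sub_twist (hp : p ≠ 2) (s : GhostRing p A n) (j : Fin n) :
    (p : A) ^ (j : ℕ) ∣ s.1 j - twist s j := by
  rw [← sub_add_sub_cancel _ (s.1 (prevIdx j))]
  exact dvd_add (s.2 j) (pow_dvd_prev_sub_twist hp s j)

theorem pow_dvd_twist_mul_sub (hp : p ≠ 2) (s t : GhostRing p A n) (j : Fin n) :
    (p : A) ^ (j + 1 : ℕ) ∣ twist (s * t) j - twist s j * twist t j := by
  by_cases hj : (j : ℕ) ≤ 1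
  · simp only [twist_of_le_one _ hj, mul_val, sub_self, dvd_zero]
  · have hfactor : twist (s * t) j - twist s j * twist t j = (s.1 (prevIdx j) - twist s j) *
        (t.1 (prevIdx j) - t.1 (prevIdx (prevIdx j))) * (1 - p ^ (p - 2)) := by
      simp only [twist, mul_val]
      ring
    rw [hfactor]
    refine Dvd.dvd.mul_right ?_ _
    refine dvd_trans ?_ (mul_dvd_mul (pow_dvd_prev_sub_twist hp s j) (t.2 (prevIdx j)))
    rw [← pow_add]
    refine pow_dvd_pow _ (Nat.add_le_add_left ?_ _)
    exact Nat.le_sub_of_add_le (not_le.1 hj)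

theorem pow_dvd_twist_succ_sub (hp : p ≠ 2) (s : GhostRing p A (n + 1)) (j : Fin n) :
    (p : A) ^ (j + 1 : ℕ) ∣ twist s j.succ - twist (frob p A n s) j := by
  by_cases hj : (j : ℕ) = 0
  · rw [twist_of_le_one _ (by simp [hj]), twist_of_le_one _ (by simp [hj]), prevIdx_of_eq_zero hj,
      frob_val, dvd_sub_comm]
    exact s.2 j.succ
  by_cases hprev : ((prevIdx j : Fin n) : ℕ) = 0
  · rw [twist_of_le_one (frob p A n s) (Nat.sub_eq_zero_iff_le.1 hprev), frob_val, succ_prevIdx hj,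
      dvd_sub_comm]
    exact pow_dvd_prev_sub_twist hp s j.succ
  · rw [twist, twist, frob_val, frob_val, succ_prevIdx hprev, succ_prevIdx hj, sub_self]
    exact dvd_zero _

theorem pow_dvd_verTwist_sub (hp : p ≠ 2) (j : ℕ) :
    (p : A) ^ (j + 1) ∣ verTwist p A j - p := by
  rw [verTwist]
  split_ifs with h0 h1
  · simp [h0]
  · rw [h1, sub_sub_cancel_left, dvd_neg, one_add_one_eq_two, sq]
    exact mul_dvd_mul_right (dvd_pow_sub_two hp) _
  · rw [sub_self]
    exact dvd_zero _

end GhostRing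

/-- The ideal of pairs `(a, b)` with `a j` divisible by `p ^ (j + 1)` and `b` by `p ^ n`. -/
def formIdeal (p : ℕ) (A : Type u) [CommRing A] (n : ℕ) : Ideal ((Fin n → A) × A) where
  carrier := {x | (∀ j : Fin n, (p : A) ^ (j + 1 : ℕ) ∣ x.1 j) ∧ (p : A) ^ n ∣ x.2}
  add_mem' hx hy := ⟨fun j => dvd_add (hx.1 j) (hy.1 j), dvd_add hx.2 hy.2⟩
  zero_mem' := ⟨fun _ => dvd_zero _, dvd_zero _⟩
  smul_mem' c _ hx := ⟨fun j => (hx.1 j).mul_left (c.1 j), hx.2.mul_left c.2⟩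

/-- The product of the rings `A / p ^ (j + 1)`, for `j < n`, and `A / p ^ n`. It contains the
logarithmic forms of level `n`: the form `∑ a j • dV^j(1) + b • dlog [p]` is represented by the
pair of `(b - p * a j)_j` and `b`. -/
abbrev FormRing (p : ℕ) (A : Type u) [CommRing A] (n : ℕ) : Type u :=
  ((Fin n → A) × A) ⧸ formIdeal p A n

namespace FormRing

open GhostRing

variable {p : ℕ} {A : Type u} [CommRing A] {n : ℕ}

/-- The class of a pair of representatives. -/
abbrev mk : (Fin n → A) × A →+* FormRing p A n := Ideal.Quotient.mk (formIdeal p A n)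

theorem mk_eq_mk_iff {x y : (Fin n → A) × A} : (mk x : FormRing p A n) = mk y ↔
    (∀ j : Fin n, (p : A) ^ (j + 1 : ℕ) ∣ x.1 j - y.1 j) ∧ (p : A) ^ n ∣ x.2 - y.2 :=
  Ideal.Quotient.eq

/-- Restriction of logarithmic forms. -/
def res (p : ℕ) (A : Type u) [CommRing A] (n : ℕ) : FormRing p A (n + 1) →+ FormRing p A n :=
  QuotientAddGroup.map (formIdeal p A (n + 1)).toAddSubgroup (formIdeal p A n).toAddSubgroup
    (AddMonoidHom.mk' (fun x => (fun j => x.1 j.castSucc, x.2)) fun _ _ => rfl)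
    fun _ hx => ⟨fun j => hx.1 j.castSucc, (pow_dvd_pow _ n.le_succ).trans hx.2⟩

/-- Frobenius on logarithmic forms. -/
def frob (p : ℕ) (A : Type u) [CommRing A] (n : ℕ) : FormRing p A (n + 1) →+ FormRing p A n :=
  QuotientAddGroup.map (formIdeal p A (n + 1)).toAddSubgroup (formIdeal p A n).toAddSubgroup
    (AddMonoidHom.mk' (fun x => (fun j => x.1 j.succ, x.2)) fun _ _ => rfl)
    fun _ hx => ⟨fun j => (pow_dvd_pow _ (Nat.le_succ _)).trans (hx.1 j.succ),
      (pow_dvd_pow _ n.le_succ).trans hx.2⟩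

/-- Verschiebung on representatives of logarithmic forms. -/
def verRep (p : ℕ) (A : Type u) [CommRing A] (n : ℕ) :
    (Fin n → A) × A →+ (Fin (n + 1) → A) × A :=
  AddMonoidHom.mk' (fun x => (Fin.cons 0 fun j => verTwist p A j * x.1 j, p * x.2)) fun x y => by
    refine Prod.ext (funext fun j => ?_) (mul_add _ _ _)
    cases j using Fin.cases with
    | zero => exact (add_zero 0).symm
    | succ j => exact mul_add _ _ _

/-- Verschiebung on logarithmic forms. -/
def ver (p : ℕ) (A : Type u) [CommRing A] (n : ℕ) : FormRing p A n →+ FormRing p A (n + 1) :=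
  QuotientAddGroup.map (formIdeal p A n).toAddSubgroup (formIdeal p A (n + 1)).toAddSubgroup
    (verRep p A n) fun x hx => ⟨fun j => by
      cases j using Fin.cases with
      | zero => exact dvd_zero _
      | succ j =>
        change _ ∣ verTwist p A j * x.1 j
        rw [Fin.val_succ, pow_succ']
        exact mul_dvd_mul (dvd_verTwist _) (hx.1 j), by
      rw [pow_succ']
      exact mul_dvd_mul_left _ hx.2⟩

/-- The last ghost component, by which Witt vectors act on the coefficient of `dlog [p]`; at level
`0`, where there is none, its value is `0`. -/
def lastVal : ∀ {n : ℕ}, GhostRing p A n → A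
  | 0, _ => 0
  | n + 1, s => s.1 (Fin.last n)

theorem pow_dvd_lastVal_sub_res (s : GhostRing p A (n + 1)) :
    (p : A) ^ n ∣ lastVal s - lastVal (GhostRing.res p A n s) := by
  cases n with
  | zero => exact (pow_zero (p : A)).symm ▸ one_dvd _
  | succ n => exact s.2 (Fin.last (n + 1))

theorem pow_dvd_lastVal_sub_frob (s : GhostRing p A (n + 1)) :
    (p : A) ^ n ∣ lastVal s - lastVal (GhostRing.frob p A n s) := by
  cases n with
  | zero => exact (pow_zero (p : A)).symm ▸ one_dvd _
  | succ n => exact (sub_self (lastVal s)).symm ▸ dvd_zero _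

theorem lastVal_ver (s : GhostRing p A n) : lastVal (GhostRing.ver p A n s) = p * lastVal s := by
  cases n with
  | zero => exact (mul_zero _).symm
  | succ n => rfl

section Prime

variable [Fact p.Prime]

/-- The action of the Witt vectors on logarithmic forms. -/
def scalar (hp : p ≠ 2) (n : ℕ) : GhostRing p A n →+* FormRing p A n where
  toFun s := mk (twist s, lastVal s)
  map_one' := mk_eq_mk_iff.2 ⟨fun j => by
    change _ ∣ twist 1 j - 1
    rw [twist_one, sub_self]
    exact dvd_zero _, by
    cases n with
    | zero => exact (pow_zero (p : A)).symm ▸ one_dvd _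
    | succ n => exact (sub_self (1 : A)).symm ▸ dvd_zero _⟩
  map_mul' s t := by
    rw [← map_mul]
    refine mk_eq_mk_iff.2 ⟨fun j => pow_dvd_twist_mul_sub hp s t j, ?_⟩
    cases n with
    | zero => exact (pow_zero (p : A)).symm ▸ one_dvd _
    | succ n => exact (sub_self (lastVal s * lastVal t)).symm ▸ dvd_zero _
  map_zero' := mk_eq_mk_iff.2 ⟨fun j => by simp [twist], by cases n <;> simp [lastVal]⟩
  map_add' s t := by
    rw [← map_add]
    refine congrArg _ (Prod.ext (funext fun j => twist_add s t j) ?_)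
    cases n with
    | zero => exact (add_zero 0).symm
    | succ n => rfl

theorem res_scalar_mul (hp : p ≠ 2) (s : GhostRing p A (n + 1)) (x : FormRing p A (n + 1)) :
    res p A n (scalar hp (n + 1) s * x) =
      scalar hp n (GhostRing.res p A n s) * res p A n x := by
  obtain ⟨x, rfl⟩ := Ideal.Quotient.mk_surjective x
  refine mk_eq_mk_iff.2
    ⟨fun j => (sub_self (twist s j.castSucc * x.1 j.castSucc)).symm ▸ dvd_zero _, ?_⟩
  change _ ∣ lastVal s * x.2 - lastVal (GhostRing.res p A n s) * x.2
  rw [← sub_mul]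
  exact (pow_dvd_lastVal_sub_res s).mul_right _

theorem frob_scalar_mul (hp : p ≠ 2) (s : GhostRing p A (n + 1)) (x : FormRing p A (n + 1)) :
    frob p A n (scalar hp (n + 1) s * x) =
      scalar hp n (GhostRing.frob p A n s) * frob p A n x := by
  obtain ⟨x, rfl⟩ := Ideal.Quotient.mk_surjective x
  refine mk_eq_mk_iff.2 ⟨fun j => ?_, ?_⟩
  · change _ ∣ twist s j.succ * x.1 j.succ - twist (GhostRing.frob p A n s) j * x.1 j.succ
    rw [← sub_mul]
    exact (pow_dvd_twist_succ_sub hp s j).mul_right _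
  · change _ ∣ lastVal s * x.2 - lastVal (GhostRing.frob p A n s) * x.2
    rw [← sub_mul]
    exact (pow_dvd_lastVal_sub_frob s).mul_right _

theorem scalar_ver_mul (hp : p ≠ 2) (s : GhostRing p A n) (x : FormRing p A (n + 1)) :
    scalar hp (n + 1) (GhostRing.ver p A n s) * x = ver p A n (scalar hp n s * frob p A n x) := by
  obtain ⟨x, rfl⟩ := Ideal.Quotient.mk_surjective x
  refine congrArg mk (Prod.ext (funext fun j => ?_) ?_)
  · cases j using Fin.cases with
    | zero => exact (congrArg (· * x.1 0) (twist_ver_zero s)).trans (zero_mul _)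
    | succ j => exact (congrArg (· * x.1 j.succ) (twist_ver_succ s j)).trans (mul_assoc _ _ _)
  · exact (congrArg (· * x.2) (lastVal_ver s)).trans (mul_assoc _ _ _)

theorem scalar_mul_ver (hp : p ≠ 2) (s : GhostRing p A (n + 1)) (x : FormRing p A n) :
    scalar hp (n + 1) s * ver p A n x =
      ver p A n (scalar hp n (GhostRing.frob p A n s) * x) := by
  obtain ⟨x, rfl⟩ := Ideal.Quotient.mk_surjective x
  refine mk_eq_mk_iff.2 ⟨fun j => ?_, ?_⟩
  · cases j using Fin.cases with
    | zero => exact ((congrArg (· - 0) (mul_zero (twist s 0))).trans (sub_self 0)) ▸ dvd_zero _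
    | succ j =>
      change _ ∣ twist s j.succ * (verTwist p A j * x.1 j) -
        verTwist p A j * (twist (GhostRing.frob p A n s) j * x.1 j)
      rw [mul_left_comm, ← mul_sub, ← sub_mul, Fin.val_succ, pow_succ']
      exact mul_dvd_mul (dvd_verTwist _) ((pow_dvd_twist_succ_sub hp s j).mul_right _)
  · change _ ∣ lastVal s * (p * x.2) - p * (lastVal (GhostRing.frob p A n s) * x.2)
    rw [mul_left_comm, ← mul_sub, ← sub_mul, pow_succ']
    exact mul_dvd_mul_left _ ((pow_dvd_lastVal_sub_frob s).mul_right _)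

theorem frob_ver (hp : p ≠ 2) (x : FormRing p A n) : frob p A n (ver p A n x) = p • x := by
  obtain ⟨x, rfl⟩ := Ideal.Quotient.mk_surjective x
  rw [← map_nsmul]
  refine mk_eq_mk_iff.2 ⟨fun j => ?_, ?_⟩
  · change _ ∣ verTwist p A j * x.1 j - p • x.1 j
    rw [nsmul_eq_mul, ← sub_mul]
    exact (pow_dvd_verTwist_sub hp j).mul_right _
  · change _ ∣ p * x.2 - p • x.2
    rw [nsmul_eq_mul, sub_self]
    exact dvd_zero _

variable [IsFermatRing p A]

/-- The differential on Witt vectors. -/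
def d (p : ℕ) (A : Type u) [CommRing A] [IsFermatRing p A] (n : ℕ) :
    GhostRing p A n →+ FormRing p A n :=
  AddMonoidHom.mk' (fun s => mk (fun j => -(p * diffQuot s j), 0)) fun s t => by
    rw [← map_add]
    refine congrArg _ (Prod.ext (funext fun j => ?_) (add_zero _).symm)
    change -(p * diffQuot (s + t) j) = -(p * diffQuot s j) + -(p * diffQuot t j)
    rw [diffQuot_add, mul_add, neg_add]

theorem d_mul (hp : p ≠ 2) (s t : GhostRing p A n) :
    d p A n (s * t) = scalar hp n s * d p A n t + scalar hp n t * d p A n s := by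
  change _ = mk _ * mk _ + mk _ * mk _
  rw [← map_mul, ← map_mul, ← map_add]
  refine mk_eq_mk_iff.2 ⟨fun j => ?_, ?_⟩
  · change _ ∣ -(p * diffQuot (s * t) j) -
      (twist s j * -(p * diffQuot t j) + twist t j * -(p * diffQuot s j))
    have hsplit : -(p * diffQuot (s * t) j) -
        (twist s j * -(p * diffQuot t j) + twist t j * -(p * diffQuot s j)) =
        -(p * ((s.1 j - twist s j) * diffQuot t j +
          (t.1 (prevIdx j) - twist t j) * diffQuot s j)) := by
      rw [diffQuot_mul]
      ring
    rw [hsplit, dvd_neg, pow_succ']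
    exact mul_dvd_mul_left _ (dvd_add ((pow_dvd_sub_twist hp s j).mul_right _)
      ((pow_dvd_prev_sub_twist hp t j).mul_right _))
  · simp

omit [Fact p.Prime] in
theorem frob_d_ver (s : GhostRing p A n) :
    frob p A n (d p A (n + 1) (GhostRing.ver p A n s)) = d p A n s := by
  refine mk_eq_mk_iff.2 ⟨fun j => ?_, (sub_self (0 : A)).symm ▸ dvd_zero _⟩
  change _ ∣ -(p * diffQuot (GhostRing.ver p A n s) j.succ) - -(p * diffQuot s j)
  by_cases hj : (j : ℕ) = 0
  · rw [hj, zero_add, pow_one]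
    exact dvd_sub (dvd_mul_right _ _).neg_right (dvd_mul_right _ _).neg_right
  · rw [diffQuot_ver_succ s hj, sub_self]
    exact dvd_zero _

theorem frob_d_teich (hp : p ≠ 2) (a : A) : frob p A n (d p A (n + 1) (teich p A (n + 1) a)) =
    scalar hp n (teich p A n a ^ (p - 1)) * d p A n (teich p A n a) := by
  rw [map_pow]
  change _ = mk _ ^ (p - 1) * mk _
  rw [← map_pow, ← map_mul]
  refine mk_eq_mk_iff.2 ⟨fun j => ?_, ?_⟩
  · set s := teich p A n a
    change _ ∣ -(p * diffQuot (teich p A (n + 1) a) j.succ) -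
      twist s j ^ (p - 1) * -(p * diffQuot s j)
    have hsplit : -(p * diffQuot (teich p A (n + 1) a) j.succ) -
        twist s j ^ (p - 1) * -(p * diffQuot s j) =
        -(p * ((diffQuot (teich p A (n + 1) a) j.succ - s.1 j ^ (p - 1) * diffQuot s j) +
          (s.1 j ^ (p - 1) - twist s j ^ (p - 1)) * diffQuot s j)) := by
      ring
    rw [hsplit, dvd_neg, pow_succ']
    exact mul_dvd_mul_left _ (dvd_add (pow_dvd_diffQuot_teich_sub hp a j)
      (((pow_dvd_sub_twist hp s j).trans (sub_dvd_pow_sub_pow _ _ _)).mul_right _))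
  · simp

/-- The Witt module of all the elements of the rings `FormRing p A n`. -/
def ambient (A : Type u) [CommRing A] [IsFermatRing p A] (hp : p ≠ 2) : WittModule p A where
  N := FormRing p A
  module n := Module.compHom _ (scalar hp n)
  subsingleton := Ideal.Quotient.subsingleton_iff.2 <| (Ideal.eq_top_iff_one _).2
    ⟨fun j => j.elim0, (pow_zero (p : A)).symm ▸ one_dvd _⟩
  R := res p A
  R_smul _ := res_scalar_mul hp
  F := frob p A
  F_smul _ := frob_scalar_mul hp
  R_F _ := Ideal.Quotient.mk_surjective.forall.2 fun _ => rfl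
  V := ver p A
  R_V _ := Ideal.Quotient.mk_surjective.forall.2 fun _ => congrArg mk <|
    Prod.ext (funext fun j => by cases j using Fin.cases <;> rfl) rfl
  ver_smul _ := scalar_ver_mul hp
  smul_V _ := scalar_mul_ver hp
  F_V _ := frob_ver hp
  d := d p A
  d_mul _ := d_mul hp
  R_d _ s := congrArg mk <| Prod.ext
    (funext fun j => congrArg (fun c => -((p : A) * c)) (diffQuot_res s j).symm) rfl
  F_d_ver _ := frob_d_ver
  F_d_teich _ := frob_d_teich hp

end Prime

end FormRing

namespace WittModule

variable {p : ℕ} [Fact p.Prime] {A : Type u} [CommRing A] [IsFermatRing p A]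

/-- The Witt module formed by a family of submodules that is stable under the operations and
contains the differentials. -/
def restrict (D : WittModule p A) (L : ∀ n, Submodule (GhostRing p A n) (D.N n))
    (R_mem : ∀ n, ∀ m ∈ L (n + 1), D.R n m ∈ L n) (F_mem : ∀ n, ∀ m ∈ L (n + 1), D.F n m ∈ L n)
    (V_mem : ∀ n, ∀ m ∈ L n, D.V n m ∈ L (n + 1)) (d_mem : ∀ n s, D.d n s ∈ L n) :
    WittModule p A where
  N n := L n
  subsingleton := have := D.subsingleton; inferInstance
  R n := ((D.R n).comp (L (n + 1)).subtype.toAddMonoidHom).codRestrict (L n) fun m => R_mem n m m.2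
  R_smul n s m := Subtype.ext (D.R_smul n s m)
  F n := ((D.F n).comp (L (n + 1)).subtype.toAddMonoidHom).codRestrict (L n) fun m => F_mem n m m.2
  F_smul n s m := Subtype.ext (D.F_smul n s m)
  R_F n m := Subtype.ext (D.R_F n m)
  V n := ((D.V n).comp (L n).subtype.toAddMonoidHom).codRestrict (L (n + 1)) fun m => V_mem n m m.2
  R_V n m := Subtype.ext (D.R_V n m)
  ver_smul n s m := Subtype.ext (D.ver_smul n s m)
  smul_V n s m := Subtype.ext (D.smul_V n s m)
  F_V n m := Subtype.ext (D.F_V n m)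
  d n := (D.d n).codRestrict (L n) (d_mem n)
  d_mul n s t := Subtype.ext (D.d_mul n s t)
  R_d n s := Subtype.ext (D.R_d n s)
  F_d_ver n s := Subtype.ext (D.F_d_ver n s)
  F_d_teich n a := Subtype.ext (D.F_d_teich n a)

end WittModule

namespace FormRing

open GhostRing

variable {p : ℕ} {A : Type u} [CommRing A] {n : ℕ}

/-- The form `∑ a j • dV^j(1) + b • dlog [p]` given by the pair of `a` and `b`. -/
def logForm (p : ℕ) (A : Type u) [CommRing A] (n : ℕ) : (Fin n → A) × A →+ FormRing p A n :=
  AddMonoidHom.mk' (fun x => mk (fun j => x.2 - p * x.1 j, x.2)) fun x y => by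
    rw [← map_add]
    refine congrArg _ (Prod.ext (funext fun j => ?_) rfl)
    change x.2 + y.2 - p * (x.1 j + y.1 j) = x.2 - p * x.1 j + (y.2 - p * y.1 j)
    ring

theorem mk_mem_range_logForm {x : (Fin n → A) × A} (hx : ∀ j, (p : A) ∣ x.2 - x.1 j) :
    mk x ∈ (logForm p A n).range := by
  choose a ha using hx
  exact ⟨(a, x.2), congrArg mk <| Prod.ext
    (funext fun j => (congrArg (x.2 - ·) (ha j).symm).trans (sub_sub_cancel _ _)) rfl⟩

theorem logForm_eq_zero_iff [IsFermatRing p A] {x : (Fin n → A) × A} :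
    logForm p A n x = 0 ↔ (∀ j : Fin n, (p : A) ^ (j : ℕ) ∣ x.1 j) ∧ (p : A) ^ n ∣ x.2 := by
  have h : logForm p A n x = 0 ↔
      (∀ j : Fin n, (p : A) ^ (j + 1 : ℕ) ∣ x.2 - p * x.1 j) ∧ (p : A) ^ n ∣ x.2 :=
    Ideal.Quotient.eq_zero_iff_mem
  rw [h]
  refine and_congr_left fun hb => forall_congr' fun j => ?_
  rw [dvd_sub_right ((pow_dvd_pow _ j.2).trans hb)]
  exact ⟨IsFermatRing.pow_dvd_of_dvd_mul, fun ha => pow_succ' (p : A) j ▸ mul_dvd_mul_left _ ha⟩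

theorem ver_mem_range_logForm {m : FormRing p A n} (hm : m ∈ (logForm p A n).range) :
    ver p A n m ∈ (logForm p A (n + 1)).range := by
  obtain ⟨⟨a, b⟩, rfl⟩ := hm
  refine mk_mem_range_logForm (x := verRep p A n (fun j => b - p * a j, b)) fun j => ?_
  cases j using Fin.cases with
  | zero => exact dvd_sub (dvd_mul_right _ _) (dvd_zero _)
  | succ j => exact dvd_sub (dvd_mul_right _ _) ((dvd_verTwist _).mul_right _)

theorem ver_logForm_inl (a : Fin n → A) : ver p A n (logForm p A n (a, 0)) =
    logForm p A (n + 1) (Fin.cons 0 fun j => verTwist p A j * a j, 0) := by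
  refine congrArg mk (Prod.ext (funext fun j => ?_) (mul_zero _))
  cases j using Fin.cases with
  | zero => exact ((congrArg (0 - ·) (mul_zero _)).trans (sub_zero 0)).symm
  | succ j =>
    change verTwist p A j * (0 - p * a j) = 0 - p * (verTwist p A j * a j)
    ring

variable [Fact p.Prime]

theorem dvd_twist_sub_lastVal (hp : p ≠ 2) (s : GhostRing p A n) (j : Fin n) :
    (p : A) ∣ lastVal s - twist s j := by
  cases n with
  | zero => exact j.elim0
  | succ n =>
    have hval : ∀ i k, (p : A) ∣ s.1 i - s.1 k := fun i k => by
      rw [← sub_sub_sub_cancel_right _ _ (s.1 0)]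
      exact dvd_sub (dvd_val_sub_val_zero s i) (dvd_val_sub_val_zero s k)
    rw [lastVal, ← sub_add_sub_cancel _ (s.1 (prevIdx j)), prev_sub_twist]
    exact dvd_add (hval _ _) ((dvd_pow_sub_two hp).mul_right _)

theorem smul_mem_range_logForm (hp : p ≠ 2) (s : GhostRing p A n) {m : FormRing p A n}
    (hm : m ∈ (logForm p A n).range) : scalar hp n s * m ∈ (logForm p A n).range := by
  obtain ⟨⟨a, b⟩, rfl⟩ := hm
  refine mk_mem_range_logForm (x := (twist s, lastVal s) * (fun j => b - p * a j, b)) fun j => ?_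
  have hsplit : lastVal s * b - twist s j * (b - p * a j) =
      (lastVal s - twist s j) * b + p * (twist s j * a j) := by ring
  exact hsplit ▸ dvd_add ((dvd_twist_sub_lastVal hp s j).mul_right _) (dvd_mul_right _ _)

theorem scalar_mul_logForm_inl (hp : p ≠ 2) (s : GhostRing p A n) (a : Fin n → A) :
    scalar hp n s * logForm p A n (a, 0) = logForm p A n (fun j => twist s j * a j, 0) :=
  congrArg mk <| Prod.ext (funext fun j => by
    change twist s j * (0 - p * a j) = 0 - p * (twist s j * a j)
    ring) (mul_zero _)

omit [Fact p.Prime] in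
theorem d_eq_logForm [IsFermatRing p A] (s : GhostRing p A n) :
    d p A n s = logForm p A n (diffQuot s, 0) :=
  congrArg mk <| Prod.ext (funext fun _ => (zero_sub _).symm) rfl

end FormRing

section Modules

open FormRing GhostRing

variable {p : ℕ} [Fact p.Prime] (A : Type u) [CommRing A] [IsFermatRing p A] (hp : p ≠ 2) (n : ℕ)

/-- The Witt module of logarithmic forms. -/
def logModule : WittModule p A :=
  (ambient A hp).restrict
    (fun n => { (logForm p A n).range with smul_mem' := fun s _ => smul_mem_range_logForm hp s })
    (by
      rintro n _ ⟨x, rfl⟩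
      exact ⟨(fun j => x.1 j.castSucc, x.2), rfl⟩)
    (by
      rintro n _ ⟨x, rfl⟩
      exact ⟨(fun j => x.1 j.succ, x.2), rfl⟩)
    (fun n _ => ver_mem_range_logForm)
    fun n s => ⟨(diffQuot s, 0), (d_eq_logForm s).symm⟩

/-- The Witt module of the forms `∑ a j • dV^j(1)`. -/
def drwModule : WittModule p A :=
  (ambient A hp).restrict
    (fun n =>
      { ((logForm p A n).comp (AddMonoidHom.inl (Fin n → A) A)).range with
        smul_mem' := by
          rintro s _ ⟨a, rfl⟩
          exact ⟨fun j => twist s j * a j, (scalar_mul_logForm_inl hp s a).symm⟩ })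
    (by
      rintro n _ ⟨a, rfl⟩
      exact ⟨fun j => a j.castSucc, rfl⟩)
    (by
      rintro n _ ⟨a, rfl⟩
      exact ⟨fun j => a j.succ, rfl⟩)
    (by
      rintro n _ ⟨a, rfl⟩
      exact ⟨Fin.cons 0 fun j => verTwist p A j * a j, (ver_logForm_inl a).symm⟩)
    fun n s => ⟨diffQuot s, (d_eq_logForm s).symm⟩

variable {A}

/-- The form `∑ a j • dV^j(1) + b • dlog [p]`, as an element of the Witt module of logarithmic
forms. -/
def logModule.form : (Fin n → A) × A →+ (logModule A hp).N n := (logForm p A n).rangeRestrict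

theorem logModule.form_surjective : Function.Surjective (form (A := A) hp n) :=
  (logForm p A n).rangeRestrict_surjective

theorem logModule.form_eq_zero_iff {x : (Fin n → A) × A} :
    form hp n x = 0 ↔ (∀ j : Fin n, (p : A) ^ (j : ℕ) ∣ x.1 j) ∧ (p : A) ^ n ∣ x.2 :=
  Subtype.ext_iff.trans logForm_eq_zero_iff

/-- The form `∑ a j • dV^j(1)`, as an element of the Witt module of such forms. -/
def drwModule.form : (Fin n → A) →+ (drwModule A hp).N n :=
  ((logForm p A n).comp (AddMonoidHom.inl (Fin n → A) A)).rangeRestrict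

theorem drwModule.form_surjective : Function.Surjective (form (A := A) hp n) :=
  AddMonoidHom.rangeRestrict_surjective _

theorem drwModule.form_eq_zero_iff {a : Fin n → A} :
    form hp n a = 0 ↔ ∀ j : Fin n, (p : A) ^ (j : ℕ) ∣ a j :=
  (Subtype.ext_iff.trans logForm_eq_zero_iff).trans (and_iff_left (dvd_zero _))

end Modules

namespace WittComplex

variable {p : ℕ} [Fact p.Prime] {A : Type u} [CommRing A] {E : WittComplex.{v} p A} {n : ℕ}

theorem mul_comm_of_mem_zero {q : ℕ} {x y : E.obj n} (hx : x ∈ E.gr n 0) (hy : y ∈ E.gr n q) :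
    x * y = y * x := by
  rw [E.graded_comm n 0 q x y hx hy, zero_mul, pow_zero, one_mul]

theorem d_mul_of_mem_zero {x : E.obj n} (hx : x ∈ E.gr n 0) (y : E.obj n) :
    E.d n (x * y) = E.d n x * y + x * E.d n y := by
  rw [E.d_mul n 0 x y hx, pow_zero, one_mul]

theorem mul_V {q : ℕ} {x : E.obj (n + 1)} {y : E.obj n} (hx : x ∈ E.gr (n + 1) 0)
    (hy : y ∈ E.gr n q) : x * E.V n y = E.V n (E.F n x * y) := by
  rw [mul_comm_of_mem_zero hx (E.V_mem n q y hy), V_mul,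
    mul_comm_of_mem_zero (E.F_mem n 0 x hx) hy]

variable (E) (n)

theorem d_one : E.d n 1 = 0 := by
  have h := d_mul_of_mem_zero (E.one_mem n) 1
  rw [mul_one, mul_one, one_mul] at h
  exact left_eq_add.1 h

variable {n}

theorem V_one_mul (x : E.obj (n + 1)) : E.V n 1 * x = E.V n (E.F n x) := by
  rw [V_mul, one_mul]

theorem V_mul_V (x y : E.obj n) : E.V n x * E.V n y = p • E.V n (x * y) := by
  rw [V_mul, F_V, mul_smul_comm, map_nsmul]

variable {E} in
theorem V_d {x : E.obj n} (hx : x ∈ E.gr n 0) :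
    E.V n (E.d n x) = p • E.d (n + 1) (E.V n x) := by
  have hV1 : E.V n 1 ∈ E.gr (n + 1) 0 := E.V_mem n 0 1 (E.one_mem n)
  have hVx : E.V n x ∈ E.gr (n + 1) 0 := E.V_mem n 0 x hx
  have h := d_mul_of_mem_zero hV1 (E.V n x)
  rw [V_mul_V, one_mul, map_nsmul, V_one_mul, F_d_V,
    ← mul_comm_of_mem_zero hVx (E.d_mem _ _ _ hV1), V_mul, F_d_V, d_one, mul_zero, map_zero,
    zero_add] at h
  exact h.symm

variable (n)

theorem vOne_mem (i : ℕ) : E.vOne n i ∈ E.gr n 0 := by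
  induction n generalizing i with
  | zero => exact (E.level_zero.elim 0 (E.vOne 0 i)) ▸ zero_mem (E.gr 0 0)
  | succ n ih =>
    cases i with
    | zero => exact E.one_mem _
    | succ i => exact E.V_mem n 0 _ (ih i)

theorem dvOne_mem (i : ℕ) : E.dvOne n i ∈ E.gr n 1 := E.d_mem n 0 _ (E.vOne_mem n i)

theorem vOne_zero : E.vOne n 0 = 1 := by
  cases n <;> rfl

theorem dvOne_zero : E.dvOne n 0 = 0 := (congrArg (E.d n) (E.vOne_zero n)).trans (E.d_one n)

theorem R_vOne (i : ℕ) : E.R n (E.vOne (n + 1) i) = E.vOne n i := by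
  induction n generalizing i with
  | zero => exact E.level_zero.elim _ _
  | succ n ih =>
    cases i with
    | zero => exact map_one _
    | succ i => exact (E.R_V n _).trans (congrArg (E.V n) (ih i))

theorem R_dvOne (i : ℕ) : E.R n (E.dvOne (n + 1) i) = E.dvOne n i := by
  rw [dvOne, R_d, R_vOne, dvOne]

theorem V_vOne (i : ℕ) : E.V n (E.vOne n i) = E.vOne (n + 1) (i + 1) := rfl

theorem F_vOne (i : ℕ) : E.F n (E.vOne (n + 1) (i + 1)) = p • E.vOne n i := E.F_V n _

theorem F_dvOne (i : ℕ) : E.F n (E.dvOne (n + 1) (i + 1)) = E.dvOne n i := E.F_d_V n _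

theorem V_dvOne (i : ℕ) : E.V n (E.dvOne n i) = p • E.dvOne (n + 1) (i + 1) :=
  V_d (E.vOne_mem n i)

theorem V_mul_dvOne (i : ℕ) (x : E.obj n) :
    E.V n x * E.dvOne (n + 1) (i + 1) = E.V n (x * E.dvOne n i) := by
  rw [V_mul, F_dvOne]

theorem d_dvOne (i : ℕ) : E.d n (E.dvOne n i) = 0 := E.d_d n _

variable {n} in
theorem vOne_eq_zero {i : ℕ} (h : n ≤ i) : E.vOne n i = 0 := by
  induction n generalizing i with
  | zero => exact E.level_zero.elim _ _
  | succ n ih =>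
    obtain ⟨i, rfl⟩ := Nat.exists_eq_add_of_le' (Nat.one_le_of_lt h)
    exact (congrArg (E.V n) (ih (Nat.le_of_succ_le_succ h))).trans (map_zero _)

variable {n} in
theorem dvOne_eq_zero {i : ℕ} (h : n ≤ i) : E.dvOne n i = 0 := by
  rw [dvOne, vOne_eq_zero E h, map_zero]

theorem pow_smul_dvOne (i : ℕ) : p ^ i • E.dvOne n i = 0 := by
  induction n generalizing i with
  | zero => exact E.level_zero.elim _ _
  | succ n ih =>
    cases i with
    | zero => rw [dvOne_zero, smul_zero]
    | succ i => rw [pow_succ, mul_smul, ← V_dvOne, ← map_nsmul, ih, map_zero]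

theorem pow_smul_dvOne_of_le {i k : ℕ} (h : i ≤ k) : p ^ k • E.dvOne n i = 0 := by
  rw [← Nat.sub_add_cancel h, pow_add, mul_smul, pow_smul_dvOne, smul_zero]

theorem vOne_mul_vOne {i j : ℕ} (h : i ≤ j) : E.vOne n i * E.vOne n j = p ^ i • E.vOne n j := by
  induction n generalizing i j with
  | zero => exact E.level_zero.elim _ _
  | succ n ih =>
    cases i with
    | zero => exact (one_mul _).trans ((pow_zero p).symm ▸ (one_smul ℕ _).symm)
    | succ i =>
      obtain ⟨j, rfl⟩ := Nat.exists_eq_add_of_le' (Nat.one_le_of_lt h)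
      rw [← V_vOne, ← V_vOne, V_mul_V, ih (Nat.succ_le_succ_iff.1 h), map_nsmul, smul_smul,
        pow_succ']

theorem vOne_mul_dvOne {i j : ℕ} (h : i < j) :
    E.vOne n i * E.dvOne n j = p ^ i • E.dvOne n j := by
  induction n generalizing i j with
  | zero => exact E.level_zero.elim _ _
  | succ n ih =>
    cases i with
    | zero => exact (one_mul _).trans ((pow_zero p).symm ▸ (one_smul ℕ _).symm)
    | succ i =>
      obtain ⟨j, rfl⟩ := Nat.exists_eq_add_of_le' (Nat.one_le_of_lt h)
      rw [← V_vOne, V_mul_dvOne, ih (Nat.succ_lt_succ_iff.1 h), map_nsmul, V_dvOne, smul_smul,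
        pow_succ]

theorem vOne_mul_dvOne_of_le {i j : ℕ} (h : j ≤ i) : E.vOne n i * E.dvOne n j = 0 := by
  induction n generalizing i j with
  | zero => exact E.level_zero.elim _ _
  | succ n ih =>
    cases j with
    | zero => rw [dvOne_zero, mul_zero]
    | succ j =>
      obtain ⟨i, rfl⟩ := Nat.exists_eq_add_of_le' (Nat.one_le_of_lt h)
      rw [← V_vOne, V_mul_dvOne, ih (Nat.succ_le_succ_iff.1 h), map_zero]

theorem dvOne_mul_dvOne (i j : ℕ) : E.dvOne n i * E.dvOne n j = 0 := by
  have h := d_mul_of_mem_zero (E.vOne_mem n i) (E.dvOne n j)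
  rw [d_dvOne, mul_zero, add_zero] at h
  rcases lt_or_ge i j with hij | hij
  · rw [vOne_mul_dvOne E n hij, map_nsmul, d_dvOne, smul_zero] at h
    exact h.symm
  · rw [vOne_mul_dvOne_of_le E n hij, map_zero] at h
    exact h.symm

namespace Hom

variable {D E : WittComplex.{v} p A} (f : Hom D E)

theorem map_vOne (i : ℕ) : f.map n (D.vOne n i) = E.vOne n i := by
  induction n generalizing i with
  | zero => exact E.level_zero.elim _ _
  | succ n ih =>
    cases i with
    | zero => exact map_one _
    | succ i => exact (f.map_V n _).trans (congrArg (E.V n) (ih i))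

theorem map_dvOne (i : ℕ) : f.map n (D.dvOne n i) = E.dvOne n i := by
  rw [dvOne, f.map_d, map_vOne, dvOne]

end Hom

end WittComplex

namespace WittComplex

open GhostRing

variable {p : ℕ} [Fact p.Prime] {A : Type u} [CommRing A] [IsFermatRing p A]
  (E : WittComplex.{v} p A) (n : ℕ)

section Ghost

/-- The map `λ` in ghost coordinates. -/
def ofGhost : GhostRing p A n →+* E.obj n := (E.lam n).comp (equiv p A n).symm.toRingHom

theorem ofGhost_ghost (x : WittVector p A) :
    E.ofGhost n (ghost p A n x) = E.lam n (WittVector.truncate n x) :=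
  congrArg (E.lam n) (equiv_symm_ghost x)

theorem ofGhost_equiv (x : TruncatedWittVector p n A) :
    E.ofGhost n (equiv p A n x) = E.lam n x :=
  congrArg (E.lam n) ((equiv p A n).symm_apply_apply x)

theorem ofGhost_teich (a : A) : E.ofGhost n (teich p A n a) =
    E.lam n (WittVector.truncate n (WittVector.teichmuller p a)) := by
  rw [← ghost_teichmuller, ofGhost_ghost]

theorem ofGhost_mem (s : GhostRing p A n) : E.ofGhost n s ∈ E.gr n 0 := E.lam_mem n _

theorem R_ofGhost (s : GhostRing p A (n + 1)) :
    E.R n (E.ofGhost (n + 1) s) = E.ofGhost n (res p A n s) := by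
  obtain ⟨x, rfl⟩ := ghost_surjective (n + 1) s
  rw [ofGhost_ghost, R_lam, ← ofGhost_ghost]
  rfl

theorem F_ofGhost (s : GhostRing p A (n + 1)) :
    E.F n (E.ofGhost (n + 1) s) = E.ofGhost n (frob p A n s) := by
  obtain ⟨x, rfl⟩ := ghost_surjective (n + 1) s
  rw [ofGhost_ghost, F_lam, ← ghost_frobenius, ofGhost_ghost]

theorem V_ofGhost (s : GhostRing p A n) :
    E.V n (E.ofGhost n s) = E.ofGhost (n + 1) (ver p A n s) := by
  obtain ⟨x, rfl⟩ := ghost_surjective n s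
  rw [ofGhost_ghost, V_lam, ← ghost_verschiebung, ofGhost_ghost]

theorem ofGhost_vOne (i : ℕ) : E.ofGhost n (GhostRing.vOne p A n i) = E.vOne n i := by
  induction n generalizing i with
  | zero => exact E.level_zero.elim _ _
  | succ n ih =>
    cases i with
    | zero => exact map_one _
    | succ i => exact (E.V_ofGhost n _).symm.trans (congrArg (E.V n) (ih i))

/-- The map `A → W_n(A) → E.obj n` given by the constant sequences in ghost coordinates, through
which `E.obj n` becomes an `A`-algebra. -/
def scalar : A →+* E.obj n := (E.ofGhost n).comp (const p A n)

theorem ofGhost_const (a : A) : E.ofGhost n (const p A n a) = E.scalar n a := rfl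

theorem scalar_mem (a : A) : E.scalar n a ∈ E.gr n 0 := E.ofGhost_mem n _

theorem R_scalar (a : A) : E.R n (E.scalar (n + 1) a) = E.scalar n a := E.R_ofGhost n _

theorem F_scalar (a : A) : E.F n (E.scalar (n + 1) a) = E.scalar n a := E.F_ofGhost n _

theorem scalar_natCast_mul (k : ℕ) (x : E.obj n) : E.scalar n k * x = k • x := by
  rw [map_natCast, nsmul_eq_mul]

variable {n} in
theorem scalar_mul_V {q : ℕ} (a : A) {y : E.obj n} (hy : y ∈ E.gr n q) :
    E.scalar (n + 1) a * E.V n y = E.V n (E.scalar n a * y) := by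
  rw [mul_V (E.scalar_mem _ a) hy, F_scalar]

theorem ofGhost_mul_dvOne (s : GhostRing p A n) (j : Fin n) :
    E.ofGhost n s * E.dvOne n j = E.scalar n (s.1 j) * E.dvOne n j := by
  induction n with
  | zero => exact j.elim0
  | succ n ih =>
    cases j using Fin.cases with
    | zero => rw [Fin.val_zero, dvOne_zero, mul_zero, mul_zero]
    | succ j =>
      obtain ⟨t, ht⟩ := exists_eq_const_add_ver s
      have hj : s.1 j.succ = s.1 0 + t.1 j * p := by
        rw [mul_comm]
        exact congrFun (congrArg Subtype.val ht) j.succ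
      rw [hj, map_add (E.scalar _), add_mul, map_mul, mul_assoc, scalar_natCast_mul, Fin.val_succ,
        ← V_dvOne, E.scalar_mul_V _ (E.dvOne_mem n j), ← ih, ← V_mul_dvOne, V_ofGhost,
        ← ofGhost_const, ← add_mul, ← map_add, ← ht]

end Ghost

section Unramified

variable [Algebra.FormallyUnramified ℤ A]

theorem d_scalar (a : A) : E.d n (E.scalar n a) = 0 := by
  let := Module.compHom (E.obj n) (E.scalar n)
  let D : Derivation ℤ A (E.obj n) :=
    Derivation.mk' ((E.d n).comp (E.scalar n).toAddMonoidHom).toIntLinearMap fun a b => by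
      change E.d n (E.scalar n (a * b)) =
        E.scalar n a * E.d n (E.scalar n b) + E.scalar n b * E.d n (E.scalar n a)
      rw [map_mul, d_mul_of_mem_zero (E.scalar_mem n a), add_comm,
        ← mul_comm_of_mem_zero (E.scalar_mem n b) (E.d_mem n 0 _ (E.scalar_mem n a))]
  have : Subsingleton (Derivation ℤ A (E.obj n)) :=
    (KaehlerDifferential.linearMapEquivDerivation ℤ A).symm.injective.subsingleton
  exact congrArg (· a) (Subsingleton.elim D 0)

theorem d_scalar_mul (a : A) (x : E.obj n) : E.d n (E.scalar n a * x) = E.scalar n a * E.d n x := by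
  rw [d_mul_of_mem_zero (E.scalar_mem n a), d_scalar, zero_mul, zero_add]

end Unramified

section OneForm

/-- The form `∑ a j • dV^j(1)`. -/
def oneForm : (Fin n → A) →+ E.obj n :=
  ∑ j : Fin n, (AddMonoidHom.mulRight (E.dvOne n j)).comp
    ((E.scalar n).toAddMonoidHom.comp (Pi.evalAddMonoidHom _ j))

theorem oneForm_apply (a : Fin n → A) :
    E.oneForm n a = ∑ j, E.scalar n (a j) * E.dvOne n j :=
  AddMonoidHom.finsetSum_apply _ _ _

theorem oneForm_single (j : Fin n) (c : A) :
    E.oneForm n (Pi.single j c) = E.scalar n c * E.dvOne n j := by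
  rw [oneForm_apply, Finset.sum_eq_single j]
  · rw [Pi.single_eq_same]
  · intro i _ hij
    rw [Pi.single_eq_of_ne hij, map_zero, zero_mul]
  · exact fun h => absurd (Finset.mem_univ j) h

theorem oneForm_mem (a : Fin n → A) : E.oneForm n a ∈ E.gr n 1 := by
  rw [oneForm_apply]
  exact sum_mem fun j _ => E.mul_mem n 0 1 _ _ (E.scalar_mem n _) (E.dvOne_mem n j)

variable {n}

theorem oneForm_eq_zero {a : Fin n → A} (ha : ∀ j : Fin n, (p : A) ^ (j : ℕ) ∣ a j) :
    E.oneForm n a = 0 := by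
  rw [oneForm_apply]
  refine Finset.sum_eq_zero fun j _ => ?_
  obtain ⟨c, hc⟩ := ha j
  rw [hc, mul_comm, ← Nat.cast_pow, map_mul, mul_assoc, scalar_natCast_mul, pow_smul_dvOne,
    mul_zero]

theorem oneForm_congr {a b : Fin n → A} (h : ∀ j : Fin n, (p : A) ^ (j : ℕ) ∣ a j - b j) :
    E.oneForm n a = E.oneForm n b :=
  sub_eq_zero.1 <| (map_sub (E.oneForm n) a b).symm.trans (E.oneForm_eq_zero h)

theorem scalar_mul_oneForm (c : A) (a : Fin n → A) :
    E.scalar n c * E.oneForm n a = E.oneForm n (c • a) := by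
  simp only [oneForm_apply, Finset.mul_sum, ← mul_assoc, ← map_mul, Pi.smul_apply, smul_eq_mul]

theorem ofGhost_mul_oneForm (s : GhostRing p A n) (a : Fin n → A) :
    E.ofGhost n s * E.oneForm n a = E.oneForm n fun j => s.1 j * a j := by
  simp only [oneForm_apply, Finset.mul_sum]
  refine Finset.sum_congr rfl fun j _ => ?_
  rw [← mul_assoc, ← ofGhost_const, ← map_mul, mul_comm s, map_mul, mul_assoc, ofGhost_mul_dvOne,
    ofGhost_const, ← mul_assoc, ← map_mul, mul_comm]

theorem R_oneForm (a : Fin (n + 1) → A) :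
    E.R n (E.oneForm (n + 1) a) = E.oneForm n fun j => a j.castSucc := by
  simp only [oneForm_apply, map_add, map_sum, map_mul, R_scalar, R_dvOne, Fin.sum_univ_castSucc,
    Fin.val_last, Fin.val_castSucc, dvOne_eq_zero E le_rfl, mul_zero, add_zero]

theorem F_oneForm (a : Fin (n + 1) → A) :
    E.F n (E.oneForm (n + 1) a) = E.oneForm n fun j => a j.succ := by
  simp only [oneForm_apply, Fin.sum_univ_succ, Fin.val_zero, dvOne_zero, mul_zero, zero_add,
    map_sum, map_mul, F_scalar, Fin.val_succ, F_dvOne]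

theorem V_oneForm (a : Fin n → A) :
    E.V n (E.oneForm n a) = E.oneForm (n + 1) (Fin.cons 0 fun j => a j * p) := by
  simp only [oneForm_apply, map_sum, Fin.sum_univ_succ, Fin.cons_zero, Fin.cons_succ, map_zero,
    zero_mul, zero_add]
  refine Finset.sum_congr rfl fun j _ => ?_
  rw [← E.scalar_mul_V _ (E.dvOne_mem n j), V_dvOne, map_mul, mul_assoc, scalar_natCast_mul,
    Fin.val_succ]

section Unramified

variable [Algebra.FormallyUnramified ℤ A]

theorem d_oneForm (a : Fin n → A) : E.d n (E.oneForm n a) = 0 := by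
  simp only [oneForm_apply, map_sum, d_scalar_mul, d_dvOne, mul_zero, Finset.sum_const_zero]

theorem d_ofGhost (s : GhostRing p A n) : E.d n (E.ofGhost n s) = E.oneForm n (diffQuot s) := by
  cases n with
  | zero => exact E.level_zero.elim _ _
  | succ n =>
    conv_lhs => rw [eq_const_add_sum_diffQuot s]
    simp only [map_add, map_sum, map_mul, ofGhost_const, ofGhost_vOne, d_scalar, d_scalar_mul,
      oneForm_apply, Fin.sum_univ_succ, Fin.val_zero, dvOne_zero, mul_zero, zero_add,
      Fin.val_succ]
    rfl

end Unramified

theorem dvOne_mul_oneForm (i : ℕ) (a : Fin n → A) : E.dvOne n i * E.oneForm n a = 0 := by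
  rw [oneForm_apply, Finset.mul_sum]
  refine Finset.sum_eq_zero fun j _ => ?_
  rw [← mul_assoc, ← mul_comm_of_mem_zero (E.scalar_mem n _) (E.dvOne_mem n i), mul_assoc,
    dvOne_mul_dvOne, mul_zero]

theorem oneForm_mul_oneForm (a b : Fin n → A) : E.oneForm n a * E.oneForm n b = 0 := by
  rw [oneForm_apply, Finset.sum_mul]
  refine Finset.sum_eq_zero fun j _ => ?_
  rw [mul_assoc, dvOne_mul_oneForm, mul_zero]

end OneForm

namespace Hom

variable {D E : WittComplex.{v} p A} (f : Hom D E)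

theorem map_ofGhost (s : GhostRing p A n) : f.map n (D.ofGhost n s) = E.ofGhost n s :=
  f.map_lam n _

theorem map_scalar (a : A) : f.map n (D.scalar n a) = E.scalar n a := f.map_lam n _

theorem map_oneForm (a : Fin n → A) : f.map n (D.oneForm n a) = E.oneForm n a := by
  simp only [oneForm_apply, map_sum, map_mul, map_scalar, map_dvOne]

end Hom

end WittComplex

theorem GhostRing.exists_diffQuot_eq {p : ℕ} {A : Type u} [CommRing A] [IsFermatRing p A] {n : ℕ}
    (a : Fin n → A) : ∃ s : GhostRing p A n, ∀ j : Fin n, (j : ℕ) ≠ 0 → diffQuot s j = a j := by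
  let t : ℕ → A := fun k => ∑ i ∈ Finset.range (k + 1), p ^ i * if h : i < n then a ⟨i, h⟩ else 0
  have step : ∀ (j : Fin n), (j : ℕ) ≠ 0 → t j - t (prevIdx j) = p ^ (j : ℕ) * a j := by
    rintro ⟨_ | k, hk⟩ hj
    · exact absurd rfl hj
    · refine (sub_eq_of_eq_add' (Finset.sum_range_succ _ (k + 1))).trans ?_
      rw [dif_pos hk]
  refine ⟨⟨fun j => t j, fun j => ?_⟩, fun j hj => diffQuot_eq (step j hj).symm⟩
  rcases eq_or_ne (j : ℕ) 0 with hj | hj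
  · rw [prevIdx_of_eq_zero hj, sub_self]
    exact dvd_zero _
  · exact ⟨a j, step j hj⟩

namespace WittModule

open GhostRing SqZero WittComplex

variable {p : ℕ} [Fact p.Prime] {A : Type u} [CommRing A] [IsFermatRing p A] {D : WittModule p A}

theorem ofGhost_toWittComplex (n : ℕ) (s : GhostRing p A n) :
    D.toWittComplex.{v, u}.ofGhost n s = ofFst D n s :=
  congrArg (ofFst D n) ((equiv p A n).apply_symm_apply s)

/-- The inclusion of the part of degree one. -/
def ofDegreeOne (D : WittModule p A) (n : ℕ) : D.N n →+ D.toWittComplex.{v, u}.obj n := ofSnd D n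

/-- The part of degree one of a map from the Witt complex of a `WittModule` to a Witt complex `E`;
it determines the map, see `DegreeOneMap.hom`. -/
structure DegreeOneMap (D : WittModule p A) (E : WittComplex.{w} p A) where
  /-- the map in degree one -/
  toFun : ∀ n, D.N n →+ E.obj n
  mem : ∀ n m, toFun n m ∈ E.gr n 1
  smul : ∀ n s m, toFun n (s • m) = E.ofGhost n s * toFun n m
  mul : ∀ n m m', toFun n m * toFun n m' = 0
  map_R : ∀ n m, toFun n (D.R n m) = E.R n (toFun (n + 1) m)
  map_d : ∀ n s, toFun n (D.d n s) = E.d n (E.ofGhost n s)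
  d_map : ∀ n m, E.d n (toFun n m) = 0
  map_F : ∀ n m, toFun n (D.F n m) = E.F n (toFun (n + 1) m)
  map_V : ∀ n m, toFun (n + 1) (D.V n m) = E.V n (toFun n m)

namespace DegreeOneMap

section Lift

variable {E : WittComplex.{w} p A}

theorem lift_comm {X X' N N' B B' : Type*} [AddCommGroup X] [AddCommGroup X'] [AddCommGroup N]
    [AddCommGroup N'] [AddCommGroup B] [AddCommGroup B'] {f : X →+ N} {f' : X' →+ N'} {g : X →+ B}
    {g' : X' →+ B'} {φ : N →+ B} {φ' : N' →+ B'} (hf : Function.Surjective f)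
    (hφ : ∀ x, φ (f x) = g x) (hφ' : ∀ x, φ' (f' x) = g' x) {α : N → N'} {β : B → B'}
    (h : ∀ x, ∃ y, α (f x) = f' y ∧ β (g x) = g' y) (m : N) : φ' (α m) = β (φ m) := by
  obtain ⟨x, rfl⟩ := hf m
  obtain ⟨y, hα, hβ⟩ := h x
  rw [hα, hφ', hφ, hβ]

/-- The map in degree one taking `f x` to `g x`, where `x` runs through a group that parametrizes
the part of degree one, and the operations are given by the same formulas on both sides. -/
def lift {X : ℕ → Type*} [∀ n, AddCommGroup (X n)] (f : ∀ n, X n →+ D.N n)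
    (hf : ∀ n, Function.Surjective (f n)) (g : ∀ n, X n →+ E.obj n)
    (eq_zero : ∀ n x, f n x = 0 → g n x = 0) (mem : ∀ n x, g n x ∈ E.gr n 1)
    (mul : ∀ n x y, g n x * g n y = 0) (d_g : ∀ n x, E.d n (g n x) = 0)
    (d : ∀ n s, ∃ y, D.toWittComplex.{v, u}.d n (D.toWittComplex.ofGhost n s) =
      ofDegreeOne D n (f n y) ∧ E.d n (E.ofGhost n s) = g n y)
    (smul : ∀ n s x, ∃ y, D.toWittComplex.{v, u}.ofGhost n s * ofDegreeOne D n (f n x) =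
      ofDegreeOne D n (f n y) ∧ E.ofGhost n s * g n x = g n y)
    (R : ∀ n x, ∃ y, D.toWittComplex.{v, u}.R n (ofDegreeOne D (n + 1) (f (n + 1) x)) =
      ofDegreeOne D n (f n y) ∧ E.R n (g (n + 1) x) = g n y)
    (F : ∀ n x, ∃ y, D.toWittComplex.{v, u}.F n (ofDegreeOne D (n + 1) (f (n + 1) x)) =
      ofDegreeOne D n (f n y) ∧ E.F n (g (n + 1) x) = g n y)
    (V : ∀ n x, ∃ y, D.toWittComplex.{v, u}.V n (ofDegreeOne D n (f n x)) =
      ofDegreeOne D (n + 1) (f (n + 1) y) ∧ E.V n (g n x) = g (n + 1) y) :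
    DegreeOneMap D E :=
  let φ n : D.N n →+ E.obj n := (f n).liftOfSurjective (hf n) ⟨g n, eq_zero n⟩
  have hφ n x : φ n (f n x) = g n x :=
    (f n).liftOfRightInverse_comp_apply _ (Function.rightInverse_surjInv (hf n)) ⟨g n, eq_zero n⟩ x
  { toFun := φ
    mem := fun n => (hf n).forall.2 fun x => (hφ n x).symm ▸ mem n x
    smul := fun n s => lift_comm (hf n) (hφ n) (hφ n) (α := (s • ·)) fun x =>
      (smul n s x).imp fun y hy => ⟨by
        have h := hy.1
        rw [ofGhost_toWittComplex] at h
        exact congrArg (snd D n) ((ofFst_mul_ofSnd s (f n x)).symm.trans h), hy.2⟩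
    mul := fun n => (hf n).forall.2 fun x => (hf n).forall.2 fun y => by rw [hφ, hφ, mul]
    map_R := fun n => lift_comm (hf _) (hφ _) (hφ n) fun x =>
      (R n x).imp fun _ => And.imp_left (congrArg (snd D n))
    map_d := fun n s => by
      obtain ⟨y, hy, hy'⟩ := d n s
      rw [ofGhost_toWittComplex] at hy
      rw [hy', ← hφ]
      exact congrArg (φ n) (congrArg (snd D n) hy)
    d_map := fun n => (hf n).forall.2 fun x => by rw [hφ, d_g]
    map_F := fun n => lift_comm (hf _) (hφ _) (hφ n) fun x =>
      (F n x).imp fun _ => And.imp_left (congrArg (snd D n))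
    map_V := fun n => lift_comm (hf n) (hφ n) (hφ _) fun x =>
      (V n x).imp fun _ => And.imp_left (congrArg (snd D (n + 1))) }

theorem lift_apply {X : ℕ → Type*} [∀ n, AddCommGroup (X n)] {f : ∀ n, X n →+ D.N n}
    {g : ∀ n, X n →+ E.obj n} {hf eq_zero mem mul d_g d smul R F V} (n : ℕ) (x : X n) :
    (lift.{v} f hf g eq_zero mem mul d_g d smul R F V).toFun n (f n x) = g n x :=
  (f n).liftOfRightInverse_comp_apply _ (Function.rightInverse_surjInv (hf n)) ⟨g n, eq_zero n⟩ x

end Lift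

variable {E : WittComplex.{max u v} p A} (f : DegreeOneMap D E)

/-- The map of rings of level `n`. -/
def ringHom (n : ℕ) : SqZero.{v, u} D n →+* E.obj n where
  __ := ((E.ofGhost n).toAddMonoidHom.comp (fst D n).toAddMonoidHom) + (f.toFun n).comp (snd D n)
  map_one' := by
    change E.ofGhost n 1 + f.toFun n 0 = 1
    rw [map_one, map_zero, add_zero]
  map_mul' x y := by
    change E.ofGhost n (fst D n x * fst D n y) +
        f.toFun n (fst D n x • snd D n y + fst D n y • snd D n x) =
      (E.ofGhost n (fst D n x) + f.toFun n (snd D n x)) *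
        (E.ofGhost n (fst D n y) + f.toFun n (snd D n y))
    rw [map_mul, map_add, f.smul, f.smul,
      mul_comm_of_mem_zero (E.ofGhost_mem n (fst D n y)) (f.mem n _), mul_add, add_mul, add_mul,
      f.mul, add_zero, add_assoc, add_comm (f.toFun n (snd D n x) * _)]

/-- The map of Witt complexes determined by its part of degree one. -/
def hom : WittComplex.Hom D.toWittComplex E where
  map n := f.ringHom n
  map_mem n q x hx := by
    match q, hx with
    | 0, ⟨s, hs⟩ =>
      subst hs
      change E.ofGhost n s + f.toFun n 0 ∈ E.gr n 0
      rw [map_zero, add_zero]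
      exact E.ofGhost_mem n s
    | 1, ⟨m, hm⟩ =>
      subst hm
      change E.ofGhost n 0 + f.toFun n m ∈ E.gr n 1
      rw [map_zero, zero_add]
      exact f.mem n m
    | q + 2, hx =>
      have h0 : f.ringHom n x = 0 :=
        (congrArg _ (AddSubgroup.mem_bot.1 hx)).trans (map_zero (f.ringHom n))
      exact h0.symm ▸ zero_mem _
  map_R n x := (congrArg₂ (· + ·) (E.R_ofGhost n _).symm (f.map_R n _)).trans (map_add _ _ _).symm
  map_lam n x := by
    change E.ofGhost n (equiv p A n x) + f.toFun n 0 = E.lam n x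
    rw [map_zero, add_zero, ofGhost_equiv]
  map_d n x := by
    change E.ofGhost n 0 + f.toFun n (D.d n (fst D n x)) =
      E.d n (E.ofGhost n (fst D n x) + f.toFun n (snd D n x))
    rw [map_zero, zero_add, f.map_d, map_add, f.d_map, add_zero]
  map_F n x := (congrArg₂ (· + ·) (E.F_ofGhost n _).symm (f.map_F n _)).trans (map_add _ _ _).symm
  map_V n x := (congrArg₂ (· + ·) (E.V_ofGhost n _).symm (f.map_V n _)).trans (map_add _ _ _).symm

theorem hom_ofDegreeOne (n : ℕ) (m : D.N n) : f.hom.map n (ofDegreeOne D n m) = f.toFun n m := by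
  change E.ofGhost n 0 + f.toFun n m = _
  rw [map_zero, zero_add]

end DegreeOneMap

section DegreeOne

theorem exists_eq_ofGhost_add_ofDegreeOne (n : ℕ) (x : D.toWittComplex.{v, u}.obj n) :
    ∃ s m, x = D.toWittComplex.ofGhost n s + ofDegreeOne D n m :=
  ⟨fst D n x, snd D n x, by
    rw [ofGhost_toWittComplex]
    exact (ofFst_fst_add_ofSnd_snd D x).symm⟩

theorem hom_ext {E : WittComplex.{max u v} p A} {g h : WittComplex.Hom D.toWittComplex E}
    (H : ∀ n m, g.map n (ofDegreeOne D n m) = h.map n (ofDegreeOne D n m)) : g = h := by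
  refine WittComplex.Hom.ext (funext fun n => RingHom.ext fun x => ?_)
  obtain ⟨s, m, rfl⟩ := exists_eq_ofGhost_add_ofDegreeOne n x
  rw [map_add, map_add, g.map_ofGhost, h.map_ofGhost, H]

theorem ofDegreeOne_eq_oneForm [Algebra.FormallyUnramified ℤ A] {n : ℕ} {f : (Fin n → A) →+ D.N n}
    (f_diffQuot : ∀ s, f (diffQuot s) = D.d n s)
    (f_eq_zero : ∀ a : Fin n → A, (∀ j : Fin n, (p : A) ^ (j : ℕ) ∣ a j) → f a = 0)
    (a : Fin n → A) : ofDegreeOne D n (f a) = D.toWittComplex.{v, u}.oneForm n a := by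
  obtain ⟨s, hs⟩ := exists_diffQuot_eq (p := p) a
  have hdvd (j : Fin n) : (p : A) ^ (j : ℕ) ∣ a j - diffQuot s j := by
    rcases eq_or_ne (j : ℕ) 0 with hj | hj
    · rw [hj, pow_zero]
      exact one_dvd _
    · rw [hs j hj, sub_self]
      exact dvd_zero _
  rw [oneForm_congr _ hdvd, ← d_ofGhost, ofGhost_toWittComplex,
    sub_eq_zero.1 ((map_sub f a _).symm.trans (f_eq_zero _ hdvd)), f_diffQuot]
  rfl

end DegreeOne

end WittModule

namespace drwModule

open GhostRing FormRing WittModule WittComplex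

variable {p : ℕ} [Fact p.Prime] {A : Type u} [CommRing A] [IsFermatRing p A]
  [Algebra.FormallyUnramified ℤ A] (hp : p ≠ 2)

theorem ofDegreeOne_form (n : ℕ) (a : Fin n → A) :
    ofDegreeOne _ n (form hp n a) = (drwModule A hp).toWittComplex.{v, u}.oneForm n a :=
  ofDegreeOne_eq_oneForm (fun s => Subtype.ext (d_eq_logForm s).symm)
    (fun _ => (form_eq_zero_iff hp n).2) a

/-- The map from the de Rham-Witt complex to a Witt complex, in degree one. -/
def degreeOneMap (E : WittComplex.{max u v} p A) : DegreeOneMap (drwModule A hp) E :=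
  DegreeOneMap.lift.{v} (form hp) (form_surjective hp) E.oneForm
    (fun n _ ha => E.oneForm_eq_zero ((form_eq_zero_iff hp n).1 ha)) E.oneForm_mem
    (fun _ => E.oneForm_mul_oneForm) (fun _ => E.d_oneForm)
    (fun _ s => ⟨diffQuot s, by rw [d_ofGhost, ofDegreeOne_form], E.d_ofGhost s⟩)
    (fun _ s a => ⟨fun j => s.1 j * a j, by simp only [ofDegreeOne_form, ofGhost_mul_oneForm],
      E.ofGhost_mul_oneForm s a⟩)
    (fun _ a => ⟨fun j => a j.castSucc, by simp only [ofDegreeOne_form, R_oneForm],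
      E.R_oneForm a⟩)
    (fun _ a => ⟨fun j => a j.succ, by simp only [ofDegreeOne_form, F_oneForm], E.F_oneForm a⟩)
    (fun _ a => ⟨Fin.cons 0 fun j => a j * p, by simp only [ofDegreeOne_form, V_oneForm],
      E.V_oneForm a⟩)

/-- The complex of the forms `∑ a j • dV^j(1)` is the de Rham-Witt complex. -/
def isInitial : IsInitial (drwModule A hp).toWittComplex.{v, u} :=
  IsInitial.ofUniqueHom (fun E => (degreeOneMap.{v, u} hp E).hom) fun E f => hom_ext fun n m => by
    obtain ⟨a, rfl⟩ := form_surjective hp n m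
    rw [ofDegreeOne_form]
    exact (Hom.map_oneForm n f a).trans (Hom.map_oneForm n _ a).symm

end drwModule

namespace ZLoc

variable {p : ℕ} [Fact p.Prime]

theorem intCast_injective : Function.Injective (Int.cast : ℤ → ZLoc p) := fun _ _ h =>
  IsLocalization.injective (ZLoc p)
    (Ideal.primeCompl_le_nonZeroDivisors (Ideal.span {(p : ℤ)})) (by simpa only [eq_intCast])

theorem isUnit_intCast {m : ℤ} (hm : ¬ (p : ℤ) ∣ m) : IsUnit (m : ZLoc p) := by
  simpa only [eq_intCast] using IsLocalization.map_units (ZLoc p)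
    (⟨m, fun h => hm (Ideal.mem_span_singleton.1 h)⟩ : (Ideal.span {(p : ℤ)}).primeCompl)

theorem exists_mul_intCast_eq (a : ZLoc p) :
    ∃ k m : ℤ, ¬ (p : ℤ) ∣ m ∧ a * (m : ZLoc p) = k := by
  obtain ⟨⟨k, m⟩, h⟩ := IsLocalization.surj (Ideal.span {(p : ℤ)}).primeCompl a
  exact ⟨k, m, fun h => m.2 (Ideal.mem_span_singleton.2 h), by
    simpa only [eq_intCast] using h⟩

theorem isCoprime_pow {m : ℤ} (hm : ¬ (p : ℤ) ∣ m) (k : ℕ) : IsCoprime ((p : ℤ) ^ k) m :=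
  ((Nat.prime_iff_prime_int.1 Fact.out).coprime_iff_not_dvd.2 hm).pow_left

theorem pow_dvd_intCast_iff {k : ℕ} {c : ℤ} : (p : ZLoc p) ^ k ∣ c ↔ (p : ℤ) ^ k ∣ c := by
  refine ⟨fun ⟨a, ha⟩ => ?_, fun h => by exact_mod_cast map_dvd (Int.castRingHom (ZLoc p)) h⟩
  obtain ⟨x, m, hm, hx⟩ := exists_mul_intCast_eq a
  have h : c * m = (p : ℤ) ^ k * x := intCast_injective <| by
    push_cast
    rw [ha, mul_assoc, hx]
  exact (isCoprime_pow hm k).dvd_of_dvd_mul_right ⟨x, h⟩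

theorem exists_pow_dvd_sub_intCast (k : ℕ) (a : ZLoc p) : ∃ c : ℤ, (p : ZLoc p) ^ k ∣ a - c := by
  obtain ⟨x, m, hm, hx⟩ := exists_mul_intCast_eq a
  obtain ⟨r, s, h⟩ := isCoprime_pow hm k
  refine ⟨s * x, r * a, ?_⟩
  have h' : (r : ZLoc p) * p ^ k + s * m = 1 := by
    exact_mod_cast congrArg (Int.cast (R := ZLoc p)) h
  push_cast
  linear_combination -a * h' + s * hx

instance : IsFermatRing p (ZLoc p) where
  isLeftRegular := isLeftRegular_iff_isRegular.2 (isRegular_iff_mem_nonZeroDivisors.2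
    (natCast_mem_ZLocMonoid p))
  dvd_pow_sub_self a := by
    obtain ⟨c, hc⟩ := exists_pow_dvd_sub_intCast 1 a
    rw [pow_one] at hc
    have hcp : (p : ZLoc p) ∣ (c : ZLoc p) ^ p - c := by
      exact_mod_cast map_dvd (Int.castRingHom (ZLoc p))
        (Int.ModEq.pow_prime_eq_self Fact.out c).symm.dvd
    have hac : (p : ZLoc p) ∣ a ^ p - (c : ZLoc p) ^ p := hc.trans (sub_dvd_pow_sub_pow _ _ p)
    have := dvd_sub (dvd_add hac hcp) hc
    rwa [sub_add_sub_cancel, sub_sub_sub_cancel_right] at this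

instance : @Algebra.FormallyUnramified ℤ (ZLoc p) _ _ (Ring.toIntAlgebra _) := by
  rw [Subsingleton.elim (Ring.toIntAlgebra (ZLoc p)) OreLocalization.instAlgebra]
  exact .of_isLocalization (Ideal.span {(p : ℤ)}).primeCompl

theorem isUnit_iff_not_dvd {a : ZLoc p} : IsUnit a ↔ ¬ (p : ZLoc p) ∣ a := by
  have hdvd (c : ℤ) : (p : ZLoc p) ∣ c ↔ (p : ℤ) ∣ c := by
    rw [← pow_one (p : ZLoc p), pow_dvd_intCast_iff, pow_one]
  refine ⟨fun ha h => ?_, fun ha => ?_⟩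
  · have h1 := (hdvd 1).1 (Int.cast_one (R := ZLoc p) ▸ h.trans ha.dvd)
    exact (Nat.prime_iff_prime_int.1 Fact.out).not_dvd_one h1
  · obtain ⟨x, m, hm, hx⟩ := exists_mul_intCast_eq a
    have hm' := isUnit_intCast hm
    refine isUnit_of_mul_isUnit_left (hx ▸ isUnit_intCast fun h => ha ?_)
    exact hm'.dvd_mul_right.1 (hx ▸ (hdvd x).2 h)

/-- The element `p` of the monoid `ℚ^* ∩ ℤ_(p)`. -/
def pMon (p : ℕ) [Fact p.Prime] : ZLocMonoid p := ⟨p, natCast_mem_ZLocMonoid p⟩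

theorem isUnit_monoid_iff {a : ZLocMonoid p} : IsUnit a ↔ IsUnit (a : ZLoc p) := by
  refine ⟨fun h => h.map (ZLocMonoid p).subtype, fun h => ?_⟩
  obtain ⟨b, hb⟩ := h.exists_right_inv
  have hbM : b ∈ ZLocMonoid p := (IsUnit.of_mul_eq_one_right _ hb).mem_nonZeroDivisors
  exact .of_mul_eq_one ⟨b, hbM⟩ (Subtype.ext hb)

theorem exists_eq_pow_mul_unit (a : ZLocMonoid p) :
    ∃ (k : ℕ) (u : (ZLocMonoid p)ˣ), a = pMon p ^ k * u := by
  have hfin : FiniteMultiplicity (p : ZLoc p) a :=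
    .of_not_isUnit (fun h => isUnit_iff_not_dvd.1 h dvd_rfl) (nonZeroDivisors.ne_zero a.2)
  obtain ⟨b, hb, hpb⟩ := hfin.exists_eq_pow_mul_and_not_dvd
  have hunit := isUnit_iff_not_dvd.2 hpb
  obtain ⟨u, hu⟩ := isUnit_monoid_iff (a := ⟨b, hunit.mem_nonZeroDivisors⟩).2 hunit
  refine ⟨multiplicity (p : ZLoc p) a, u, Subtype.ext (hb.trans ?_)⟩
  rw [Submonoid.coe_mul, hu]
  rfl

theorem pow_mul_unit_injective {k l : ℕ} {u w : (ZLocMonoid p)ˣ}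
    (h : pMon p ^ k * u = pMon p ^ l * w) : k = l ∧ u = w := by
  have hval : (p : ZLoc p) ^ k * (u : ZLocMonoid p) = (p : ZLoc p) ^ l * (w : ZLocMonoid p) :=
    congrArg Subtype.val h
  have hle {i j : ℕ} {v v' : (ZLocMonoid p)ˣ}
      (h : (p : ZLoc p) ^ i * (v : ZLocMonoid p) = (p : ZLoc p) ^ j * (v' : ZLocMonoid p)) :
      j ≤ i := by
    refine (pow_dvd_pow_iff (nonZeroDivisors.ne_zero (pMon p).2)
      fun h => isUnit_iff_not_dvd.1 h dvd_rfl).1 ?_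
    exact (isUnit_monoid_iff.1 v.isUnit).dvd_mul_right.1 ⟨_, h⟩
  obtain rfl := le_antisymm (hle hval.symm) (hle hval)
  exact ⟨rfl, Units.ext (mul_left_cancel h)⟩

/-- The decomposition of `ℚ^* ∩ ℤ_(p)` into the powers of `p` and the units. -/
def powMulUnitEquiv (p : ℕ) [Fact p.Prime] :
    Multiplicative ℕ × (ZLocMonoid p)ˣ ≃* ZLocMonoid p :=
  MulEquiv.ofBijective ((powersHom _ (pMon p)).coprod (Units.coeHom _))
    ⟨fun _ _ h => Prod.ext (pow_mul_unit_injective h).1 (pow_mul_unit_injective h).2, fun a =>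
      let ⟨k, u, h⟩ := exists_eq_pow_mul_unit a
      ⟨(Multiplicative.ofAdd k, u), h.symm⟩⟩

end ZLoc

namespace GhostRing

variable {p : ℕ} [Fact p.Prime] {A : Type u} [CommRing A] [IsFermatRing p A] {n : ℕ}

theorem exists_teich_prime_eq (hp : p ≠ 2) : ∃ w : GhostRing p A n,
    (∀ j : Fin n, (p : A) ^ (j : ℕ) ∣ w.1 j) ∧
      teich p A (n + 1) p = const p A (n + 1) p + ver p A n (teich p A n p * w - 1) := by
  have hp3 : 2 < p := lt_of_le_of_ne (Fact.out : p.Prime).two_le hp.symm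
  have hle (i : ℕ) : i + 2 ≤ (p - 1) * p ^ i := calc
    i + 2 ≤ 2 * p ^ i := by have := i.lt_pow_self (hp3.trans' one_lt_two); omega
    _ ≤ (p - 1) * p ^ i := Nat.mul_le_mul_right _ (by omega)
  let w (j : ℕ) : A := p ^ ((p - 1) * p ^ j - 1)
  have hw (j : ℕ) : (p : A) ^ (j + 1) ∣ w j := pow_dvd_pow _ (by have := hle j; omega)
  have hw' (j : ℕ) : (p : A) ^ j ∣ w j := (pow_dvd_pow _ j.le_succ).trans (hw j)
  refine ⟨⟨fun j => w j, ?_⟩, fun j => hw' j, ext fun j => ?_⟩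
  · rintro ⟨_ | i, _⟩
    · exact (pow_zero (p : A)).symm ▸ one_dvd _
    · exact dvd_sub (hw' (i + 1)) (hw i)
  · cases j using Fin.cases with
    | zero => exact (pow_one _).trans (add_zero _).symm
    | succ j =>
      have hexp : 1 + (p ^ (j : ℕ) + ((p - 1) * p ^ (j : ℕ) - 1)) = p ^ (j + 1 : ℕ) := by
        have := hle j
        rw [pow_succ', ← Nat.sub_add_cancel (hp3.trans' one_lt_two).le, Nat.add_sub_cancel,
          add_mul, one_mul] at *
        omega
      change (p : A) ^ p ^ (j + 1 : ℕ) = p + p * (p ^ p ^ (j : ℕ) * w j - 1)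
      rw [← hexp, pow_add, pow_add, pow_one]
      ring

omit [Fact p.Prime] [IsFermatRing p A] in
theorem induction_on {P : GhostRing p A n → Prop} (const : ∀ a, P (const p A n a))
    (vOne : ∀ i, P (vOne p A n i)) (add : ∀ s t, P s → P t → P (s + t))
    (mul : ∀ s t, P s → P t → P (s * t)) (s : GhostRing p A n) : P s := by
  cases n with
  | zero => exact Subsingleton.elim 0 s ▸ map_zero (GhostRing.const p A 0) ▸ const 0
  | succ n =>
    rw [eq_const_add_sum_diffQuot s]
    exact add _ _ (const _) <| Finset.sum_induction _ P add
      (map_zero (GhostRing.const p A (n + 1)) ▸ const 0) fun _ _ => mul _ _ (const _) (vOne _)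

/-- The coefficients of the form `dV^k(1) + p^(p-2) dV^(k+1)(1)`, which measures the failure of
`V^k(1) dlog [p] = p^k dlog [p]`. -/
def correction (p : ℕ) (A : Type u) [CommRing A] {n : ℕ} (k : ℕ) (j : Fin n) : A :=
  (if (j : ℕ) = k then 1 else 0) + if (j : ℕ) = k + 1 then (p : A) ^ (p - 2) else 0

theorem pow_dvd_diffQuot_teich_prime_add (hp : p ≠ 2) (j : Fin n) :
    (p : A) ^ (j : ℕ) ∣ diffQuot (teich p A n p) j + correction p A 1 j := by
  have hp3 : 3 ≤ p := lt_of_le_of_ne (Fact.out : p.Prime).two_le hp.symm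
  have hle (i : ℕ) : 2 * (i + 1) ≤ p ^ (i + 1) :=
    (Nat.mul_le_mul (hp3.trans' (by decide)) (i.lt_pow_self (hp3.trans' (by decide)))).trans_eq
      (pow_succ' p i).symm
  refine IsFermatRing.pow_dvd_of_pow_add_dvd_mul (k := j) ?_
  rw [correction, mul_add, pow_mul_diffQuot, teich_val, teich_val, ← two_mul]
  obtain ⟨_ | _ | _ | i, hj⟩ := j
  · exact (pow_zero (p : A)).symm ▸ one_dvd _
  · simpa [prevIdx] using pow_dvd_pow (p : A) (hle 0)
  · have hpow : (p : A) ^ 2 * p ^ (p - 2) = p ^ p := by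
      rw [← pow_add, Nat.add_sub_cancel' (hp3.trans' (by decide))]
    simpa [prevIdx, hpow] using pow_dvd_pow (p : A) (hle 1)
  · have hle' : 2 * (i + 3) ≤ p ^ (i + 2) := calc
      2 * (i + 3) ≤ 3 * (2 * (i + 1)) := by omega
      _ ≤ p * p ^ (i + 1) := Nat.mul_le_mul hp3 (hle i)
      _ = p ^ (i + 2) := (pow_succ' p (i + 1)).symm
    simpa [prevIdx] using dvd_sub (pow_dvd_pow (p : A) (hle (i + 2))) (pow_dvd_pow (p : A) hle')

end GhostRing

namespace WittComplex

variable {p : ℕ} [Fact p.Prime] {A : Type u} [CommRing A] [IsFermatRing p A]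
  (E : WittComplex.{v} p A) (n : ℕ)

theorem oneForm_ite (k : ℕ) (c : A) :
    E.oneForm n (fun j => if (j : ℕ) = k then c else 0) = E.scalar n c * E.dvOne n k := by
  by_cases hk : k < n
  · rw [← E.oneForm_single n ⟨k, hk⟩ c]
    congr 1
    ext j
    simp only [Pi.single_apply, Fin.ext_iff]
  · rw [dvOne_eq_zero E (not_lt.1 hk), mul_zero, oneForm_apply]
    refine Finset.sum_eq_zero fun j _ => ?_
    rw [if_neg (by omega), map_zero, zero_mul]

theorem oneForm_correction (k : ℕ) : E.oneForm n (GhostRing.correction p A k) =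
    E.dvOne n k + p ^ (p - 2) • E.dvOne n (k + 1) := by
  rw [← one_mul (E.dvOne n k), ← map_one (E.scalar n), ← E.scalar_natCast_mul, Nat.cast_pow,
    ← E.oneForm_ite, ← E.oneForm_ite, ← map_add]
  rfl

end WittComplex

namespace LogWittComplex

open GhostRing

section DlogOf

variable {p : ℕ} [Fact p.Prime] {A : Type u} [CommRing A] {M : Type w} [CommMonoid M] {α : M →* A}
  (E : LogWittComplex.{v} p α) (n : ℕ)

/-- The element `dlog [a]_n`. -/
def dlogOf (a : M) : E.obj n := E.dlog n (E.lamMon a)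

theorem dlogOf_mem (a : M) : E.dlogOf n a ∈ E.gr n 1 := E.dlog_mem n _

theorem R_dlogOf (a : M) : E.R n (E.dlogOf (n + 1) a) = E.dlogOf n a := E.R_dlog n _

theorem F_dlogOf (a : M) : E.F n (E.dlogOf (n + 1) a) = E.dlogOf n a := E.F_dlog n a

theorem d_dlogOf (a : M) : E.d n (E.dlogOf n a) = 0 := E.d_dlog n _

theorem teich_mul_dlogOf [IsFermatRing p A] (a : M) :
    E.ofGhost n (teich p A n (α a)) * E.dlogOf n a = E.d n (E.ofGhost n (teich p A n (α a))) := by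
  rw [WittComplex.ofGhost_teich, ← pre_lamMon]
  exact E.pre_mul_dlog n _

end DlogOf

section Prime

variable {p : ℕ} [Fact p.Prime] {A : Type u} [CommRing A] [IsFermatRing p A]
  [Algebra.FormallyUnramified ℤ A] {M : Type w} [CommMonoid M] {α : M →* A}
  (E : LogWittComplex.{v} p α) {m : M} (hm : α m = p) (hp : p ≠ 2) (n : ℕ)

include hp in
theorem d_teich_prime : E.d n (E.ofGhost n (teich p A n p)) =
    -(E.dvOne n 1 + p ^ (p - 2) • E.dvOne n 2) := by
  rw [WittComplex.d_ofGhost, eq_neg_iff_add_eq_zero, ← E.oneForm_correction, ← map_add]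
  exact E.oneForm_eq_zero (pow_dvd_diffQuot_teich_prime_add hp)

include hm hp

theorem V_dlogOf : E.V n (E.dlogOf n m) =
    p • E.dlogOf (n + 1) m + (E.dvOne (n + 1) 1 + p ^ (p - 2) • E.dvOne (n + 1) 2) := by
  obtain ⟨w, hw, hteich⟩ := exists_teich_prime_eq (A := A) (n := n) hp
  have hzero : E.ofGhost n (teich p A n p * w) * E.dlogOf n m = 0 := by
    rw [mul_comm, map_mul, mul_assoc, ← hm, teich_mul_dlogOf, WittComplex.d_ofGhost,
      E.ofGhost_mul_oneForm]
    exact E.oneForm_eq_zero fun j => (hw j).mul_right _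
  have h := E.teich_mul_dlogOf (n + 1) m
  rw [hm, d_teich_prime E hp, hteich, map_add, add_mul, WittComplex.ofGhost_const,
    E.scalar_natCast_mul, ← E.V_ofGhost, E.V_mul, F_dlogOf, map_sub, sub_mul, hzero, map_one,
    one_mul, zero_sub, map_neg, ← sub_eq_add_neg] at h
  rw [← sub_eq_iff_eq_add', ← neg_sub, h, neg_neg]

theorem vOne_mul_dlogOf (i : ℕ) : E.vOne n (i + 1) * E.dlogOf n m =
    p ^ (i + 1) • E.dlogOf n m +
      p ^ i • (E.dvOne n (i + 1) + p ^ (p - 2) • E.dvOne n (i + 2)) := by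
  induction n generalizing i with
  | zero => exact E.level_zero.elim _ _
  | succ n ih =>
    rw [← E.V_vOne, E.V_mul, F_dlogOf]
    cases i with
    | zero =>
      rw [E.vOne_zero, one_mul, V_dlogOf E hm hp, zero_add, pow_one, pow_zero, one_smul]
    | succ i =>
      have hp3 : 3 ≤ p := lt_of_le_of_ne (Fact.out : p.Prime).two_le hp.symm
      simp only [ih, V_dlogOf E hm hp, map_add, map_nsmul, E.V_dvOne, smul_add, smul_smul,
        ← pow_add, ← pow_succ, E.pow_smul_dvOne_of_le (n + 1) (show 1 ≤ i + 1 by omega),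
        E.pow_smul_dvOne_of_le (n + 1) (show 2 ≤ i + 1 + (p - 2) by omega), add_zero]
      rw [add_right_comm i 1 (p - 2)]

theorem pow_smul_dlogOf : p ^ n • E.dlogOf n m = 0 := by
  cases n with
  | zero => exact E.level_zero.elim _ _
  | succ n =>
    have h := vOne_mul_dlogOf E hm hp (n + 1) n
    rwa [E.vOne_eq_zero le_rfl, E.dvOne_eq_zero le_rfl, E.dvOne_eq_zero (Nat.le_succ _), zero_mul,
      smul_zero, add_zero, smul_zero, add_zero, eq_comm] at h

theorem dvOne_mul_dlogOf (i : ℕ) : E.dvOne n i * E.dlogOf n m = 0 := by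
  cases i with
  | zero => rw [E.dvOne_zero, zero_mul]
  | succ i =>
    have h := congrArg (E.d n) (vOne_mul_dlogOf E hm hp n i)
    simp only [WittComplex.d_mul_of_mem_zero (E.vOne_mem n _), map_add, map_nsmul, d_dlogOf,
      E.d_dvOne, mul_zero, add_zero, smul_zero] at h
    exact h

theorem dlogOf_mul_self : E.dlogOf n m * E.dlogOf n m = 0 := by
  have htwo : (2 : ℤ) • (E.dlogOf n m * E.dlogOf n m) = 0 := by
    have h := E.graded_comm n 1 1 _ _ (E.dlogOf_mem n m) (E.dlogOf_mem n m)
    rw [mul_one, pow_one, neg_mul, one_mul, eq_neg_iff_add_eq_zero] at h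
    rwa [two_smul]
  have hpow : ((p : ℤ) ^ n) • (E.dlogOf n m * E.dlogOf n m) = 0 := by
    rw [← smul_mul_assoc, ← Nat.cast_pow, natCast_zsmul, pow_smul_dlogOf E hm hp, zero_mul]
  obtain ⟨a, b, hab⟩ : IsCoprime (2 : ℤ) ((p : ℤ) ^ n) := by
    refine IsCoprime.pow_right (Nat.isCoprime_iff_coprime.2 ?_)
    exact (Nat.coprime_primes Nat.prime_two Fact.out).2 hp.symm
  rw [← one_smul ℤ (E.dlogOf n m * E.dlogOf n m), ← hab, add_smul, mul_smul, mul_smul, htwo, hpow,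
    smul_zero, smul_zero, add_zero]

end Prime

section LogForm

variable {p : ℕ} [Fact p.Prime] {A : Type u} [CommRing A] [IsFermatRing p A] {M : Type w}
  [CommMonoid M] {α : M →* A} (E : LogWittComplex.{v} p α) (m : M) {n : ℕ}

/-- The form `∑ a j • dV^j(1) + b • dlog [m]` given by the pair of `a` and `b`. -/
def logForm (n : ℕ) : (Fin n → A) × A →+ E.obj n :=
  (E.oneForm n).coprod ((AddMonoidHom.mulRight (E.dlogOf n m)).comp (E.scalar n).toAddMonoidHom)

theorem logForm_apply (x : (Fin n → A) × A) :
    E.logForm m n x = E.oneForm n x.1 + E.scalar n x.2 * E.dlogOf n m := rfl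

theorem logForm_inl (a : Fin n → A) : E.logForm m n (a, 0) = E.oneForm n a := by
  rw [logForm_apply, map_zero, zero_mul, add_zero]

theorem logForm_mem (x : (Fin n → A) × A) : E.logForm m n x ∈ E.gr n 1 :=
  add_mem (E.oneForm_mem n x.1) (E.mul_mem n 0 1 _ _ (E.scalar_mem n _) (E.dlogOf_mem n m))

theorem scalar_mul_logForm (c : A) (x : (Fin n → A) × A) :
    E.scalar n c * E.logForm m n x = E.logForm m n (c • x) := by
  rw [logForm_apply, mul_add, E.scalar_mul_oneForm, ← mul_assoc, ← map_mul]
  rfl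

theorem R_logForm (x : (Fin (n + 1) → A) × A) :
    E.R n (E.logForm m (n + 1) x) = E.logForm m n (fun j => x.1 j.castSucc, x.2) := by
  rw [logForm_apply, map_add, map_mul, E.R_oneForm, E.R_scalar, R_dlogOf]
  rfl

theorem F_logForm (x : (Fin (n + 1) → A) × A) :
    E.F n (E.logForm m (n + 1) x) = E.logForm m n (fun j => x.1 j.succ, x.2) := by
  rw [logForm_apply, map_add, map_mul, E.F_oneForm, E.F_scalar, F_dlogOf]
  rfl

variable [Algebra.FormallyUnramified ℤ A]

theorem d_ofGhost_eq_logForm (s : GhostRing p A n) :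
    E.d n (E.ofGhost n s) = E.logForm m n (diffQuot s, 0) :=
  (E.d_ofGhost s).trans (E.logForm_inl m _).symm

theorem d_logForm (x : (Fin n → A) × A) : E.d n (E.logForm m n x) = 0 := by
  rw [logForm_apply, map_add, E.d_oneForm, E.d_scalar_mul, d_dlogOf, mul_zero, add_zero]

variable {m} (hm : α m = p) (hp : p ≠ 2)

include hm hp

theorem logForm_eq_zero {x : (Fin n → A) × A} (h : ∀ j : Fin n, (p : A) ^ (j : ℕ) ∣ x.1 j)
    (h' : (p : A) ^ n ∣ x.2) : E.logForm m n x = 0 := by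
  obtain ⟨c, hc⟩ := h'
  rw [logForm_apply, E.oneForm_eq_zero h, hc, mul_comm, map_mul, mul_assoc, ← Nat.cast_pow,
    E.scalar_natCast_mul, pow_smul_dlogOf E hm hp, mul_zero, add_zero]

theorem oneForm_mul_dlogOf (a : Fin n → A) : E.oneForm n a * E.dlogOf n m = 0 := by
  rw [E.oneForm_apply, Finset.sum_mul]
  exact Finset.sum_eq_zero fun j _ => by rw [mul_assoc, dvOne_mul_dlogOf E hm hp, mul_zero]

theorem logForm_mul_logForm (x y : (Fin n → A) × A) :
    E.logForm m n x * E.logForm m n y = 0 := by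
  have hone : E.oneForm n x.1 * E.logForm m n y = 0 := by
    rw [logForm_apply, mul_add, E.oneForm_mul_oneForm, zero_add, ← mul_assoc,
      ← WittComplex.mul_comm_of_mem_zero (E.scalar_mem n _) (E.oneForm_mem n _),
      E.scalar_mul_oneForm, oneForm_mul_dlogOf E hm hp]
  have hdlog : E.dlogOf n m * E.logForm m n y = 0 := by
    rw [E.graded_comm n 1 1 _ _ (E.dlogOf_mem n m) (E.logForm_mem m y), logForm_apply, add_mul,
      oneForm_mul_dlogOf E hm hp, mul_assoc, dlogOf_mul_self E hm hp, mul_zero, add_zero, mul_zero]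
  rw [logForm_apply, add_mul, hone, mul_assoc, hdlog, mul_zero, add_zero]

theorem V_logForm (x : (Fin n → A) × A) : E.V n (E.logForm m n x) =
    E.logForm m (n + 1) (Fin.cons 0 (fun j => x.1 j * p) + x.2 • correction p A 1, x.2 * p) := by
  rw [logForm_apply, logForm_apply, map_add, E.V_oneForm, ← E.scalar_mul_V _ (E.dlogOf_mem n m),
    V_dlogOf E hm hp, ← E.oneForm_correction, mul_add, E.scalar_mul_oneForm, map_add, map_mul,
    mul_assoc, E.scalar_natCast_mul, add_assoc, add_comm (E.scalar _ _ * _)]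

theorem vOne_succ_mul_logForm (i : ℕ) (x : (Fin n → A) × A) :
    E.vOne n (i + 1) * E.logForm m n x = E.logForm m n
      ((fun j => (vOne p A n (i + 1)).1 j * x.1 j) + (x.2 * p ^ i) • correction p A (i + 1),
        x.2 * p ^ (i + 1)) := by
  have hcomm : E.vOne n (i + 1) * E.scalar n x.2 = E.scalar n x.2 * E.vOne n (i + 1) :=
    WittComplex.mul_comm_of_mem_zero (E.vOne_mem n _) (E.scalar_mem n _)
  rw [logForm_apply, logForm_apply, mul_add, ← E.ofGhost_vOne, E.ofGhost_mul_oneForm,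
    E.ofGhost_vOne, ← mul_assoc, hcomm, mul_assoc, vOne_mul_dlogOf E hm hp,
    ← E.oneForm_correction, mul_add, ← E.scalar_natCast_mul, ← E.scalar_natCast_mul, ← mul_assoc,
    ← mul_assoc, ← map_mul, ← map_mul, E.scalar_mul_oneForm, map_add, Nat.cast_pow, Nat.cast_pow,
    add_assoc, add_comm (E.scalar _ _ * _)]

omit E in
theorem exists_ofGhost_mul_logForm (s : GhostRing p A n) (x : (Fin n → A) × A) :
    ∃ y, ∀ E : LogWittComplex.{v} p α, E.ofGhost n s * E.logForm m n x = E.logForm m n y := by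
  induction s using GhostRing.induction_on generalizing x with
  | const a => exact ⟨a • x, fun E => E.scalar_mul_logForm m a x⟩
  | vOne i =>
    simp only [fun E : LogWittComplex.{v} p α => E.ofGhost_vOne n i]
    cases i with
    | zero => exact ⟨x, fun E => by rw [E.vOne_zero, one_mul]⟩
    | succ i => exact ⟨_, fun E => vOne_succ_mul_logForm E hm hp i x⟩
  | add s t hs ht =>
    obtain ⟨y, hy⟩ := hs x
    obtain ⟨z, hz⟩ := ht x
    exact ⟨y + z, fun E => by rw [map_add, add_mul, hy, hz, map_add]⟩
  | mul s t hs ht =>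
    obtain ⟨y, hy⟩ := ht x
    obtain ⟨z, hz⟩ := hs y
    exact ⟨z, fun E => by rw [map_mul, mul_assoc, hy, hz]⟩

end LogForm

end LogWittComplex

namespace FormRing

open GhostRing

variable {p : ℕ} [Fact p.Prime] {A : Type u} [CommRing A] [IsFermatRing p A] {n : ℕ} (hp : p ≠ 2)

theorem pow_dvd_lastVal_teich_prime : (p : A) ^ n ∣ lastVal (teich p A n p) := by
  cases n with
  | zero => exact (pow_zero (p : A)).symm ▸ one_dvd _
  | succ n => exact pow_dvd_pow _ (n.lt_pow_self (Fact.out : p.Prime).one_lt)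

include hp in
theorem pow_dvd_twist_teich_prime_sub (j : Fin n) :
    (p : A) ^ (j + 1 : ℕ) ∣ twist (teich p A n p) j - p * correction p A 1 j := by
  have hp3 : 3 ≤ p := lt_of_le_of_ne (Fact.out : p.Prime).two_le hp.symm
  obtain ⟨_ | _ | _ | i, hj⟩ := j
  · simp [twist, prevIdx, teich_val, correction]
  · simp [twist, prevIdx, teich_val, correction]
  · have h : twist (teich p A n p) ⟨2, hj⟩ - p * correction p A 1 (⟨2, hj⟩ : Fin n) =
        (p : A) ^ p - p ^ (p - 2 + p) := by
      simp only [twist, prevIdx, Nat.add_one_sub_one, teich_val, pow_one, tsub_self, pow_zero,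
        correction, OfNat.ofNat_ne_one, ↓reduceIte, Nat.reduceAdd, zero_add, pow_add]
      ring
    rw [h]
    change (p : A) ^ 3 ∣ _
    exact dvd_sub (pow_dvd_pow _ hp3) (pow_dvd_pow _ (by omega))
  · have hlt : i + 3 ≤ p ^ (i + 1) := calc
      i + 3 ≤ 3 * (i + 1) := by omega
      _ ≤ p * p ^ i := Nat.mul_le_mul hp3 (i.lt_pow_self (hp3.trans' (by decide)))
      _ = p ^ (i + 1) := (pow_succ' p i).symm
    have hlt' : i + 4 ≤ p ^ (i + 2) := (Nat.pow_lt_pow_succ (hp3.trans' (by decide))).trans_le' hlt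
    have h : twist (teich p A n p) ⟨i + 3, hj⟩ - p * correction p A 1 (⟨i + 3, hj⟩ : Fin n) =
        (p : A) ^ p ^ (i + 2) - p ^ (p - 2) * (p ^ p ^ (i + 2) - p ^ p ^ (i + 1)) := by
      simp [twist, prevIdx, teich_val, correction]
    rw [h, mul_sub, ← pow_add, ← pow_add]
    change (p : A) ^ (i + 4) ∣ _
    exact dvd_sub (pow_dvd_pow _ hlt')
      (dvd_sub (pow_dvd_pow _ (by omega)) (pow_dvd_pow _ (by omega)))

theorem scalar_teich_prime : scalar hp n (teich p A n p) = d p A n (teich p A n p) := by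
  refine mk_eq_mk_iff.2 ⟨fun j => ?_,
    (sub_zero (lastVal (teich p A n p))).symm ▸ pow_dvd_lastVal_teich_prime⟩
  have h := mul_dvd_mul_left (p : A) (pow_dvd_diffQuot_teich_prime_add (A := A) hp j)
  rw [← pow_succ', mul_add] at h
  have h' := dvd_add (pow_dvd_twist_teich_prime_sub hp j) h
  rwa [sub_add_add_cancel, ← sub_neg_eq_add] at h'

end FormRing

namespace ZLoc

theorem monoid_induction {p : ℕ} [Fact p.Prime] {P : ZLocMonoid p → Prop} (prime : P (pMon p))
    (unit : ∀ u : (ZLocMonoid p)ˣ, P u) (mul : ∀ a b, P a → P b → P (a * b)) (a : ZLocMonoid p) :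
    P a := by
  obtain ⟨k, u, rfl⟩ := exists_eq_pow_mul_unit a
  induction k with
  | zero => exact (one_mul (u : ZLocMonoid p)).symm ▸ unit u
  | succ k ih =>
    rw [pow_succ', mul_assoc]
    exact mul _ _ prime ih

end ZLoc

namespace WittComplex

open GhostRing

section DlogUnit

variable {p : ℕ} [Fact p.Prime] {A : Type u} [CommRing A] [IsFermatRing p A]
  (E : WittComplex.{v} p A) (n : ℕ)

/-- The logarithmic differential `[u]⁻¹ d[u]` of a unit `u`. -/
def dlogUnit (u : Aˣ) : E.obj n :=
  E.ofGhost n (teich p A n ↑u⁻¹) * E.d n (E.ofGhost n (teich p A n u))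

variable {n}

theorem R_teich (a : A) :
    E.R n (E.ofGhost (n + 1) (teich p A (n + 1) a)) = E.ofGhost n (teich p A n a) :=
  E.R_ofGhost n _

theorem teich_inv_mul_teich (u : Aˣ) :
    E.ofGhost n (teich p A n ↑u⁻¹) * E.ofGhost n (teich p A n u) = 1 := by
  rw [← map_mul, ← map_mul, u.inv_mul, map_one, map_one]

theorem eq_dlogUnit {u : Aˣ} {x : E.obj n}
    (h : E.ofGhost n (teich p A n u) * x = E.d n (E.ofGhost n (teich p A n u))) :
    x = E.dlogUnit n u := by
  rw [dlogUnit, ← h, ← mul_assoc, teich_inv_mul_teich, one_mul]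

theorem teich_mul_dlogUnit (u : Aˣ) : E.ofGhost n (teich p A n u) * E.dlogUnit n u =
    E.d n (E.ofGhost n (teich p A n u)) := by
  have h := E.teich_inv_mul_teich (n := n) u⁻¹
  rw [inv_inv] at h
  rw [dlogUnit, ← mul_assoc, h, one_mul]

theorem dlogUnit_mem (u : Aˣ) : E.dlogUnit n u ∈ E.gr n 1 :=
  E.mul_mem n 0 1 _ _ (E.ofGhost_mem n _) (E.d_mem n 0 _ (E.ofGhost_mem n _))

theorem teich_mul_add {a b : A} {x y : E.obj n}
    (hx : E.ofGhost n (teich p A n a) * x = E.d n (E.ofGhost n (teich p A n a)))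
    (hy : E.ofGhost n (teich p A n b) * y = E.d n (E.ofGhost n (teich p A n b))) :
    E.ofGhost n (teich p A n (a * b)) * (x + y) = E.d n (E.ofGhost n (teich p A n (a * b))) := by
  have hmem (a : A) := E.ofGhost_mem n (teich p A n a)
  rw [map_mul, map_mul, d_mul_of_mem_zero (hmem a), ← hy, mul_add, mul_assoc _ _ y,
    mul_comm_of_mem_zero (hmem a) (hmem b), mul_assoc, hx,
    mul_comm_of_mem_zero (hmem b) (E.d_mem n 0 _ (hmem a))]

theorem dlogUnit_mul (u w : Aˣ) : E.dlogUnit n (u * w) = E.dlogUnit n u + E.dlogUnit n w := by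
  refine (E.eq_dlogUnit ?_).symm
  rw [Units.val_mul]
  exact E.teich_mul_add (E.teich_mul_dlogUnit u) (E.teich_mul_dlogUnit w)

variable (n) in
/-- The logarithmic differential of units as a homomorphism. -/
def dlogUnitHom : Aˣ →* Multiplicative (E.obj n) :=
  .mk' (fun u => .ofAdd (E.dlogUnit n u)) fun u w =>
    congrArg Multiplicative.ofAdd (E.dlogUnit_mul u w)

theorem R_dlogUnit (u : Aˣ) : E.R n (E.dlogUnit (n + 1) u) = E.dlogUnit n u := by
  rw [dlogUnit, map_mul, R_teich, E.R_d, R_teich, dlogUnit]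

theorem F_dlogUnit (u : Aˣ) : E.F n (E.dlogUnit (n + 1) u) = E.dlogUnit n u := by
  have hF : E.F n (E.ofGhost (n + 1) (teich p A (n + 1) ↑u⁻¹)) =
      E.ofGhost n (teich p A n ↑u⁻¹) * E.ofGhost n (teich p A n ↑u⁻¹) ^ (p - 1) := by
    rw [F_ofGhost, ← pow_succ', Nat.sub_add_cancel (Fact.out : p.Prime).one_le, ← map_pow]
    exact congrArg _ (GhostRing.ext fun j => by
      rw [frob_val, ← map_pow, teich_val, teich_val, Fin.val_succ, pow_succ', pow_mul])
  have hd := E.F_d_teichmuller n (u : A)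
  rw [← ofGhost_teich, ← ofGhost_teich] at hd
  have hcomm : Commute (E.ofGhost n (teich p A n ↑u⁻¹)) (E.ofGhost n (teich p A n u)) :=
    mul_comm_of_mem_zero (E.ofGhost_mem n _) (E.ofGhost_mem n _)
  rw [dlogUnit, map_mul, hF, hd, mul_assoc, ← mul_assoc (_ ^ _), ← hcomm.mul_pow,
    teich_inv_mul_teich, one_pow, one_mul, dlogUnit]

theorem d_dlogUnit [Algebra.FormallyUnramified ℤ A] (u : Aˣ) : E.d n (E.dlogUnit n u) = 0 := by
  rw [dlogUnit, d_mul_of_mem_zero (E.ofGhost_mem n _), E.d_d, mul_zero, add_zero, d_ofGhost,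
    d_ofGhost, oneForm_mul_oneForm]

theorem Hom.map_dlogUnit {D : WittComplex.{v} p A} (f : Hom D E) (u : Aˣ) :
    f.map n (D.dlogUnit n u) = E.dlogUnit n u := by
  rw [dlogUnit, map_mul, f.map_d, f.map_ofGhost, f.map_ofGhost, dlogUnit]

end DlogUnit

section PrimeDlog

variable {p : ℕ} [Fact p.Prime]

/-- A compatible system of logarithmic differentials of `p`. As a monoid `ℚ^* ∩ ℤ_(p)` is generated
by `p` and by units, this is what a Witt complex over `ℤ_(p)` needs to become a Witt complex over
the log ring, see `PrimeDlog.toLog`. -/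
structure PrimeDlog (E : WittComplex.{v} p (ZLoc p)) where
  /-- the logarithmic differential of level `n` -/
  val : ∀ n, E.obj n
  mem : ∀ n, val n ∈ E.gr n 1
  teich_mul : ∀ n, E.ofGhost n (teich p _ n p) * val n = E.d n (E.ofGhost n (teich p _ n p))
  R_val : ∀ n, E.R n (val (n + 1)) = val n
  F_val : ∀ n, E.F n (val (n + 1)) = val n
  d_val : ∀ n, E.d n (val n) = 0

namespace PrimeDlog

variable {E : WittComplex.{v} p (ZLoc p)} (y : E.PrimeDlog) (n : ℕ)

/-- The logarithmic derivation with the given values at `p`. -/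
def dlog : ZLocMonoid p →* Multiplicative (E.obj n) :=
  ((powersHom _ (.ofAdd (y.val n))).coprod <|
    (E.dlogUnitHom n).comp (Units.map (canonicalLog p))).comp
      (ZLoc.powMulUnitEquiv p).symm.toMonoidHom

variable {n}

theorem toAdd_dlog_mul (a b : ZLocMonoid p) :
    (y.dlog n (a * b)).toAdd = (y.dlog n a).toAdd + (y.dlog n b).toAdd :=
  congrArg Multiplicative.toAdd (map_mul (y.dlog n) a b)

theorem toAdd_dlog_pMon : (y.dlog n (ZLoc.pMon p)).toAdd = y.val n := by
  have h : (ZLoc.powMulUnitEquiv p).symm (ZLoc.pMon p) = (.ofAdd 1, 1) :=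
    (MulEquiv.symm_apply_eq _).2 ((pow_one _).symm.trans (mul_one _).symm)
  rw [dlog, MonoidHom.comp_apply, MulEquiv.toMonoidHom_eq_coe, MonoidHom.coe_coe, h,
    MonoidHom.coprod_apply, MonoidHom.map_one, mul_one]
  exact one_nsmul _

theorem toAdd_dlog_unit (u : (ZLocMonoid p)ˣ) :
    (y.dlog n u).toAdd = E.dlogUnit n (Units.map (canonicalLog p) u) := by
  have h : (ZLoc.powMulUnitEquiv p).symm u = (1, u) :=
    (MulEquiv.symm_apply_eq _).2 (one_mul _).symm
  rw [dlog, MonoidHom.comp_apply, MulEquiv.toMonoidHom_eq_coe, MonoidHom.coe_coe, h,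
    MonoidHom.coprod_apply, MonoidHom.map_one, one_mul]
  rfl

theorem toAdd_dlog_mem (a : ZLocMonoid p) : (y.dlog n a).toAdd ∈ E.gr n 1 := by
  induction a using ZLoc.monoid_induction with
  | prime => exact y.toAdd_dlog_pMon.symm ▸ y.mem n
  | unit u => exact (y.toAdd_dlog_unit u).symm ▸ E.dlogUnit_mem _
  | mul a b ha hb => exact (y.toAdd_dlog_mul a b).symm ▸ add_mem ha hb

theorem teich_mul_dlog (a : ZLocMonoid p) :
    E.ofGhost n (teich p _ n a) * (y.dlog n a).toAdd = E.d n (E.ofGhost n (teich p _ n a)) := by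
  induction a using ZLoc.monoid_induction with
  | prime => exact y.toAdd_dlog_pMon.symm ▸ y.teich_mul n
  | unit u =>
    rw [toAdd_dlog_unit]
    exact E.teich_mul_dlogUnit (Units.map (canonicalLog p) u)
  | mul a b ha hb =>
    rw [toAdd_dlog_mul, Submonoid.coe_mul]
    exact E.teich_mul_add ha hb

theorem R_dlog (a : ZLocMonoid p) :
    E.R n (y.dlog (n + 1) a).toAdd = (y.dlog n a).toAdd := by
  induction a using ZLoc.monoid_induction with
  | prime => rw [toAdd_dlog_pMon, toAdd_dlog_pMon, R_val]
  | unit u => rw [toAdd_dlog_unit, toAdd_dlog_unit, R_dlogUnit]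
  | mul a b ha hb => rw [toAdd_dlog_mul, toAdd_dlog_mul, map_add, ha, hb]

theorem F_dlog (a : ZLocMonoid p) :
    E.F n (y.dlog (n + 1) a).toAdd = (y.dlog n a).toAdd := by
  induction a using ZLoc.monoid_induction with
  | prime => rw [toAdd_dlog_pMon, toAdd_dlog_pMon, F_val]
  | unit u => rw [toAdd_dlog_unit, toAdd_dlog_unit, F_dlogUnit]
  | mul a b ha hb => rw [toAdd_dlog_mul, toAdd_dlog_mul, map_add, ha, hb]

theorem d_dlog (a : ZLocMonoid p) : E.d n (y.dlog n a).toAdd = 0 := by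
  induction a using ZLoc.monoid_induction with
  | prime => rw [toAdd_dlog_pMon, d_val]
  | unit u => rw [toAdd_dlog_unit, d_dlogUnit]
  | mul a b ha hb => rw [toAdd_dlog_mul, map_add, ha, hb, add_zero]

/-- The Witt complex over the log ring `(ℤ_(p), ℚ^* ∩ ℤ_(p))`. -/
def toLog : LogWittComplex.{v} p (canonicalLog p) where
  toWittComplex := E
  mon := ULift.{v} (ZLocMonoid p)
  pre n :=
    { toFun a := E.ofGhost n (teich p _ n (a.down : ZLoc p))
      map_one' := (congrArg _ (map_one _)).trans (map_one _)
      map_mul' a b := (congrArg _ (map_mul _ (a.down : ZLoc p) b.down)).trans (map_mul _ _ _) }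
  pre_mem n _ := E.ofGhost_mem n _
  R_pre n a := E.R_teich (n := n) (a.down : ZLoc p)
  lamMon := MulEquiv.ulift.symm.toMonoidHom
  pre_lamMon n a := by
    change E.ofGhost n (teich p (ZLoc p) n a) = _
    exact E.ofGhost_teich n _
  dlog n a := (y.dlog n a.down).toAdd
  dlog_mem _ a := y.toAdd_dlog_mem a.down
  dlog_one n := congrArg Multiplicative.toAdd (map_one (y.dlog n))
  dlog_mul _ a b := y.toAdd_dlog_mul a.down b.down
  pre_mul_dlog _ a := y.teich_mul_dlog a.down
  R_dlog _ a := y.R_dlog a.down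
  d_dlog _ a := y.d_dlog a.down
  F_dlog _ a := y.F_dlog a

end PrimeDlog

end PrimeDlog

end WittComplex

namespace FormRing

open GhostRing

variable {p : ℕ} [Fact p.Prime] {A : Type u} [CommRing A] {n : ℕ} (hp : p ≠ 2)

omit [Fact p.Prime] in
theorem logForm_zero_one : logForm p A n (0, 1) = 1 :=
  congrArg mk <| Prod.ext
    (funext fun _ => (congrArg (1 - ·) (mul_zero (p : A))).trans (sub_zero 1)) rfl

theorem scalar_const_mul_logForm (c : A) (x : (Fin n → A) × A) :
    scalar hp n (const p A n c) * logForm p A n x = logForm p A n (c • x) := by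
  refine mk_eq_mk_iff.2 ⟨fun j => ?_, ?_⟩
  · have htwist : twist (const p A n c) j = c := by
      change c - _ * (c - c) = c
      rw [sub_self, mul_zero, sub_zero]
    change _ ∣ twist (const p A n c) j * (x.2 - p * x.1 j) - (c * x.2 - p * (c * x.1 j))
    rw [htwist, mul_sub, mul_left_comm, sub_self]
    exact dvd_zero _
  · cases n with
    | zero => exact (pow_zero (p : A)).symm ▸ one_dvd _
    | succ n => exact (sub_self (c * x.2)).symm ▸ dvd_zero _

end FormRing

namespace logModule

open GhostRing FormRing WittModule WittModule.SqZero WittComplex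

variable {p : ℕ} [Fact p.Prime] {A : Type u} [CommRing A] [IsFermatRing p A] (hp : p ≠ 2)

/-- The form `dlog [p]` in the Witt complex of logarithmic forms. -/
def primeForm (n : ℕ) : (logModule A hp).toWittComplex.{v, u}.obj n :=
  ofDegreeOne _ n (form hp n (0, 1))

theorem scalar_mul_primeForm (n : ℕ) (c : A) :
    (logModule A hp).toWittComplex.{v, u}.scalar n c * primeForm hp n =
      ofDegreeOne _ n (form hp n (0, c)) := by
  have hsmul : const p A n c • form hp n (0, 1) = form hp n (0, c) := Subtype.ext <|
    (scalar_const_mul_logForm hp c _).trans <|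
      congrArg _ (Prod.ext (smul_zero c) (mul_one c))
  rw [← hsmul, ← ofGhost_const, ofGhost_toWittComplex]
  exact ofFst_mul_ofSnd _ _

theorem teich_prime_mul_primeForm (n : ℕ) :
    (logModule A hp).toWittComplex.{v, u}.ofGhost n (teich p A n p) * primeForm hp n =
      (logModule A hp).toWittComplex.d n
        ((logModule A hp).toWittComplex.ofGhost n (teich p A n p)) := by
  have hsmul : teich p A n p • form hp n (0, 1) = (logModule A hp).d n (teich p A n p) :=
    Subtype.ext <| ((congrArg (scalar hp n (teich p A n p) * ·) logForm_zero_one).trans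
      (mul_one _)).trans (scalar_teich_prime hp)
  rw [ofGhost_toWittComplex]
  exact (ofFst_mul_ofSnd _ _).trans (congrArg (ofSnd _ n) hsmul)

theorem ofDegreeOne_form [Algebra.FormallyUnramified ℤ A] (n : ℕ) (x : (Fin n → A) × A) :
    ofDegreeOne _ n (form hp n x) = (logModule A hp).toWittComplex.{v, u}.oneForm n x.1 +
      (logModule A hp).toWittComplex.scalar n x.2 * primeForm hp n := by
  have hone := ofDegreeOne_eq_oneForm.{v} (D := logModule A hp)
    (f := (form hp n).comp (AddMonoidHom.inl (Fin n → A) A))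
    (fun s => Subtype.ext (d_eq_logForm s).symm)
    (fun a ha => (form_eq_zero_iff hp n).2 ⟨ha, dvd_zero _⟩) x.1
  rw [scalar_mul_primeForm, ← hone, ← map_add]
  refine congrArg _ ?_
  rw [AddMonoidHom.comp_apply, ← map_add, AddMonoidHom.inl_apply, Prod.mk_add_mk, add_zero,
    zero_add]

end logModule

namespace logModule

open WittModule

variable {p : ℕ} [Fact p.Prime] (hp : p ≠ 2)

/-- The forms `dlog [p]` make the Witt complex of logarithmic forms one over the log ring. -/
def primeDlog : (logModule (ZLoc p) hp).toWittComplex.{v, 0}.PrimeDlog where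
  val := primeForm hp
  mem _ := ⟨_, rfl⟩
  teich_mul := teich_prime_mul_primeForm hp
  R_val _ := SqZero.ext (map_zero _) rfl
  F_val _ := SqZero.ext (map_zero _) rfl
  d_val n := SqZero.ext rfl (map_zero ((logModule (ZLoc p) hp).d n))

/-- The Witt complex of logarithmic forms, over the log ring. -/
def logComplex : LogWittComplex.{v} p (canonicalLog p) := (primeDlog hp).toLog

theorem dlogOf_logComplex (n : ℕ) :
    (logComplex.{v} hp).dlogOf n (ZLoc.pMon p) = primeForm hp n :=
  (primeDlog hp).toAdd_dlog_pMon

theorem ofDegreeOne_form_eq_logForm (n : ℕ) (x : (Fin n → ZLoc p) × ZLoc p) :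
    ofDegreeOne _ n (form hp n x) = (logComplex.{v} hp).logForm (ZLoc.pMon p) n x := by
  rw [LogWittComplex.logForm_apply, dlogOf_logComplex]
  exact ofDegreeOne_form hp n x

/-- The map from the Witt complex of logarithmic forms to a Witt complex over the log ring, in
degree one. -/
def degreeOneMap (E : LogWittComplex.{v} p (canonicalLog p)) :
    DegreeOneMap (logModule (ZLoc p) hp) E.toWittComplex :=
  DegreeOneMap.lift.{v} (form hp) (form_surjective hp) (E.logForm (ZLoc.pMon p))
    (fun n _ h => E.logForm_eq_zero rfl hp ((form_eq_zero_iff hp n).1 h).1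
      ((form_eq_zero_iff hp n).1 h).2)
    (fun _ => E.logForm_mem _) (fun _ => E.logForm_mul_logForm rfl hp) (fun _ => E.d_logForm _)
    (fun n s => ⟨_, ((logComplex hp).d_ofGhost_eq_logForm _ s).trans
      (ofDegreeOne_form_eq_logForm hp n _).symm, E.d_ofGhost_eq_logForm _ s⟩)
    (fun n s x => (LogWittComplex.exists_ofGhost_mul_logForm rfl hp s x).imp fun y hy =>
      ⟨(congrArg (_ * ·) (ofDegreeOne_form_eq_logForm hp n x)).trans <|
        (hy (logComplex hp)).trans (ofDegreeOne_form_eq_logForm hp n y).symm, hy E⟩)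
    (fun n x => ⟨_, (congrArg _ (ofDegreeOne_form_eq_logForm hp _ x)).trans <|
      ((logComplex hp).R_logForm _ x).trans (ofDegreeOne_form_eq_logForm hp n _).symm,
      E.R_logForm _ x⟩)
    (fun n x => ⟨_, (congrArg _ (ofDegreeOne_form_eq_logForm hp _ x)).trans <|
      ((logComplex hp).F_logForm _ x).trans (ofDegreeOne_form_eq_logForm hp n _).symm,
      E.F_logForm _ x⟩)
    (fun n x => ⟨_, (congrArg _ (ofDegreeOne_form_eq_logForm hp _ x)).trans <|
      ((logComplex hp).V_logForm rfl hp x).trans (ofDegreeOne_form_eq_logForm hp (n + 1) _).symm,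
      E.V_logForm rfl hp x⟩)

theorem degreeOneMap_form (E : LogWittComplex.{v} p (canonicalLog p)) (n : ℕ)
    (x : (Fin n → ZLoc p) × ZLoc p) :
    (degreeOneMap hp E).toFun n (form hp n x) = E.logForm (ZLoc.pMon p) n x := by
  rw [degreeOneMap, DegreeOneMap.lift_apply]

end logModule

namespace LogWittComplex

variable {p : ℕ} [Fact p.Prime] (E : LogWittComplex.{v} p (canonicalLog p))

theorem dlogOf_mul (n : ℕ) (a b : ZLocMonoid p) :
    E.dlogOf n (a * b) = E.dlogOf n a + E.dlogOf n b := by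
  rw [dlogOf, map_mul, dlog_mul]
  rfl

theorem dlogOf_unit (n : ℕ) (u : (ZLocMonoid p)ˣ) :
    E.dlogOf n u = E.dlogUnit n (Units.map (canonicalLog p) u) :=
  E.eq_dlogUnit (E.teich_mul_dlogOf n (u : ZLocMonoid p))

end LogWittComplex

namespace WittComplex.PrimeDlog

variable {p : ℕ} [Fact p.Prime] {D : WittComplex.{v} p (ZLoc p)} (y : D.PrimeDlog)
  {E : LogWittComplex.{v} p (canonicalLog p)} (f : WittComplex.Hom D E.toWittComplex)

theorem map_dlog (hf : ∀ n, f.map n (y.val n) = E.dlogOf n (ZLoc.pMon p)) (n : ℕ)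
    (a : ZLocMonoid p) : f.map n (y.dlog n a).toAdd = E.dlogOf n a := by
  induction a using ZLoc.monoid_induction with
  | prime => rw [toAdd_dlog_pMon, hf]
  | unit u => rw [toAdd_dlog_unit, f.map_dlogUnit, E.dlogOf_unit]
  | mul a b ha hb => rw [toAdd_dlog_mul, map_add, ha, hb, E.dlogOf_mul]

/-- A map of Witt complexes preserving the logarithmic differential of `p`, as a map of Witt
complexes over the log ring. -/
def homOfToLog (hf : ∀ n, f.map n (y.val n) = E.dlogOf n (ZLoc.pMon p)) :
    LogWittComplex.Hom y.toLog E where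
  toHom := f
  mapMon := E.lamMon.comp (MulEquiv.ulift : ULift.{v} (ZLocMonoid p) ≃* ZLocMonoid p).toMonoidHom
  mapMon_lamMon _ := rfl
  map_pre n a := by
    refine (f.map_ofGhost n _).trans ((E.ofGhost_teich n _).trans ?_)
    exact (E.pre_lamMon n a.down).symm
  map_dlog n a := y.map_dlog f hf n a.down

theorem hom_ext {g h : LogWittComplex.Hom y.toLog E} (H : g.toHom = h.toHom) : g = h := by
  refine LogWittComplex.Hom.ext (congrArg (·.map) H) (MonoidHom.ext fun a => ?_)
  exact (g.mapMon_lamMon a.down).trans (h.mapMon_lamMon a.down).symm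

end WittComplex.PrimeDlog

theorem LogWittComplex.Hom.map_logForm {p : ℕ} [Fact p.Prime] {A : Type u} [CommRing A]
    [IsFermatRing p A] {M : Type w} [CommMonoid M] {α : M →* A} {D E : LogWittComplex.{v} p α}
    (f : Hom D E) (m : M) (n : ℕ) (x : (Fin n → A) × A) :
    f.map n (D.logForm m n x) = E.logForm m n x := by
  rw [logForm_apply, logForm_apply, map_add, map_mul, f.map_oneForm, f.map_scalar, dlogOf,
    f.map_dlog, f.mapMon_lamMon, dlogOf]

namespace logModule

open WittModule

variable {p : ℕ} [Fact p.Prime] (hp : p ≠ 2)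

theorem hom_degreeOneMap_primeForm (E : LogWittComplex.{v} p (canonicalLog p)) (n : ℕ) :
    (degreeOneMap hp E).hom.map n (primeForm hp n) = E.dlogOf n (ZLoc.pMon p) := by
  rw [primeForm, DegreeOneMap.hom_ofDegreeOne, degreeOneMap_form, LogWittComplex.logForm_apply,
    map_zero, map_one, one_mul, zero_add]

/-- The Witt complex of logarithmic forms is the de Rham-Witt complex of the log ring. -/
def isInitial : IsInitial (logComplex.{v} hp) :=
  IsInitial.ofUniqueHom
    (fun E => (primeDlog hp).homOfToLog (degreeOneMap hp E).hom (hom_degreeOneMap_primeForm hp E))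
    fun E f => (primeDlog hp).hom_ext <| WittModule.hom_ext fun n m => by
      obtain ⟨x, rfl⟩ := form_surjective hp n m
      rw [ofDegreeOne_form_eq_logForm]
      exact (LogWittComplex.Hom.map_logForm f _ n x).trans
        (LogWittComplex.Hom.map_logForm _ _ n x).symm

end logModule

namespace ZLoc

variable {p : ℕ} [Fact p.Prime]

/-- The reduction of `ℤ_(p)` modulo `p ^ k`. -/
def toZModPow (p : ℕ) [Fact p.Prime] (k : ℕ) : ZLoc p →+* ZMod (p ^ k) :=
  IsLocalization.lift (M := (Ideal.span {(p : ℤ)}).primeCompl) (g := Int.castRingHom _) fun m => by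
    obtain ⟨r, s, h⟩ := isCoprime_pow (fun h => m.2 (Ideal.mem_span_singleton.2 h)) k
    refine .of_mul_eq_one (s : ZMod (p ^ k)) ?_
    have h' := congrArg (Int.cast (R := ZMod (p ^ k))) h
    push_cast at h'
    rwa [← Nat.cast_pow, ZMod.natCast_self, mul_zero, zero_add, mul_comm] at h'

theorem toZModPow_surjective (k : ℕ) : Function.Surjective (toZModPow p k) :=
  ZMod.ringHom_surjective _

theorem toZModPow_eq_zero_iff {k : ℕ} {a : ZLoc p} :
    toZModPow p k a = 0 ↔ (p : ZLoc p) ^ k ∣ a := by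
  obtain ⟨c, b, hb⟩ := exists_pow_dvd_sub_intCast k a
  have hp : toZModPow p k ((p : ZLoc p) ^ k) = 0 := by
    rw [map_pow, map_natCast, ← Nat.cast_pow, ZMod.natCast_self]
  obtain rfl : a = c + p ^ k * b := eq_add_of_sub_eq' hb
  rw [map_add, map_mul, hp, zero_mul, add_zero, map_intCast, ZMod.intCast_zmod_eq_zero_iff_dvd,
    dvd_add_left (dvd_mul_right _ b), pow_dvd_intCast_iff, Nat.cast_pow]

/-- The reduction of the `j`-th coordinate modulo `p ^ j`, for `0 < j < n`. -/
def coordToZMod (p : ℕ) [Fact p.Prime] (n : ℕ) :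
    (Fin n → ZLoc p) →+ ((i : Fin (n - 1)) → ZMod (p ^ (i.val + 1))) :=
  AddMonoidHom.mk' (fun a i => toZModPow p (i + 1) (a ⟨i + 1, by lia⟩)) fun _ _ =>
    funext fun _ => map_add _ _ _

theorem coordToZMod_apply {n : ℕ} (a : Fin n → ZLoc p) (i : Fin (n - 1)) :
    coordToZMod p n a i = toZModPow p (i + 1) (a ⟨i + 1, by lia⟩) := rfl

theorem coordToZMod_surjective (n : ℕ) : Function.Surjective (coordToZMod p n) := fun c => by
  choose b hb using fun i => toZModPow_surjective _ (c i)
  cases n with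
  | zero => exact ⟨0, funext fun i => i.elim0⟩
  | succ n => exact ⟨Fin.cons 0 b, funext hb⟩

theorem coordToZMod_eq_zero_iff {n : ℕ} {a : Fin n → ZLoc p} :
    coordToZMod p n a = 0 ↔ ∀ j : Fin n, (p : ZLoc p) ^ (j : ℕ) ∣ a j := by
  refine ⟨fun h => ?_, fun h => funext fun i => toZModPow_eq_zero_iff.2 (h _)⟩
  rintro ⟨_ | j, hj⟩
  · exact (pow_zero (p : ZLoc p)).symm ▸ one_dvd _
  · exact toZModPow_eq_zero_iff.1 (congrFun h ⟨j, by lia⟩)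

theorem coordToZMod_single {n : ℕ} (i : Fin (n - 1)) :
    coordToZMod p n (Pi.single ⟨i + 1, by lia⟩ 1) = Pi.single i 1 := by
  funext k
  rw [coordToZMod_apply]
  rcases eq_or_ne k i with rfl | h
  · rw [Pi.single_eq_same, Pi.single_eq_same, map_one]
  · rw [Pi.single_eq_of_ne h, Pi.single_eq_of_ne, map_zero]
    exact fun h' => h (Fin.ext (Nat.succ_injective (congrArg Fin.val h')))

end ZLoc

namespace WittModule

variable {p : ℕ} [Fact p.Prime] {A : Type u} [CommRing A] [IsFermatRing p A] {W : WittModule p A}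
  {D : WittComplex.{max u v} p A} (g : WittComplex.Hom D W.toWittComplex.{v, u})
  {h : WittComplex.Hom W.toWittComplex D} (hg : ∀ n x, h.map n (g.map n x) = x)

include g hg

theorem bijOn_ofGhost (n : ℕ) : Set.BijOn (D.ofGhost n) Set.univ (D.gr n 0) := by
  refine ⟨fun s _ => D.ofGhost_mem n s, fun s _ t _ hst => ?_, fun x hx => ?_⟩
  · have := congrArg (g.map n) hst
    rw [g.map_ofGhost, g.map_ofGhost, ofGhost_toWittComplex, ofGhost_toWittComplex] at this
    exact congrArg (SqZero.fst W n) this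
  · obtain ⟨s, hs⟩ := g.map_mem n 0 x hx
    refine ⟨s, trivial, ?_⟩
    rw [← h.map_ofGhost, ofGhost_toWittComplex, ← hg n x, ← hs]

theorem exists_map_ofDegreeOne_eq {n : ℕ} {x : D.obj n} (hx : x ∈ D.gr n 1) :
    ∃ m, h.map n (ofDegreeOne W n m) = x := by
  obtain ⟨m, hm⟩ := g.map_mem n 1 x hx
  exact ⟨m, (congrArg (h.map n) hm).trans (hg n x)⟩

theorem gr_eq_bot {n q : ℕ} (hq : 2 ≤ q) : D.gr n q = ⊥ := by
  refine (AddSubgroup.eq_bot_iff_forall _).2 fun x hx => ?_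
  have hgx : g.map n x = 0 :=
    AddSubgroup.mem_bot.1 ((SqZero.gr_of_two_le hq).le (g.map_mem n q x hx))
  rw [← hg n x, hgx, map_zero]

end WittModule

namespace WittComplex

open GhostRing

section DegreeZero

variable {p : ℕ} [Fact p.Prime] {A : Type u} [CommRing A] [IsFermatRing p A]
  {D E : WittComplex.{v} p A} {n : ℕ}

theorem bijOn_lam (hE : Set.BijOn (E.ofGhost n) Set.univ (E.gr n 0)) :
    Set.BijOn (E.lam n) Set.univ (E.gr n 0) :=
  (hE.comp (Set.bijOn_univ.2 (equiv p A n).bijective)).congr fun x _ => E.ofGhost_equiv n x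

theorem Hom.bijOn_gr_zero (f : Hom D E) (hD : Set.BijOn (D.ofGhost n) Set.univ (D.gr n 0))
    (hE : Set.BijOn (E.ofGhost n) Set.univ (E.gr n 0)) :
    Set.BijOn (f.map n) (D.gr n 0) (E.gr n 0) := by
  rw [← hD.image_eq, ← Set.bijOn_comp_iff hD.injOn]
  exact hE.congr fun s _ => (f.map_ofGhost n s).symm

theorem existsUnique_sum_scalar_mul_vOne (hE : Set.BijOn (E.ofGhost n) Set.univ (E.gr n 0))
    {x : E.obj n} (hx : x ∈ E.gr n 0) :
    ∃! c : Fin n → A, x = ∑ i, E.scalar n (c i) * E.vOne n i := by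
  obtain ⟨s, -, rfl⟩ := hE.surjOn hx
  have hsum (c : Fin n → A) : ∑ i, E.scalar n (c i) * E.vOne n i =
      E.ofGhost n (∑ i, const p A n (c i) * GhostRing.vOne p A n i) := by
    simp only [map_sum, map_mul, ofGhost_const, ofGhost_vOne]
  simpa only [hsum, hE.injOn.eq_iff (Set.mem_univ _) (Set.mem_univ _)] using
    existsUnique_sum_const_mul_vOne s

end DegreeZero

end WittComplex

theorem exists_addEquiv_of_surjective {X Y Z : Type*} [AddCommGroup X] [AddCommGroup Y]
    [AddCommGroup Z] {f : X →+ Y} {g : X →+ Z} (hf : Function.Surjective f)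
    (hg : Function.Surjective g) (h : ∀ x, f x = 0 ↔ g x = 0) :
    ∃ e : Y ≃+ Z, ∀ x, e (f x) = g x := by
  let φ := f.liftOfSurjective hf ⟨g, fun x => (h x).1⟩
  have hφ (x : X) : φ (f x) = g x :=
    f.liftOfRightInverse_comp_apply _ (Function.rightInverse_surjInv hf) _ x
  refine ⟨AddEquiv.ofBijective φ ⟨(injective_iff_map_eq_zero φ).2 (hf.forall.2 fun x hx => ?_),
    fun z => ?_⟩, hφ⟩
  · exact (h x).2 (hφ x ▸ hx)
  · obtain ⟨x, rfl⟩ := hg z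
    exact ⟨f x, hφ x⟩

namespace drwModule

open WittModule ZLoc

variable {p : ℕ} [Fact p.Prime] (hp : p ≠ 2)

section Initial

variable {A : Type u} [CommRing A] [IsFermatRing p A] [Algebra.FormallyUnramified ℤ A]
  {D : WittComplex.{max u v} p A} (hD : IsInitial D)

include hp hD

theorem exists_retraction : ∃ (g : WittComplex.Hom D (drwModule A hp).toWittComplex.{v, u})
    (h : WittComplex.Hom (drwModule A hp).toWittComplex D), ∀ n x, h.map n (g.map n x) = x :=
  ⟨hD.to _, (isInitial hp).to D, fun n x =>
    congrArg (fun f : WittComplex.Hom D D => f.map n x)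
      (hD.hom_ext (hD.to _ ≫ (isInitial hp).to D) (𝟙 D))⟩

theorem bijOn_ofGhost (n : ℕ) : Set.BijOn (D.ofGhost n) Set.univ (D.gr n 0) :=
  let ⟨g, _, hg⟩ := exists_retraction.{v, u} hp hD
  WittModule.bijOn_ofGhost g hg n

theorem gr_eq_bot {n q : ℕ} (hq : 2 ≤ q) : D.gr n q = ⊥ :=
  let ⟨g, _, hg⟩ := exists_retraction.{v, u} hp hD
  WittModule.gr_eq_bot g hg hq

theorem oneForm_eq_zero_iff {n : ℕ} {a : Fin n → A} :
    D.oneForm n a = 0 ↔ ∀ j : Fin n, (p : A) ^ (j : ℕ) ∣ a j := by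
  obtain ⟨g, -, -⟩ := exists_retraction.{v, u} hp hD
  refine ⟨fun h => (form_eq_zero_iff hp n).1 ?_, D.oneForm_eq_zero⟩
  have hform : ofDegreeOne.{v, u} (drwModule A hp) n (form hp n a) = 0 := by
    rw [ofDegreeOne_form, ← g.map_oneForm, h, map_zero]
  exact congrArg (SqZero.snd _ n) hform

theorem exists_oneForm_eq {n : ℕ} {x : D.obj n} (hx : x ∈ D.gr n 1) : ∃ a, D.oneForm n a = x := by
  obtain ⟨g, h, hg⟩ := exists_retraction.{v, u} hp hD
  obtain ⟨m, hm⟩ := exists_map_ofDegreeOne_eq g hg hx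
  obtain ⟨a, rfl⟩ := form_surjective hp n m
  rw [ofDegreeOne_form, h.map_oneForm] at hm
  exact ⟨a, hm⟩

end Initial

include hp in
theorem exists_addEquiv_gr_one {D : WittComplex.{v} p (ZLoc p)} (hD : IsInitial D) (n : ℕ) :
    ∃ e : ((i : Fin (n - 1)) → ZMod (p ^ (i.val + 1))) ≃+ D.gr n 1,
      ∀ i, (e (Pi.single i 1) : D.obj n) = D.dvOne n (i.val + 1) := by
  obtain ⟨e, he⟩ := exists_addEquiv_of_surjective (coordToZMod_surjective n)
    (g := (D.oneForm n).codRestrict (D.gr n 1) (D.oneForm_mem n))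
    (fun x => (exists_oneForm_eq hp hD x.2).imp fun _ => Subtype.ext)
    fun a => by
      rw [Subtype.ext_iff]
      exact coordToZMod_eq_zero_iff.trans (oneForm_eq_zero_iff hp hD).symm
  refine ⟨e, fun i => ?_⟩
  rw [← coordToZMod_single, he]
  refine (D.oneForm_single n _ 1).trans ?_
  rw [map_one, one_mul]

end drwModule

namespace logModule

open WittModule ZLoc

variable {p : ℕ} [Fact p.Prime] (hp : p ≠ 2) {E : LogWittComplex.{v} p (canonicalLog p)}
  (hE : IsInitial E)

include hp hE

theorem exists_retraction : ∃ (g : LogWittComplex.Hom E (logComplex hp))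
    (h : LogWittComplex.Hom (logComplex hp) E), ∀ n x, h.map n (g.map n x) = x :=
  ⟨hE.to _, (isInitial hp).to E, fun n x =>
    congrArg (fun f : LogWittComplex.Hom E E => f.map n x)
      (hE.hom_ext (hE.to _ ≫ (isInitial hp).to E) (𝟙 E))⟩

theorem bijOn_ofGhost (n : ℕ) : Set.BijOn (E.ofGhost n) Set.univ (E.gr n 0) :=
  let ⟨g, h, hg⟩ := exists_retraction hp hE
  WittModule.bijOn_ofGhost g.toHom (h := h.toHom) hg n

theorem gr_eq_bot {n q : ℕ} (hq : 2 ≤ q) : E.gr n q = ⊥ :=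
  let ⟨g, h, hg⟩ := exists_retraction hp hE
  WittModule.gr_eq_bot g.toHom (h := h.toHom) hg hq

theorem logForm_eq_zero_iff {n : ℕ} {x : (Fin n → ZLoc p) × ZLoc p} :
    E.logForm (pMon p) n x = 0 ↔
      (∀ j : Fin n, (p : ZLoc p) ^ (j : ℕ) ∣ x.1 j) ∧ (p : ZLoc p) ^ n ∣ x.2 := by
  obtain ⟨g, -, -⟩ := exists_retraction hp hE
  refine ⟨fun h => (form_eq_zero_iff hp n).1 ?_, fun h => E.logForm_eq_zero rfl hp h.1 h.2⟩
  have hform : ofDegreeOne.{v, 0} (logModule (ZLoc p) hp) n (form hp n x) = 0 := by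
    rw [ofDegreeOne_form_eq_logForm, ← g.map_logForm, h]
    exact map_zero (g.map n)
  exact congrArg (SqZero.snd _ n) hform

theorem exists_logForm_eq {n : ℕ} {x : E.obj n} (hx : x ∈ E.gr n 1) :
    ∃ y, E.logForm (pMon p) n y = x := by
  obtain ⟨g, h, hg⟩ := exists_retraction hp hE
  obtain ⟨m, hm⟩ := exists_map_ofDegreeOne_eq g.toHom (h := h.toHom) hg hx
  obtain ⟨y, rfl⟩ := form_surjective hp n m
  rw [ofDegreeOne_form_eq_logForm] at hm
  exact ⟨y, (h.map_logForm _ n y).symm.trans hm⟩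

theorem exists_addEquiv_gr_one {D : WittComplex.{v} p (ZLoc p)} (hD : IsInitial D)
    (f : WittComplex.Hom D E.toWittComplex) (n : ℕ) :
    ∃ e : D.gr n 1 × ZMod (p ^ n) ≃+ E.gr n 1,
      (∀ x, (e (x, 0) : E.obj n) = f.map n x) ∧ (e (0, 1) : E.obj n) = E.dlogP n := by
  let u : (Fin n → ZLoc p) →+ D.gr n 1 := (D.oneForm n).codRestrict _ (D.oneForm_mem n)
  have hu : Function.Surjective u := fun x =>
    (drwModule.exists_oneForm_eq hp hD x.2).imp fun _ => Subtype.ext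
  obtain ⟨e, he⟩ := exists_addEquiv_of_surjective
    (f := u.prodMap (toZModPow p n).toAddMonoidHom)
    (g := (E.logForm (pMon p) n).codRestrict (E.gr n 1) (E.logForm_mem _))
    (hu.prodMap (toZModPow_surjective n))
    (fun x => (exists_logForm_eq hp hE x.2).imp fun _ => Subtype.ext)
    fun x => by
      rw [Subtype.ext_iff]
      exact (Prod.ext_iff.trans (and_congr (Subtype.ext_iff.trans
        (drwModule.oneForm_eq_zero_iff hp hD)) toZModPow_eq_zero_iff)).trans
          (logForm_eq_zero_iff hp hE).symm
  refine ⟨e, fun x => ?_, ?_⟩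
  · obtain ⟨a, rfl⟩ := hu x
    have h : e (u a, toZModPow p n 0) = E.logForm (pMon p) n (a, 0) := congrArg _ (he (a, 0))
    rw [map_zero, E.logForm_inl] at h
    exact h.trans (f.map_oneForm n a).symm
  · have h : e (u 0, toZModPow p n 1) = E.logForm (pMon p) n (0, 1) := congrArg _ (he (0, 1))
    rwa [map_zero, map_one, E.logForm_apply, map_zero, map_one, one_mul, zero_add] at h

end logModule

namespace LogWittComplex

variable {p : ℕ} [Fact p.Prime] {A : Type u} [CommRing A] [IsFermatRing p A]
  [Algebra.FormallyUnramified ℤ A] {M : Type w} [CommMonoid M] {α : M →* A}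
  (E : LogWittComplex.{v} p α) {m : M} (hm : α m = p) (n : ℕ)

include hm

theorem vOne_mul_dlogOf_of_five_le (hp : 5 ≤ p) {i : ℕ} (hi : 1 ≤ i) :
    E.vOne n i * E.dlogOf n m = p ^ i • E.dlogOf n m + p ^ (i - 1) • E.dvOne n i := by
  obtain ⟨i, rfl⟩ := Nat.exists_eq_add_of_le' hi
  rw [vOne_mul_dlogOf E hm (by lia), smul_add, ← mul_smul, ← pow_add,
    E.pow_smul_dvOne_of_le n (show i + 2 ≤ i + (p - 2) by lia), add_zero, Nat.add_sub_cancel]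

theorem V_dlogOf_of_five_le (hp : 5 ≤ p) :
    E.V n (E.dlogOf n m) = p • E.dlogOf (n + 1) m + E.dvOne (n + 1) 1 := by
  rw [V_dlogOf E hm (by lia), E.pow_smul_dvOne_of_le (n + 1) (by lia), add_zero]

theorem vOne_mul_dlogOf_of_eq_three (hp : p = 3) {i : ℕ} (hi : 1 ≤ i) :
    E.vOne n i * E.dlogOf n m =
      3 ^ i • E.dlogOf n m + 3 ^ (i - 1) • E.dvOne n i + 3 ^ i • E.dvOne n (i + 1) := by
  subst hp
  obtain ⟨i, rfl⟩ := Nat.exists_eq_add_of_le' hi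
  rw [vOne_mul_dlogOf E hm (by lia), smul_add, ← mul_smul, ← pow_add, ← add_assoc]
  rfl

theorem V_dlogOf_of_eq_three (hp : p = 3) : E.V n (E.dlogOf n m) =
    3 • E.dlogOf (n + 1) m + E.dvOne (n + 1) 1 + 3 • E.dvOne (n + 1) 2 := by
  subst hp
  rw [V_dlogOf E hm (by lia), ← add_assoc]
  rfl

end LogWittComplex

end

theorem mainTheorem5 (p : ℕ) [Fact p.Prime] (hp : p ≠ 2) :
    -- the de Rham-Witt complexes of `ℤ_(p)` and of `(ℤ_(p), M)` exist
    HasInitial (WittComplex.{v} p (ZLoc p)) ∧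
    HasInitial (LogWittComplex.{v} p (canonicalLog p)) ∧
    -- let `D`, `E` be these complexes and let `f : D ⟶ E` be the canonical map
    ∀ (D : WittComplex.{v} p (ZLoc p)) (hD : IsInitial D)
      (E : LogWittComplex.{v} p (canonicalLog p)) (_ : IsInitial E)
      (f : WittComplex.Hom D E.toWittComplex), f = hD.to E.toWittComplex →
    -- (i) additive structure; degree zero
    (∀ n, Set.BijOn (f.map n) (D.gr n 0) (E.gr n 0) ∧
      Set.BijOn (D.lam n) Set.univ (D.gr n 0) ∧
      Set.BijOn (E.lam n) Set.univ (E.gr n 0) ∧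
      ∃ φ : ZLoc p →+* E.obj n, (∀ a, φ a ∈ E.gr n 0) ∧
        ∀ x ∈ E.gr n 0, ∃! c : Fin n → ZLoc p, x = ∑ i, φ (c i) * E.vOne n i) ∧
    -- degree one
    (∀ n, ∃ e : ((i : Fin (n - 1)) → ZMod (p ^ (i.val + 1))) ≃+ D.gr n 1,
      ∀ i, (e (Pi.single i 1) : D.obj n) = D.dvOne n (i.val + 1)) ∧
    (∀ n, ∃ e : D.gr n 1 × ZMod (p ^ n) ≃+ E.gr n 1,
      (∀ x, (e (x, 0) : E.obj n) = f.map n x) ∧ (e (0, 1) : E.obj n) = E.dlogP n) ∧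
    -- degrees at least two
    (∀ n q, 2 ≤ q → D.gr n q = ⊥ ∧ E.gr n q = ⊥) ∧
    -- (ii) products
    (∀ n i j, i ≤ j → E.vOne n i * E.vOne n j = p ^ i • E.vOne n j) ∧
    (∀ n i j, i < j → E.vOne n i * E.dvOne n j = p ^ i • E.dvOne n j) ∧
    (∀ n i j, j ≤ i → E.vOne n i * E.dvOne n j = 0) ∧
    (p = 3 → ∀ n i, 1 ≤ i → E.vOne n i * E.dlogP n =
      3 ^ i • E.dlogP n + 3 ^ (i - 1) • E.dvOne n i + 3 ^ i • E.dvOne n (i + 1)) ∧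
    (5 ≤ p → ∀ n i, 1 ≤ i → E.vOne n i * E.dlogP n =
      p ^ i • E.dlogP n + p ^ (i - 1) • E.dvOne n i) ∧
    -- (iii) the operators `F` and `V`
    (∀ n i, E.F n (E.vOne (n + 1) (i + 1)) = p • E.vOne n i) ∧
    (∀ n i, E.F n (E.dvOne (n + 1) (i + 1)) = E.dvOne n i) ∧
    (∀ n i, E.V n (E.vOne n i) = E.vOne (n + 1) (i + 1)) ∧
    (∀ n i, E.V n (E.dvOne n i) = p • E.dvOne (n + 1) (i + 1)) ∧
    (∀ n, E.F n (E.dlogP (n + 1)) = E.dlogP n) ∧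
    (p = 3 → ∀ n, E.V n (E.dlogP n) =
      3 • E.dlogP (n + 1) + E.dvOne (n + 1) 1 + 3 • E.dvOne (n + 1) 2) ∧
    (5 ≤ p → ∀ n, E.V n (E.dlogP n) = p • E.dlogP (n + 1) + E.dvOne (n + 1) 1) := by
  refine ⟨(drwModule.isInitial hp).hasInitial, (logModule.isInitial hp).hasInitial, ?_⟩
  intro D hD E hE f _
  have hD₀ := drwModule.bijOn_ofGhost hp hD
  have hE₀ := logModule.bijOn_ofGhost hp hE
  have hpMon : canonicalLog p (ZLoc.pMon p) = p := rfl
  exact ⟨fun n => ⟨f.bijOn_gr_zero (hD₀ n) (hE₀ n), WittComplex.bijOn_lam (hD₀ n),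
      WittComplex.bijOn_lam (hE₀ n), E.scalar n, E.scalar_mem n, fun _ =>
        WittComplex.existsUnique_sum_scalar_mul_vOne (hE₀ n)⟩,
    drwModule.exists_addEquiv_gr_one hp hD, logModule.exists_addEquiv_gr_one hp hE hD f,
    fun _ _ hq => ⟨drwModule.gr_eq_bot hp hD hq, logModule.gr_eq_bot hp hE hq⟩,
    fun n _ _ h => E.vOne_mul_vOne n h, fun n _ _ h => E.vOne_mul_dvOne n h,
    fun n _ _ h => E.vOne_mul_dvOne_of_le n h,
    fun h n _ hi => E.vOne_mul_dlogOf_of_eq_three hpMon n h hi,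
    fun h n _ hi => E.vOne_mul_dlogOf_of_five_le hpMon n h hi,
    E.F_vOne, E.F_dvOne, E.V_vOne, E.V_dvOne, fun n => E.F_dlogOf n _,
    fun h n => E.V_dlogOf_of_eq_three hpMon n h, fun h n => E.V_dlogOf_of_five_le hpMon n h⟩
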